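/- **The reallocation problem.** An instance consists of a set $P$ of $m\ge 1$ products and a set $W$ of $n$ warehouses. Each product $p$ has a size $\mathrm{size}(p)\in\mathbb R_{\ge 0}$, a source $s(p)\in W$, a sink $t(p)\in W$ with $t(p)\neq s(p)$, and a transit time $\tau(p)$, a positive integer. Each warehouse $w$ has a capacity $c(w)$, a carry-out capacity $d^+(w)$ and a carry-in capacity $d^-(w)$, all nonnegative reals. With $P^+(w)=\{p: s(p)=w\}$ and $P^-(w)=\{p: t(p)=w\}$ it is assumed that $\mathrm{size}(p)\le d^+(w)$ for $p\in P^+(w)$, $\mathrm{size}(p)\le d^-(w)$ for $p\in P^-(w)$, $\sum_{p\in P^+(w)}\mathrm{size}(p)\le c(w)$ and $\sum_{p\in P^-(w)}\mathrm{size}(p)\le c(w)$. A schedule $\varphi:P\to\mathbb Z_{\ge 0}$ is feasible if for every time $\theta\in\mathbb Z_{\ge 0}$ and every $w\in W$ $$\sum_{p\in P^+(w):\,\varphi(p)=\theta}\mathrm{size}(p)\le d^+(w),\qquad \sum_{p\in P^-(w):\,\varphi(p)+\tau(p)=\theta}\mathrm{size}(p)\le d^-(w),$$ $$\sum_{p\in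 P^+(w):\,\varphi(p)\ge\theta}\mathrm{size}(p)+\sum_{p\in P^-(w):\,\varphi(p)+\tau(p)\le\theta}\mathrm{size}(p)\le c(w).$$ Its completion time is $\max_{p\in P}(\varphi(p)+\tau(p))$, and it is optimal if it is feasible and has minimum completion time among the feasible schedules. **Theorem.** Consider instances with $\mathrm{size}(p)=k$ and $\tau(p)=\mu$ for all $p\in P$. (1) If $k>0$, then the minimum completion time of a feasible schedule exists and equals $\rho_{\max}+\mu-1$, where $$\rho_{\max}=\max_{w\in W}\max\left\{\left\lceil\frac{|P^+(w)|}{\lfloor d^+(w)/k\rfloor}\right\rceil,\ \left\lceil\frac{|P^-(w)|}{\lfloor d^-(w)/k\rfloor}\right\rceil\right\}\qquad(\text{with } 0/0:=0).$$ (2) There is an algorithm that computes an optimal schedule for every such instance in $O(mn\log(m+1))$ steps (that is, $O(mn\log m)$ steps for $m\ge 2$). The algorithm is one fixed program of a random access machine with $O(\log(m+n))$-bit integer words and exact real numbers (arithmetic operations and comparisons at unit cost, no rounding of reals). -/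

import Mathlib

noncomputable section

namespace Realloc

/-! ### The reallocation problem -/

/-- An instance of the reallocation problem with `m` products (numbered by `Fin m`) and
`n` warehouses (numbered by `Fin n`), in the discrete-time model.  The last four fields are
the standing assumptions on capacities that belong to the definition of the problem. -/
structure Instance (m n : ℕ) where
  /-- size of a product -/
  size : Fin m → ℝ
  /-- warehouse in which a product is initially stored -/
  source : Fin m → Fin n
  /-- warehouse in which a product has to be stored finally -/
  sink : Fin m → Fin n
  /-- transit time of a product -/
  transit : Fin m → ℕ
  /-- capacity of a warehouse -/
  cap : Fin n → ℝ
  /-- carry-out capacity of a warehouse -/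
  carryOut : Fin n → ℝ
  /-- carry-in capacity of a warehouse -/
  carryIn : Fin n → ℝ
  size_nonneg : ∀ p, 0 ≤ size p
  transit_pos : ∀ p, 0 < transit p
  source_ne_sink : ∀ p, source p ≠ sink p
  cap_nonneg : ∀ w, 0 ≤ cap w
  carryOut_nonneg : ∀ w, 0 ≤ carryOut w
  carryIn_nonneg : ∀ w, 0 ≤ carryIn w
  size_le_carryOut : ∀ p, size p ≤ carryOut (source p)
  size_le_carryIn : ∀ p, size p ≤ carryIn (sink p)
  initial_le_cap : ∀ w, ∑ p with source p = w, size p ≤ cap w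
  final_le_cap : ∀ w, ∑ p with sink p = w, size p ≤ cap w

namespace Instance

variable {m n : ℕ}

/-- A schedule `φ` assigns to every product its sending time.  It is feasible if at every time
and every warehouse the carry-out, the carry-in and the warehouse capacity are respected. -/
def Feasible (I : Instance m n) (φ : Fin m → ℕ) : Prop :=
  (∀ (θ : ℕ) (w : Fin n),
    ∑ p with I.source p = w ∧ φ p = θ, I.size p ≤ I.carryOut w) ∧
  (∀ (θ : ℕ) (w : Fin n),
    ∑ p with I.sink p = w ∧ φ p + I.transit p = θ, I.size p ≤ I.carryIn w) ∧
  (∀ (θ : ℕ) (w : Fin n),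
    (∑ p with I.source p = w ∧ θ ≤ φ p, I.size p) +
      (∑ p with I.sink p = w ∧ φ p + I.transit p ≤ θ, I.size p) ≤ I.cap w)

/-- The completion time: the last arrival time of a product. -/
def completionTime (I : Instance m n) (φ : Fin m → ℕ) : ℕ :=
  Finset.univ.sup fun p => φ p + I.transit p

/-- `φ` is a feasible schedule of minimum completion time. -/
def IsOptimal (I : Instance m n) (φ : Fin m → ℕ) : Prop :=
  I.Feasible φ ∧ ∀ ψ : Fin m → ℕ, I.Feasible ψ → I.completionTime φ ≤ I.completionTime ψ

/-- All products have size `k`. -/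
def UniformSize (I : Instance m n) (k : ℝ) : Prop := ∀ p, I.size p = k

/-- All products have transit time `μ`. -/
def UniformTransit (I : Instance m n) (μ : ℕ) : Prop := ∀ p, I.transit p = μ

/-- `ρ(w)` for the instance normalized to unit sizes: when every product has size `k > 0`, at most
`⌊d⁺(w) / k⌋` products can leave `w`, and at most `⌊d⁻(w) / k⌋` can arrive at `w`, at one time.
A quotient `0 / 0` (no product leaves, respectively arrives, at all) counts as `0`. -/
def rho (I : Instance m n) (k : ℝ) (w : Fin n) : ℕ :=
  max
    ⌈((Finset.univ.filter fun p => I.source p = w).card : ℝ) / (⌊I.carryOut w / k⌋₊ : ℝ)⌉₊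
    ⌈((Finset.univ.filter fun p => I.sink p = w).card : ℝ) / (⌊I.carryIn w / k⌋₊ : ℝ)⌉₊

/-- `ρ_max`, the maximum of `ρ(w)` over all warehouses. -/
def rhoMax (I : Instance m n) (k : ℝ) : ℕ := Finset.univ.sup (I.rho k)

end Instance

/-! ### The machine model

A random access machine with machine words (natural numbers) and real numbers, programmed in a
structured language.  Each kind of datum has scalar variables and arrays that are indexed by words;
a program mentions finitely many of them.  Words have `+`, `-` (truncated), `*`, `/` (rounded down),
reals have the exact field operations; reals influence words only through comparisons (there is no
rounding of reals). -/

/-- A memory configuration. -/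
structure Store where
  /-- word variables -/
  var : ℕ → ℕ
  /-- word arrays: `arr a i` is cell `i` of array `a` -/
  arr : ℕ → ℕ → ℕ
  /-- real variables -/
  rvar : ℕ → ℝ
  /-- real arrays -/
  rarr : ℕ → ℕ → ℝ

/-- Word expressions. -/
inductive WordExp where
  | const (c : ℕ)
  | var (x : ℕ)
  | get (a : ℕ) (i : WordExp)
  | add (e f : WordExp)
  | sub (e f : WordExp)
  | mul (e f : WordExp)
  | div (e f : WordExp)

/-- The value of a word expression. -/
def WordExp.eval (σ : Store) : WordExp → ℕ
  | .const c => c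
  | .var x => σ.var x
  | .get a i => σ.arr a (i.eval σ)
  | .add e f => e.eval σ + f.eval σ
  | .sub e f => e.eval σ - f.eval σ
  | .mul e f => e.eval σ * f.eval σ
  | .div e f => e.eval σ / f.eval σ

/-- The cost of evaluating a word expression: the number of its nodes. -/
def WordExp.cost : WordExp → ℕ
  | .const _ => 1
  | .var _ => 1
  | .get _ i => i.cost + 1
  | .add e f => e.cost + f.cost + 1
  | .sub e f => e.cost + f.cost + 1
  | .mul e f => e.cost + f.cost + 1
  | .div e f => e.cost + f.cost + 1

/-- Real expressions; `word e` turns a word into a real number. -/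
inductive RealExp where
  | word (e : WordExp)
  | var (x : ℕ)
  | get (a : ℕ) (i : WordExp)
  | add (e f : RealExp)
  | sub (e f : RealExp)
  | mul (e f : RealExp)
  | div (e f : RealExp)

/-- The value of a real expression. -/
def RealExp.eval (σ : Store) : RealExp → ℝ
  | .word e => (e.eval σ : ℝ)
  | .var x => σ.rvar x
  | .get a i => σ.rarr a (i.eval σ)
  | .add e f => e.eval σ + f.eval σ
  | .sub e f => e.eval σ - f.eval σ
  | .mul e f => e.eval σ * f.eval σ
  | .div e f => e.eval σ / f.eval σ

/-- The cost of evaluating a real expression: the number of its nodes. -/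
def RealExp.cost : RealExp → ℕ
  | .word e => e.cost + 1
  | .var _ => 1
  | .get _ i => i.cost + 1
  | .add e f => e.cost + f.cost + 1
  | .sub e f => e.cost + f.cost + 1
  | .mul e f => e.cost + f.cost + 1
  | .div e f => e.cost + f.cost + 1

/-- Tests: comparisons of words and of reals, and their Boolean combinations. -/
inductive Test where
  | le (e f : WordExp)
  | rle (e f : RealExp)
  | not (b : Test)
  | and (b c : Test)

/-- The truth of a test. -/
def Test.Holds (σ : Store) : Test → Prop
  | .le e f => e.eval σ ≤ f.eval σ
  | .rle e f => e.eval σ ≤ f.eval σ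
  | .not b => ¬ b.Holds σ
  | .and b c => b.Holds σ ∧ c.Holds σ

/-- The cost of a test: the number of its nodes. -/
def Test.cost : Test → ℕ
  | .le e f => e.cost + f.cost + 1
  | .rle e f => e.cost + f.cost + 1
  | .not b => b.cost + 1
  | .and b c => b.cost + c.cost + 1

/-- Programs. -/
inductive Program where
  /-- do nothing -/
  | skip
  /-- `x := e` for a word variable -/
  | set (x : ℕ) (e : WordExp)
  /-- `a[i] := e` for a word array -/
  | put (a : ℕ) (i e : WordExp)
  /-- `x := e` for a real variable -/
  | rset (x : ℕ) (e : RealExp)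
  /-- `a[i] := e` for a real array -/
  | rput (a : ℕ) (i : WordExp) (e : RealExp)
  /-- first `p`, then `q` -/
  | seq (p q : Program)
  /-- `if b then p else q` -/
  | ite (b : Test) (p q : Program)
  /-- `while b do p` -/
  | loop (b : Test) (p : Program)

/-- `Exec B p σ t σ'`: started in `σ`, the program `p` halts in `σ'` after `t` elementary steps, and
each word that it stores is smaller than `B` (so that words have `log₂ B` bits). -/
inductive Exec (B : ℕ) : Program → Store → ℕ → Store → Prop where
  | skip (σ : Store) : Exec B .skip σ 1 σ
  | set (σ : Store) (x : ℕ) (e : WordExp) (h : e.eval σ < B) :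
      Exec B (.set x e) σ (e.cost + 1) { σ with var := Function.update σ.var x (e.eval σ) }
  | put (σ : Store) (a : ℕ) (i e : WordExp) (h : e.eval σ < B) :
      Exec B (.put a i e) σ (i.cost + e.cost + 1)
        { σ with
          arr := Function.update σ.arr a (Function.update (σ.arr a) (i.eval σ) (e.eval σ)) }
  | rset (σ : Store) (x : ℕ) (e : RealExp) :
      Exec B (.rset x e) σ (e.cost + 1) { σ with rvar := Function.update σ.rvar x (e.eval σ) }
  | rput (σ : Store) (a : ℕ) (i : WordExp) (e : RealExp) :
      Exec B (.rput a i e) σ (i.cost + e.cost + 1)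
        { σ with
          rarr := Function.update σ.rarr a (Function.update (σ.rarr a) (i.eval σ) (e.eval σ)) }
  | seq (p q : Program) (σ₁ σ₂ σ₃ : Store) (t u : ℕ)
      (hp : Exec B p σ₁ t σ₂) (hq : Exec B q σ₂ u σ₃) : Exec B (.seq p q) σ₁ (t + u) σ₃
  | iteTrue (b : Test) (p q : Program) (σ σ' : Store) (t : ℕ)
      (hb : b.Holds σ) (hp : Exec B p σ t σ') : Exec B (.ite b p q) σ (b.cost + t) σ'
  | iteFalse (b : Test) (p q : Program) (σ σ' : Store) (t : ℕ)
      (hb : ¬ b.Holds σ) (hq : Exec B q σ t σ') : Exec B (.ite b p q) σ (b.cost + t) σ'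
  | loopFalse (b : Test) (p : Program) (σ : Store) (hb : ¬ b.Holds σ) :
      Exec B (.loop b p) σ b.cost σ
  | loopTrue (b : Test) (p : Program) (σ₁ σ₂ σ₃ : Store) (t u : ℕ)
      (hb : b.Holds σ₁) (hp : Exec B p σ₁ t σ₂) (hl : Exec B (.loop b p) σ₂ u σ₃) :
      Exec B (.loop b p) σ₁ (b.cost + t + u) σ₃

/-- The array with entries `f`, padded by zeros. -/
def toArray {α : Type} [Zero α] {k : ℕ} (f : Fin k → α) (i : ℕ) : α :=
  if h : i < k then f ⟨i, h⟩ else 0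

/-- The initial memory for an instance: the word variables 0 and 1 hold `m` and `n`, the word arrays
0 and 1 the sources and the sinks, the real arrays 0 to 4 the sizes, the transit times, the
warehouse capacities, the carry-out and the carry-in capacities; all else is zero. -/
def Instance.input {m n : ℕ} (I : Instance m n) : Store where
  var := fun
    | 0 => m
    | 1 => n
    | _ => 0
  arr := fun
    | 0 => toArray fun p => (I.source p : ℕ)
    | 1 => toArray fun p => (I.sink p : ℕ)
    | _ => fun _ => 0
  rvar := fun _ => 0
  rarr := fun
    | 0 => toArray I.size
    | 1 => toArray fun p => (I.transit p : ℝ)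
    | 2 => toArray I.cap
    | 3 => toArray I.carryOut
    | 4 => toArray I.carryIn
    | _ => fun _ => 0

/-- The schedule found in the final memory: the sending times are in the word array 2. -/
def output (m : ℕ) (σ : Store) (p : Fin m) : ℕ := σ.arr 2 p

end Realloc

end

/-!
Let all products have size `k > 0` and transit time `μ`, and write `dA w = ⌊d⁺(w) / k⌋`,
`dB w = ⌊d⁻(w) / k⌋`.  A feasible schedule of completion time `T` sends products only in the
`T + 1 - μ` rounds `0, …, T - μ`, at most `dA w` of them leave `w` and at most `dB w` of them are
sent to `w` in one round.  So `ρ_max ≤ T + 1 - μ` (`Instance.rhoMax_add_le`).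

For the upper bound, and for the algorithm, the products have to be distributed to `ρ = ρ_max`
rounds such that each round respects these two bounds, and such that each warehouse either receives
at least as much as it sends in every round, or sends at least as much as it receives in every round.
The second condition makes the number of products at a warehouse monotone in time, so that the
capacity is respected because it is respected by the initial and by the final storage
(`Instance.feasible_of_counts`).

The distribution is found by halving.  At first all products form one group that has the rounds
`0, …, ρ - 1`.  A group of `r` rounds, with `A w` departures and `B w` arrivals at `w`, satisfies
`A w ≤ r * dA w` and `B w ≤ r * dB w`, and the sign of `B w - A w` does not depend on the group
(`IsLabelling`).  To split off `h ≤ r` of its rounds, put the flow `h` on each product, out of a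
maximum of `r`, and consider a network in which each product is an arc from the departures at its
source to the arrivals at its sink; inside a warehouse, one arc carries all arrivals, one all
departures and a third one the difference between them to a node common to all warehouses
(`IsSetup`).  The flow on the internal arcs only matters modulo `r`.  The flow can be rounded to the
values `0` and `r` on all arcs without changing the excess at any node: a fractional flow value is
never alone at its node, because excesses are divisible by `r`, so there is a cycle of fractional
arcs, and pushing flow around it makes one of them integral.  After rounding, the numbers of
departures, of arrivals, and of their difference in the first part differ from `h / r` times the
original numbers by less than `1`.  Since `h * dA w`, `h * dB w` and `0` are integers, this is
enough for both parts to inherit the bounds and the sign (`rounding_le`, `rounding_nonneg`,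
`IsSetup.split`).  After about `log₂ ρ` halvings every group is a single round.

The fractional arcs that have been treated are kept as a forest given by parent pointers.  To insert
another arc, the tree of its tail is rerooted there, and the path from its head to the root is
walked; if it ends in the tail, it closes a cycle, which is cancelled (`IsPushing`).  Thus an arc
costs `O(n)` steps, since a group has `3 * n + 1` nodes.  In the end all arcs are integral, as a
leaf of a nonempty forest would be a node with a single fractional arc (`IsForest.pa_eq_zero`).
Each product creates at most five fractional arcs, and there are `n * ρ ≤ n * m` cells for a
warehouse in a group, so that a halving step costs `O(m * n)` steps; the same holds for the
computation of `ρ`.  The time bounds are proved together with the correctness of the programs, in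
a calculus of weakest preconditions (`WP`).

Products of size `0` are all sent at time `0`, which is optimal as the transit times are equal.
-/

noncomputable section

namespace Realloc

/-! ### Total correctness with running times -/

/-- `σ.setv x v` is `σ` with the word variable `x` changed to `v`. -/
def Store.setv (σ : Store) (x v : ℕ) : Store := { σ with var := Function.update σ.var x v }

/-- `σ.seta a i v` is `σ` with cell `i` of the word array `a` changed to `v`. -/
def Store.seta (σ : Store) (a i v : ℕ) : Store :=
  { σ with arr := Function.update σ.arr a (Function.update (σ.arr a) i v) }

section StoreLemmas
variable (σ : Store) (x v a i y : ℕ)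

@[simp] theorem Store.setv_var : (σ.setv x v).var y = if y = x then v else σ.var y := by
  simp [Store.setv, Function.update_apply]
@[simp] theorem Store.setv_arr : (σ.setv x v).arr = σ.arr := rfl
@[simp] theorem Store.setv_rarr : (σ.setv x v).rarr = σ.rarr := rfl
@[simp] theorem Store.seta_var : (σ.seta a i v).var = σ.var := rfl
@[simp] theorem Store.seta_arr : (σ.seta a i v).arr y =
    if y = a then Function.update (σ.arr a) i v else σ.arr y := by
  simp only [Store.seta, Function.update_apply]

end StoreLemmas

/-- `WP B p σ Q`: started in `σ`, the program `p` halts on words below `B`, and the number of its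
steps and its final memory satisfy `Q`. -/
def WP (B : ℕ) (p : Program) (σ : Store) (Q : ℕ → Store → Prop) : Prop :=
  ∃ t σ', Exec B p σ t σ' ∧ Q t σ'

section Rules
variable {B : ℕ} {σ : Store} {Q : ℕ → Store → Prop}

theorem WP.mono {p : Program} {Q' : ℕ → Store → Prop} (h : WP B p σ Q)
    (hQ : ∀ t σ', Q t σ' → Q' t σ') : WP B p σ Q' := by
  obtain ⟨t, σ', h1, h2⟩ := h
  exact ⟨t, σ', h1, hQ _ _ h2⟩

theorem WP_skip (h : Q 1 σ) : WP B .skip σ Q := ⟨_, _, .skip σ, h⟩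

theorem WP_set {x : ℕ} {e : WordExp} (h : e.eval σ < B)
    (hQ : Q (e.cost + 1) (σ.setv x (e.eval σ))) : WP B (.set x e) σ Q :=
  ⟨_, _, .set σ x e h, hQ⟩

theorem WP_put {a : ℕ} {i e : WordExp} (h : e.eval σ < B)
    (hQ : Q (i.cost + e.cost + 1) (σ.seta a (i.eval σ) (e.eval σ))) : WP B (.put a i e) σ Q :=
  ⟨_, _, .put σ a i e h, hQ⟩

theorem WP_seq {p q : Program}
    (h : WP B p σ fun t σ' => WP B q σ' fun u σ'' => Q (t + u) σ'') : WP B (.seq p q) σ Q := by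
  obtain ⟨t, σ', h1, u, σ'', h2, h3⟩ := h
  exact ⟨_, _, .seq _ _ _ _ _ _ _ h1 h2, h3⟩

theorem WP_ite {b : Test} {p q : Program}
    (hp : b.Holds σ → WP B p σ fun t σ' => Q (b.cost + t) σ')
    (hq : ¬ b.Holds σ → WP B q σ fun t σ' => Q (b.cost + t) σ') : WP B (.ite b p q) σ Q := by
  by_cases hb : b.Holds σ
  · obtain ⟨t, σ', h1, h2⟩ := hp hb
    exact ⟨_, _, .iteTrue _ _ _ _ _ _ hb h1, h2⟩
  · obtain ⟨t, σ', h1, h2⟩ := hq hb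
    exact ⟨_, _, .iteFalse _ _ _ _ _ _ hb h1, h2⟩

end Rules

/-- Whether the program may write to the word variable `x`. -/
def Program.writesVar : Program → ℕ → Bool
  | .set y _, x => x == y
  | .seq p q, x => p.writesVar x || q.writesVar x
  | .ite _ p q, x => p.writesVar x || q.writesVar x
  | .loop _ p, x => p.writesVar x
  | _, _ => false

/-- Whether the program may write to the word array `a`. -/
def Program.writesArr : Program → ℕ → Bool
  | .put b _ _, a => a == b
  | .seq p q, a => p.writesArr a || q.writesArr a
  | .ite _ p q, a => p.writesArr a || q.writesArr a
  | .loop _ p, a => p.writesArr a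
  | _, _ => false

/-- Whether the program may write real numbers. -/
def Program.writesReal : Program → Bool
  | .rset _ _ => true
  | .rput _ _ _ => true
  | .seq p q => p.writesReal || q.writesReal
  | .ite _ p q => p.writesReal || q.writesReal
  | .loop _ p => p.writesReal
  | _ => false

/-- `σ'` agrees with `σ` wherever the program `p` does not write.  Each part is decided by
computation on `p`, so that `rfl` proves that a program leaves a certain variable alone. -/
structure Frame (p : Program) (σ σ' : Store) : Prop where
  var : ∀ x, p.writesVar x = false → σ'.var x = σ.var x
  arr : ∀ a, p.writesArr a = false → σ'.arr a = σ.arr a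
  rarr : p.writesReal = false → σ'.rarr = σ.rarr

theorem Frame.refl (p : Program) (σ : Store) : Frame p σ σ :=
  ⟨fun _ _ => rfl, fun _ _ => rfl, fun _ => rfl⟩

theorem Frame.trans {p : Program} {σ₁ σ₂ σ₃ : Store} (h : Frame p σ₁ σ₂) (h' : Frame p σ₂ σ₃) :
    Frame p σ₁ σ₃ :=
  ⟨fun x hx => (h'.var x hx).trans (h.var x hx), fun x hx => (h'.arr x hx).trans (h.arr x hx),
    fun hx => (h'.rarr hx).trans (h.rarr hx)⟩

theorem Exec.frame {B t : ℕ} {p : Program} {σ σ' : Store} (h : Exec B p σ t σ') :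
    Frame p σ σ' := by
  induction h with
  | skip σ => exact Frame.refl _ _
  | set σ x e h =>
    refine ⟨fun y hy => ?_, fun _ _ => rfl, fun _ => rfl⟩
    have : y ≠ x := by simpa [Program.writesVar] using hy
    simp [Function.update_of_ne this]
  | put σ a i e h =>
    refine ⟨fun _ _ => rfl, fun y hy => ?_, fun _ => rfl⟩
    have : y ≠ a := by simpa [Program.writesArr] using hy
    simp [Function.update_of_ne this]
  | rset σ x e => exact ⟨fun _ _ => rfl, fun _ _ => rfl, fun _ => rfl⟩
  | rput σ a i e =>
    exact ⟨fun _ _ => rfl, fun _ _ => rfl, fun h => by simp [Program.writesReal] at h⟩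
  | seq p q σ₁ σ₂ σ₃ t u hp hq ihp ihq =>
    refine Frame.trans (σ₂ := σ₂) ⟨fun x hx => ihp.var x ?_, fun x hx => ihp.arr x ?_,
      fun hx => ihp.rarr ?_⟩ ⟨fun x hx => ihq.var x ?_, fun x hx => ihq.arr x ?_,
      fun hx => ihq.rarr ?_⟩ <;>
    simp only [Program.writesVar, Program.writesArr, Program.writesReal,
      Bool.or_eq_false_iff] at hx <;> simp [hx]
  | iteTrue b p q σ σ' t hb hp ihp =>
    refine ⟨fun x hx => ihp.var x ?_, fun x hx => ihp.arr x ?_, fun hx => ihp.rarr ?_⟩ <;>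
    simp only [Program.writesVar, Program.writesArr, Program.writesReal,
      Bool.or_eq_false_iff] at hx <;> simp [hx]
  | iteFalse b p q σ σ' t hb hp ihp =>
    refine ⟨fun x hx => ihp.var x ?_, fun x hx => ihp.arr x ?_, fun hx => ihp.rarr ?_⟩ <;>
    simp only [Program.writesVar, Program.writesArr, Program.writesReal,
      Bool.or_eq_false_iff] at hx <;> simp [hx]
  | loopFalse b p σ hb => exact Frame.refl _ _
  | loopTrue b p σ₁ σ₂ σ₃ t u hb hp hl ihp ihl =>
    exact Frame.trans (σ₂ := σ₂) ⟨ihp.var, ihp.arr, ihp.rarr⟩ ihl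

theorem WP.frame {B : ℕ} {p : Program} {σ : Store} {Q : ℕ → Store → Prop} (h : WP B p σ Q) :
    WP B p σ fun t σ' => Frame p σ σ' ∧ Q t σ' := by
  obtain ⟨t, σ', h1, h2⟩ := h
  exact ⟨t, σ', h1, h1.frame, h2⟩

theorem Test.cost_pos (b : Test) : 0 < b.cost := by
  cases b <;> simp [Test.cost]

/-- The loop rule: `Inv` is an invariant, and the potential `V` pays for the steps that are still to
be made (so that it also proves termination). -/
theorem WP_loop {B : ℕ} {b : Test} {p : Program} {σ₀ : Store} (Inv : Store → Prop)
    (V : Store → ℕ) (h₀ : Inv σ₀)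
    (hstep : ∀ σ, Frame p σ₀ σ → Inv σ → b.Holds σ →
      WP B p σ fun t σ' => Inv σ' ∧ V σ' + t + b.cost ≤ V σ) :
    WP B (.loop b p) σ₀ fun t σ' =>
      Frame p σ₀ σ' ∧ Inv σ' ∧ ¬ b.Holds σ' ∧ t ≤ V σ₀ + b.cost := by
  have key : ∀ N σ, V σ ≤ N → Frame p σ₀ σ → Inv σ →
      WP B (.loop b p) σ fun t σ' =>
        Frame p σ₀ σ' ∧ Inv σ' ∧ ¬ b.Holds σ' ∧ t ≤ V σ + b.cost := by
    intro N
    induction N with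
    | zero =>
      intro σ hN hf hi
      by_cases hb : b.Holds σ
      · obtain ⟨t, σ', -, -, h⟩ := hstep σ hf hi hb
        have := b.cost_pos
        omega
      · exact ⟨_, _, .loopFalse _ _ _ hb, hf, hi, hb, by omega⟩
    | succ N ih =>
      intro σ hN hf hi
      by_cases hb : b.Holds σ
      · obtain ⟨t, σ', he, hi', hV⟩ := hstep σ hf hi hb
        have := b.cost_pos
        obtain ⟨u, σ'', he', hf', hi'', hb', hu⟩ := ih σ' (by omega) (hf.trans he.frame) hi'
        exact ⟨_, _, .loopTrue _ _ _ _ _ _ _ hb he he', hf', hi'', hb', by omega⟩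
      · exact ⟨_, _, .loopFalse _ _ _ hb, hf, hi, hb, by omega⟩
  exact key _ σ₀ le_rfl (Frame.refl _ _) h₀

/-- The strict comparison of words. -/
def Test.lt (e f : WordExp) : Test := .not (.le f e)

/-- `for i < N do p`, where `i` is the word variable `i` and `p` does not change `i`. -/
def Program.forLoop (i : ℕ) (N : WordExp) (p : Program) : Program :=
  .seq (.set i (.const 0))
    (.loop (.lt (.var i) N) (.seq p (.set i (.add (.var i) (.const 1)))))

/-- The rule for counting loops whose bound the body does not change: `c k` bounds the steps of the
`k`-th run of the body, which leads from `Inv k` to `Inv (k + 1)`. -/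
theorem WP_forLoop {B : ℕ} {i : ℕ} {N : WordExp} {p : Program} {σ₀ : Store} (M : ℕ)
    (c : ℕ → ℕ) (Inv : ℕ → Store → Prop) (hB : M < B) (hi : p.writesVar i = false)
    (hN : ∀ σ k, Frame (.seq p (.set i (.const 0))) σ₀ σ → Inv k σ → N.eval σ = M)
    (h₀ : Inv 0 (σ₀.setv i 0))
    (hsetv : ∀ k σ v, Inv k σ → Inv k (σ.setv i v))
    (hstep : ∀ k σ, k < M → Frame (.seq p (.set i (.const 0))) σ₀ σ → σ.var i = k → Inv k σ →
      WP B p σ fun t σ' => Inv (k + 1) σ' ∧ t ≤ c k) :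
    WP B (.forLoop i N p) σ₀ fun t σ' =>
      Frame (.seq p (.set i (.const 0))) σ₀ σ' ∧ Inv M σ' ∧
        t ≤ ∑ k ∈ Finset.range M, (c k + N.cost + 7) + N.cost + 5 := by
  have hfr : ∀ σ, Frame (.seq p (.set i (.add (.var i) (.const 1)))) (σ₀.setv i 0) σ →
      Frame (.seq p (.set i (.const 0))) σ₀ σ := by
    intro σ h
    refine ⟨fun x hx => ?_, fun a ha => h.arr a ha, fun hr => h.rarr hr⟩
    rw [h.var x hx]
    have : x ≠ i := by
      rintro rfl
      simp [Program.writesVar] at hx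
    simp [this]
  refine WP_seq (WP_set (by simp [WordExp.eval]; omega) ?_)
  refine (WP_loop (fun σ => ∃ k, σ.var i = k ∧ k ≤ M ∧ Inv k σ)
    (fun σ => ∑ k ∈ Finset.Ico (σ.var i) M, (c k + N.cost + 7)) ?_ ?_).mono ?_
  · exact ⟨0, by simp [WordExp.eval], by omega, h₀⟩
  · rintro σ hf ⟨k, hk, hkM, hI⟩ hb
    have hf' := hfr σ hf
    have hkM' : k < M := by
      simpa [Test.lt, Test.Holds, WordExp.eval, hk, hN σ k hf' hI] using hb
    refine WP_seq ((hstep k σ hkM' hf' hk hI).frame.mono ?_)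
    rintro t σ' ⟨hfp, hI', ht⟩
    have hk' : σ'.var i = k := (hfp.var i hi).trans hk
    refine WP_set (by simp [WordExp.eval, hk']; omega) ⟨⟨k + 1, by simp [WordExp.eval, hk'], hkM',
      hsetv _ _ _ hI'⟩, ?_⟩
    simp only [Store.setv_var, if_true, WordExp.eval, hk', hk, WordExp.cost, Test.cost, Test.lt]
    rw [← Finset.sum_Ioo_add_eq_sum_Ico hkM', ← Finset.Ico_succ_left_eq_Ioo]
    simp only [Order.succ_eq_add_one]
    omega
  · rintro t σ' ⟨hf, ⟨k, hk, hkM, hI⟩, hb, ht⟩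
    have hf' := hfr σ' hf
    have hkM' : k = M := by
      have : ¬ k < M := by
        simpa [Test.lt, Test.Holds, WordExp.eval, hk, hN σ' k hf' hI] using hb
      omega
    subst hkM'
    refine ⟨hf', hI, ?_⟩
    simp only [WordExp.eval, Store.setv_var, if_true, Test.cost, Test.lt, WordExp.cost,
      Finset.range_eq_Ico] at ht ⊢
    omega

/-! ### Rooted forests given by parent pointers -/

/-- In the forest with parent pointers `p`, the path of `k` steps from `x` upwards ends in the
root `z`. -/
inductive Climb (p : ℕ → Option ℕ) : ℕ → ℕ → ℕ → Prop
  | root {z : ℕ} (h : p z = none) : Climb p z 0 z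
  | step {x y k z : ℕ} (h : p x = some y) (hy : Climb p y k z) : Climb p x (k + 1) z

/-- The parent pointers lead every node to a root. -/
def Acyclic (p : ℕ → Option ℕ) : Prop := ∀ x, ∃ k z, Climb p x k z

/-- `Above p x y`: `y` is on the path upwards from `x`. -/
inductive Above (p : ℕ → Option ℕ) : ℕ → ℕ → Prop
  | refl (x : ℕ) : Above p x x
  | step {x y z : ℕ} (h : p x = some y) (hy : Above p y z) : Above p x z

section Forest
variable {p : ℕ → Option ℕ}

theorem Climb.root_eq_none {x k z : ℕ} (h : Climb p x k z) : p z = none := by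
  induction h with
  | root h => exact h
  | step _ _ ih => exact ih

theorem Climb.unique {x k z k' z' : ℕ} (h : Climb p x k z) (h' : Climb p x k' z') :
    k = k' ∧ z = z' := by
  induction h generalizing k' with
  | root h =>
    cases h' with
    | root => exact ⟨rfl, rfl⟩
    | step h1 => rw [h] at h1; cases h1
  | step h hy ih =>
    cases h' with
    | root h1 => rw [h] at h1; cases h1
    | step h1 hy1 =>
      rw [h] at h1
      cases h1
      obtain ⟨rfl, rfl⟩ := ih hy1
      exact ⟨rfl, rfl⟩

theorem Climb.parent {x y k z : ℕ} (h : Climb p x k z) (hp : p x = some y) :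
    ∃ j, k = j + 1 ∧ Climb p y j z := by
  cases h with
  | root h => rw [h] at hp; cases hp
  | step h1 hy => rw [h1] at hp; cases hp; exact ⟨_, rfl, hy⟩

theorem Climb.eq_of_root {x k z : ℕ} (h : Climb p x k z) (hp : p x = none) : k = 0 ∧ z = x := by
  obtain ⟨h1, h2⟩ := h.unique (.root hp)
  exact ⟨h1, h2⟩

/-- Changing the pointer of `y` does not affect the path of a node that is nearer to its root than
`y`, or in another tree. -/
theorem Climb.update {x k z y : ℕ} (c : Option ℕ) (h : Climb p x k z)
    (hy : ∃ k' z', Climb p y k' z' ∧ (k < k' ∨ z ≠ z')) :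
    Climb (Function.update p y c) x k z := by
  obtain ⟨k', z', hy, hne⟩ := hy
  induction h with
  | @root z h =>
    have : z ≠ y := by
      rintro rfl
      obtain ⟨h1, h2⟩ := hy.eq_of_root h
      subst h1; subst h2; simp at hne
    exact .root (by rwa [Function.update_of_ne this])
  | @step x y' k z h hy1 ih =>
    have : x ≠ y := by
      rintro rfl
      obtain ⟨h1, h2⟩ := hy.unique (.step h hy1)
      subst h1; subst h2; simp at hne
    exact .step (by rwa [Function.update_of_ne this]) (ih (by omega))

/-- Making `y` a root splits its tree. -/
theorem Acyclic.cut (h : Acyclic p) (y : ℕ) : Acyclic (Function.update p y none) := by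
  intro x
  obtain ⟨k, z, hx⟩ := h x
  induction hx with
  | @root z hz =>
    refine ⟨0, z, .root ?_⟩
    by_cases hzy : z = y
    · subst hzy; simp
    · rwa [Function.update_of_ne hzy]
  | @step x y' k z h hy1 ih =>
    by_cases hxy : x = y
    · subst hxy; exact ⟨0, x, .root (by simp)⟩
    · obtain ⟨k', z', h'⟩ := ih
      exact ⟨_, _, .step (by rwa [Function.update_of_ne hxy]) h'⟩

/-- A root may be linked below a node of another tree. -/
theorem Acyclic.link (h : Acyclic p) {u v k z : ℕ} (hu : p u = none) (hv : Climb p v k z)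
    (hz : z ≠ u) : Acyclic (Function.update p u (some v)) := by
  have hv' : Climb (Function.update p u (some v)) v k z :=
    hv.update _ ⟨0, u, .root hu, Or.inr hz⟩
  have hu' : Climb (Function.update p u (some v)) u (k + 1) z := .step (by simp) hv'
  intro x
  obtain ⟨k, z, hx⟩ := h x
  induction hx with
  | @root z hz =>
    by_cases hzy : z = u
    · subst hzy; exact ⟨_, _, hu'⟩
    · exact ⟨0, z, .root (by rwa [Function.update_of_ne hzy])⟩
  | @step x y' k z h hy1 ih =>
    have hxy : x ≠ u := by rintro rfl; rw [hu] at h; cases h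
    obtain ⟨k', z', h'⟩ := ih
    exact ⟨_, _, .step (by rwa [Function.update_of_ne hxy]) h'⟩

theorem Above.trans {x y z : ℕ} (h : Above p x y) (h' : Above p y z) : Above p x z := by
  induction h with
  | refl => exact h'
  | step h _ ih => exact .step h (ih h')

theorem Above.climb {x y : ℕ} (h : Above p x y) {k z : ℕ} (hx : Climb p x k z) :
    ∃ j ≤ k, Climb p y j z := by
  induction h generalizing k with
  | refl => exact ⟨k, le_rfl, hx⟩
  | step h _ ih =>
    obtain ⟨j, rfl, hj⟩ := hx.parent h
    obtain ⟨i, hi, hi'⟩ := ih hj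
    exact ⟨i, by omega, hi'⟩

theorem Above.eq_or {x y : ℕ} (h : Above p x y) : x = y ∨ ∃ w, p x = some w ∧ Above p w y := by
  cases h with
  | refl => exact Or.inl rfl
  | step h hy => exact Or.inr ⟨_, h, hy⟩

theorem Above.ne_of_parent (hp : Acyclic p) {x w y : ℕ} (hx : p x = some w) (h : Above p w y) :
    y ≠ x := by
  rintro rfl
  obtain ⟨k, z, hk⟩ := hp y
  obtain ⟨j, rfl, hj⟩ := hk.parent hx
  obtain ⟨i, hi, hi'⟩ := h.climb hj
  have := (hk.unique hi').1
  omega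

/-- Cutting at `y` makes `y` the root of everything from which `y` is reached. -/
theorem Above.climb_cut {x y : ℕ} (h : Above p x y) :
    ∃ k, Climb (Function.update p y none) x k y := by
  induction h with
  | refl x => exact ⟨0, .root (by simp)⟩
  | @step x w y h hy ih =>
    by_cases hxy : x = y
    · subst hxy; exact ⟨0, .root (by simp)⟩
    · obtain ⟨k, hk⟩ := ih
      exact ⟨_, .step (by rwa [Function.update_of_ne hxy]) hk⟩

/-- A path is shorter than the number of nodes available to it, because the nodes of a path differ
in their distances from the root. -/
theorem Climb.lt_card {x k z : ℕ} (h : Climb p x k z) {S : Finset ℕ} (hx : x ∈ S)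
    (hS : ∀ a b, p a = some b → a ∈ S → b ∈ S) : k < S.card := by
  have key : ∀ j ≤ k, ∃ y ∈ S, Climb p y j z := by
    induction h with
    | root h =>
      intro j hj
      obtain rfl : j = 0 := by omega
      exact ⟨_, hx, .root h⟩
    | @step x y k z h hy ih =>
      intro j hj
      rcases Nat.lt_or_ge k j with hlt | hle
      · obtain rfl : j = k + 1 := by omega
        exact ⟨x, hx, .step h hy⟩
      · exact ih (hS _ _ h hx) j hle
  choose! f hf hf' using key
  have := Finset.card_le_card_of_injOn (s := Finset.range (k + 1)) (t := S) f
    (fun j hj => hf j (by simpa [Nat.lt_succ_iff] using hj))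
    (fun i hi j hj hij => by
      have h1 := hf' i (by simpa [Nat.lt_succ_iff] using hi)
      have h2 := hf' j (by simpa [Nat.lt_succ_iff] using hj)
      rw [hij] at h1
      exact (h1.unique h2).1)
  simp at this
  omega

end Forest

/-! ### Forests of arcs in a network -/

/-- The parent of `x` when the cell `pa x` holds `0` for a root, and `e + 1` if `e` is the arc that
connects `x` with its parent.  The arc `e` has the end nodes `T e` and `H e`, so that the end node
other than `x` is `T e + H e - x`. -/
def par (T H pa : ℕ → ℕ) (x : ℕ) : Option ℕ :=
  if pa x = 0 then none else some (T (pa x - 1) + H (pa x - 1) - x)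

/-- The excess of the flow `F` at the node `x`: inflow minus outflow, over the arcs below `M`. -/
def exc (M : ℕ) (T H F : ℕ → ℕ) (x : ℕ) : ℤ :=
  ∑ e ∈ Finset.range M, (F e : ℤ) * ((if H e = x then 1 else 0) - (if T e = x then 1 else 0))

section Network
variable {M : ℕ} {T H F pa : ℕ → ℕ}

theorem par_update_succ (x e : ℕ) :
    par T H (Function.update pa x (e + 1)) =
      Function.update (par T H pa) x (some (T e + H e - x)) := by
  funext y
  by_cases h : y = x
  · subst h; simp [par]
  · simp [par, Function.update_of_ne h]

theorem par_update_zero (x : ℕ) :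
    par T H (Function.update pa x 0) = Function.update (par T H pa) x none := by
  funext y
  by_cases h : y = x
  · subst h; simp [par]
  · simp [par, Function.update_of_ne h]

theorem par_eq_none {x : ℕ} : par T H pa x = none ↔ pa x = 0 := by
  unfold par; split_ifs <;> simp_all

theorem exc_update {e : ℕ} (he : e < M) (v x : ℕ) :
    exc M T H (Function.update F e v) x = exc M T H F x +
      ((v : ℤ) - F e) * ((if H e = x then 1 else 0) - (if T e = x then 1 else 0)) := by
  unfold exc
  rw [← Finset.sum_erase_add _ _ (Finset.mem_range.2 he),
    ← Finset.sum_erase_add (Finset.range M) _ (Finset.mem_range.2 he)]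
  have : ∀ a ∈ (Finset.range M).erase e,
      ((Function.update F e v a : ℕ) : ℤ) *
        ((if H a = x then 1 else 0) - (if T a = x then 1 else 0)) =
      (F a : ℤ) * ((if H a = x then 1 else 0) - (if T a = x then 1 else 0)) := by
    intro a ha
    rw [Function.update_of_ne (Finset.ne_of_mem_erase ha)]
  rw [Finset.sum_congr rfl this]
  simp only [Function.update_self]
  ring

/-- Arcs without flow may be redirected. -/
theorem exc_congr {T' H' F' : ℕ → ℕ} (h : ∀ e < M, F e = F' e ∧ (F e ≠ 0 → T e = T' e ∧ H e = H' e))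
    (x : ℕ) : exc M T H F x = exc M T' H' F' x := by
  refine Finset.sum_congr rfl fun e he => ?_
  obtain ⟨h1, h2⟩ := h e (Finset.mem_range.1 he)
  by_cases h0 : F e = 0
  · rw [← h1, h0]; simp
  · obtain ⟨h3, h4⟩ := h2 h0
    rw [h1, h3, h4]

end Network

/-! ### Cancelling cycles of fractional arcs -/

/-- A network with the arcs `e < M` from `T e` to `H e`.  It consists of separate groups of at most
`L` nodes each; `md` gives the modulus of a node, and `MD e` is the modulus of the end nodes
of `e`.  The size of the groups bounds the length of the paths in a forest. -/
structure IsNetwork (M L : ℕ) (T H MD grp md : ℕ → ℕ) : Prop where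
  tail_ne_head : ∀ e < M, T e ≠ H e
  grp_eq : ∀ e < M, grp (T e) = grp (H e)
  md_tail : ∀ e < M, md (T e) = MD e
  md_head : ∀ e < M, md (H e) = MD e
  card_le : ∀ g, ∃ S : Finset ℕ, S.card ≤ L ∧
    ∀ x e, e < M → (T e = x ∨ H e = x) → grp x = g → x ∈ S

/-- The parent pointers `pa` describe a forest that consists of those arcs of `P` whose flow `F` is
fractional, that is, strictly between `0` and the modulus. -/
structure IsForest (P : ℕ → Prop) (T H MD F pa : ℕ → ℕ) : Prop where
  arc : ∀ x e, pa x = e + 1 → P e ∧ (T e = x ∨ H e = x) ∧ 0 < F e ∧ F e < MD e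
  covers : ∀ e, P e → 0 < F e → F e < MD e → ∃ x, pa x = e + 1
  acyclic : Acyclic (par T H pa)

/-- The distance of `x` from its root, or `0` if the pointers do not lead to a root. -/
def depth (p : ℕ → Option ℕ) (x : ℕ) : ℕ :=
  open Classical in if h : ∃ k z, Climb p x k z then h.choose else 0

theorem Climb.depth_eq {p : ℕ → Option ℕ} {x k z : ℕ} (h : Climb p x k z) : depth p x = k := by
  have h' : ∃ k z, Climb p x k z := ⟨k, z, h⟩
  rw [depth, dif_pos h']
  obtain ⟨z', hz'⟩ := h'.choose_spec
  exact (hz'.unique h).1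

/-- The amount by which the flow on the arc from `x` to its parent can be increased in the direction
of the parent, when `r` is the modulus. -/
def slack (r : ℕ) (T F pa : ℕ → ℕ) (y : ℕ) : ℕ :=
  if T (pa y - 1) = y then r - F (pa y - 1) else F (pa y - 1)

section
variable {P : ℕ → Prop} {M L : ℕ} {T H MD F pa grp md : ℕ → ℕ}

theorem par_eq_some {x e : ℕ} (h : pa x = e + 1) :
    par T H pa x = some (T e + H e - x) := by
  simp [par, h]

theorem exists_arc_of_par {x y : ℕ} (h : par T H pa x = some y) :
    ∃ e, pa x = e + 1 ∧ y = T e + H e - x := by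
  unfold par at h
  split_ifs at h with h0
  refine ⟨pa x - 1, by omega, ?_⟩
  simpa using h.symm

namespace IsForest

variable (hF : IsForest P T H MD F pa)
include hF

theorem injective {x y e : ℕ} (hx : pa x = e + 1) (hy : pa y = e + 1) : x = y := by
  by_contra hne
  obtain ⟨-, hx', -⟩ := hF.arc x e hx
  obtain ⟨-, hy', -⟩ := hF.arc y e hy
  have h1 : par T H pa x = some y := by
    rw [par_eq_some hx]; congr 1; omega
  have h2 : par T H pa y = some x := by
    rw [par_eq_some hy]; congr 1; omega
  exact Above.ne_of_parent hF.acyclic h1 (.step h2 (.refl x)) rfl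

theorem grp_parent (hP : ∀ e, P e → e < M) (hN : IsNetwork M L T H MD grp md) {x y : ℕ}
    (h : par T H pa x = some y) : grp y = grp x ∧ md y = md x := by
  obtain ⟨e, he, rfl⟩ := exists_arc_of_par h
  obtain ⟨h1, h2, -⟩ := hF.arc x e he
  have h3 := hN.grp_eq e (hP e h1)
  have h4 := hN.md_tail e (hP e h1)
  have h5 := hN.md_head e (hP e h1)
  rcases h2 with rfl | rfl
  · rw [Nat.add_sub_cancel_left]; exact ⟨h3.symm, h5.trans h4.symm⟩
  · rw [Nat.add_sub_cancel]; exact ⟨h3, h4.trans h5.symm⟩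

theorem md_above (hP : ∀ e, P e → e < M) (hN : IsNetwork M L T H MD grp md) {x y : ℕ}
    (h : Above (par T H pa) x y) : md y = md x := by
  induction h with
  | refl => rfl
  | step h _ ih => rw [ih, (hF.grp_parent hP hN h).2]

/-- Paths are short, because they stay within a group. -/
theorem climb_lt (hP : ∀ e, P e → e < M) (hN : IsNetwork M L T H MD grp md) {x k z e : ℕ}
    (h : Climb (par T H pa) x k z) (he : e < M) (hx : T e = x ∨ H e = x) : k < L := by
  obtain ⟨S, hS, hS'⟩ := hN.card_le (grp x)
  refine lt_of_lt_of_le (h.lt_card (S := S.filter fun y => grp y = grp x) ?_ ?_)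
    ((Finset.card_filter_le _ _).trans hS)
  · simpa using hS' x e he hx rfl
  · intro a b hab ha
    obtain ⟨e', he', rfl⟩ := exists_arc_of_par hab
    obtain ⟨h1, h2, -⟩ := hF.arc a e' he'
    have h3 := (hF.grp_parent hP hN hab).1
    simp only [Finset.mem_filter] at ha ⊢
    refine ⟨hS' _ e' (hP _ h1) ?_ (h3.trans ha.2), h3.trans ha.2⟩
    omega

/-- Changing the flow on a forest arc to another fractional value. -/
theorem update {x a v : ℕ} (hx : pa x = a + 1) (h0 : 0 < v) (h1 : v < MD a) :
    IsForest P T H MD (Function.update F a v) pa where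
  arc y e hy := by
    obtain ⟨h2, h3, h4, h5⟩ := hF.arc y e hy
    refine ⟨h2, h3, ?_⟩
    by_cases h : e = a
    · subst h; simp [h0, h1]
    · simp [Function.update_of_ne h, h4, h5]
  covers e he := by
    by_cases h : e = a
    · subst h; exact fun _ _ => ⟨x, hx⟩
    · rw [Function.update_of_ne h]; exact hF.covers e he
  acyclic := hF.acyclic

/-- Changing the flow on a forest arc to an integral value and removing the arc. -/
theorem update_cut {x a v : ℕ} (hx : pa x = a + 1) (h0 : v = 0 ∨ MD a ≤ v) :
    IsForest P T H MD (Function.update F a v) (Function.update pa x 0) where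
  arc y e hy := by
    have hyx : y ≠ x := by rintro rfl; simp at hy
    rw [Function.update_of_ne hyx] at hy
    have hea : e ≠ a := by rintro rfl; exact hyx (hF.injective hy hx)
    rw [Function.update_of_ne hea]
    exact hF.arc y e hy
  covers e he := by
    by_cases h : e = a
    · subst h; simp; omega
    · rw [Function.update_of_ne h]
      intro h1 h2
      obtain ⟨y, hy⟩ := hF.covers e he h1 h2
      refine ⟨y, ?_⟩
      rw [Function.update_of_ne, hy]
      rintro rfl
      rw [hx] at hy; omega
  acyclic := by
    rw [par_update_zero]; exact hF.acyclic.cut x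

/-- A forest of all fractional arcs is empty if the excesses vanish modulo the moduli: a deepest
node would be incident to a single fractional arc. -/
theorem pa_eq_zero (hP : ∀ e, P e ↔ e < M) (hN : IsNetwork M L T H MD grp md)
    (hMD : ∀ e < M, F e ≤ MD e)
    (hexc : ∀ x, (md x : ℤ) ∣ exc M T H F x) : ∀ x, pa x = 0 := by
  by_contra! hne
  obtain ⟨x₀, hx₀⟩ := hne
  let S : Finset ℕ := ((Finset.range M).image T ∪ (Finset.range M).image H).filter (pa · ≠ 0)
  have hS : ∀ x, x ∈ S ↔ pa x ≠ 0 := by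
    intro x
    simp only [S, Finset.mem_filter, Finset.mem_union, Finset.mem_image, Finset.mem_range]
    refine ⟨fun h => h.2, fun h => ⟨?_, h⟩⟩
    obtain ⟨e, he⟩ := Nat.exists_eq_succ_of_ne_zero h
    obtain ⟨h1, h2, -⟩ := hF.arc x e he
    rcases h2 with h2 | h2
    · exact Or.inl ⟨e, (hP e).1 h1, h2⟩
    · exact Or.inr ⟨e, (hP e).1 h1, h2⟩
  obtain ⟨x, hxS, hmax⟩ := S.exists_max_image (depth (par T H pa)) ⟨x₀, (hS _).2 hx₀⟩
  obtain ⟨a, ha⟩ := Nat.exists_eq_succ_of_ne_zero ((hS x).1 hxS)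
  obtain ⟨h1, h2, h3, h4⟩ := hF.arc x a ha
  have haM := (hP a).1 h1
  -- the other arcs at `x` are integral
  have hint : ∀ e < M, e ≠ a → (T e = x ∨ H e = x) → F e = 0 ∨ F e = MD e := by
    intro e he hea hx
    by_contra! hcon
    have := hMD e he
    obtain ⟨y, hy⟩ := hF.covers e ((hP e).2 he) (by omega) (by omega)
    obtain ⟨-, hy', -⟩ := hF.arc y e hy
    have hyx : y ≠ x := by
      rintro rfl
      rw [ha] at hy; simp at hy; omega
    have hpar : par T H pa y = some x := by
      rw [par_eq_some hy]; congr 1; omega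
    obtain ⟨k, z, hk⟩ := hF.acyclic x
    have h5 := hmax y ((hS y).2 (by omega))
    rw [hk.depth_eq, (Climb.step hpar hk).depth_eq] at h5
    omega
  have hmd : (md x : ℤ) = MD a := by
    rcases h2 with rfl | rfl
    · rw [hN.md_tail a haM]
    · rw [hN.md_head a haM]
  have hsum := hexc x
  unfold exc at hsum
  rw [← Finset.sum_erase_add _ _ (Finset.mem_range.2 haM)] at hsum
  have hrest : (md x : ℤ) ∣ ∑ e ∈ (Finset.range M).erase a,
      (F e : ℤ) * ((if H e = x then 1 else 0) - (if T e = x then 1 else 0)) := by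
    refine Finset.dvd_sum fun e he => ?_
    have heM := Finset.mem_range.1 (Finset.mem_of_mem_erase he)
    by_cases hx : T e = x ∨ H e = x
    · have : (md x : ℤ) = MD e := by
        rcases hx with rfl | rfl
        · rw [hN.md_tail e heM]
        · rw [hN.md_head e heM]
      rcases hint e heM (Finset.ne_of_mem_erase he) hx with h | h
      · simp [h]
      · rw [h, this]; exact Dvd.intro _ rfl
    · simp only [not_or] at hx; simp [hx.1, hx.2]
  have := (Int.dvd_add_right hrest).1 hsum
  have hne := hN.tail_ne_head a haM
  rw [hmd] at this
  have hdvd : MD a ∣ F a := by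
    rcases h2 with rfl | rfl
    · rw [if_neg (Ne.symm hne), if_pos rfl] at this
      simpa [Int.natCast_dvd_natCast] using this
    · rw [if_neg hne, if_pos rfl] at this
      simpa [Int.natCast_dvd_natCast] using this
  exact absurd (Nat.le_of_dvd h3 hdvd) (by omega)

end IsForest

/-- The state between two steps of making `u` the root of its tree: the tree of `u` has been
turned up to its node `x`, and the arc `d - 1` from `x` to the former parent of `x` is waiting to be
turned, unless `d = 0`. -/
structure IsRerooting (i u : ℕ) (T H MD F pa : ℕ → ℕ) (x d : ℕ) : Prop where
  forest : IsForest (fun e => e < i ∧ e + 1 ≠ d) T H MD F pa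
  root : pa u = 0
  climb : ∃ k, Climb (par T H pa) x k u
  pending : ∀ e, d = e + 1 → e < i ∧ (T e = x ∨ H e = x) ∧ 0 < F e ∧ F e < MD e ∧
    ∃ k z, Climb (par T H pa) (T e + H e - x) k z ∧ z ≠ u

/-- The depth in the second part is the potential that bounds the number of the following steps. -/
theorem IsForest.startReroot {i u : ℕ} (hF : IsForest (fun e => e < i) T H MD F pa) :
    IsRerooting i u T H MD F (Function.update pa u 0) u (pa u) ∧
    (∀ e, pa u = e + 1 → ∀ k z, Climb (par T H pa) u k z →
      depth (par T H (Function.update pa u 0)) (T e + H e - u) + 1 = k) := by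
  have hacy := hF.acyclic.cut u
  have hpend : ∀ e, pa u = e + 1 → ∃ k z, Climb (par T H pa) u (k + 1) z ∧
      Climb (par T H (Function.update pa u 0)) (T e + H e - u) k z ∧ z ≠ u := by
    intro e he
    obtain ⟨k, z, hk⟩ := hF.acyclic u
    obtain ⟨j, rfl, hj⟩ := hk.parent (par_eq_some he)
    refine ⟨j, z, hk, ?_, ?_⟩
    · rw [par_update_zero]
      exact hj.update _ ⟨_, _, hk, Or.inl (by omega)⟩
    · rintro rfl
      have := hk.root_eq_none
      rw [par_eq_some he] at this; cases this
  refine ⟨⟨⟨fun x e hx => ?_, fun e he h0 h1 => ?_, ?_⟩, by simp, ⟨0, .root ?_⟩,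
    fun e he => ?_⟩, ?_⟩
  · have hxu : x ≠ u := by rintro rfl; simp at hx
    rw [Function.update_of_ne hxu] at hx
    obtain ⟨h1, h2, h3⟩ := hF.arc x e hx
    refine ⟨⟨h1, fun h => hxu (hF.injective hx h.symm)⟩, h2, h3⟩
  · obtain ⟨x, hx⟩ := hF.covers e he.1 h0 h1
    refine ⟨x, ?_⟩
    rw [Function.update_of_ne, hx]
    rintro rfl
    exact he.2 hx.symm
  · rw [par_update_zero]; exact hacy
  · rw [par_update_zero]; simp
  · obtain ⟨h1, h2, h3, h4⟩ := hF.arc u e he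
    obtain ⟨k, z, -, h5, h6⟩ := hpend e he
    exact ⟨h1, h2, h3, h4, k, z, h5, h6⟩
  · intro e he k z hk
    obtain ⟨k', z', h5, h6, -⟩ := hpend e he
    rw [h6.depth_eq, (h5.unique hk).1]

/-- One step of the rerooting: the end node other than `x` of the arc `e` becomes a child of `x`,
and the arc to its former parent is the next one that waits. -/
theorem IsRerooting.next {i u x e : ℕ} (h : IsRerooting i u T H MD F pa x (e + 1)) :
    IsRerooting i u T H MD F (Function.update pa (T e + H e - x) (e + 1)) (T e + H e - x)
      (pa (T e + H e - x)) ∧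
    ∀ e', pa (T e + H e - x) = e' + 1 →
      depth (par T H (Function.update pa (T e + H e - x) (e + 1)))
        (T e' + H e' - (T e + H e - x)) + 1 = depth (par T H pa) (T e + H e - x) := by
  obtain ⟨hei, hex, h0, h1, k, z, hk, hz⟩ := h.pending e rfl
  set y := T e + H e - x with hy
  have hyx : T e + H e - y = x := by omega
  obtain ⟨j, hj⟩ := h.climb
  have hu : par T H pa u = none := par_eq_none.2 h.root
  have huy : y ≠ u := by
    intro hyu
    rw [hyu] at hk
    exact hz (hk.eq_of_root hu).2
  have hp : par T H (Function.update pa y (e + 1)) =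
      Function.update (par T H pa) y (some x) := by rw [par_update_succ, hyx]
  have hxu' : Climb (par T H (Function.update pa y (e + 1))) x j u := by
    rw [hp]; exact hj.update _ ⟨_, _, hk, Or.inr (Ne.symm hz)⟩
  have hpend : ∀ e', pa y = e' + 1 → ∃ k, depth (par T H pa) y = k + 1 ∧
      Climb (par T H (Function.update pa y (e + 1))) (T e' + H e' - y) k z := by
    intro e' he'
    obtain ⟨k', rfl, hk'⟩ := hk.parent (par_eq_some he')
    refine ⟨k', hk.depth_eq, ?_⟩
    rw [hp]
    exact hk'.update _ ⟨_, _, hk, Or.inl (by omega)⟩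
  refine ⟨⟨⟨?_, ?_, ?_⟩, ?_, ⟨j + 1, .step ?_ hxu'⟩, ?_⟩, ?_⟩
  · intro w e' hw
    by_cases hwy : w = y
    · subst hwy
      simp only [Function.update_self] at hw
      obtain rfl : e = e' := by omega
      refine ⟨⟨hei, fun hc => ?_⟩, by omega, h0, h1⟩
      exact (h.forest.arc y e hc.symm).1.2 rfl
    · rw [Function.update_of_ne hwy] at hw
      obtain ⟨h2, h3, h4⟩ := h.forest.arc w e' hw
      exact ⟨⟨h2.1, fun hc => hwy (h.forest.injective hw hc.symm)⟩, h3, h4⟩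
  · intro e' he' h2 h3
    by_cases hee : e' = e
    · subst hee; exact ⟨y, by simp⟩
    · obtain ⟨w, hw⟩ := h.forest.covers e' ⟨he'.1, by omega⟩ h2 h3
      refine ⟨w, ?_⟩
      rw [Function.update_of_ne, hw]
      rintro rfl
      exact he'.2 hw.symm
  · rw [hp]
    have hcut := h.forest.acyclic.cut y
    have := hcut.link (u := y) (v := x) (k := j) (z := u) (by simp)
      (hj.update _ ⟨_, _, hk, Or.inr (Ne.symm hz)⟩) (Ne.symm huy)
    simpa using this
  · rw [Function.update_of_ne (Ne.symm huy)]; exact h.root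
  · rw [hp]; simp
  · intro e' he'
    obtain ⟨h2, h3, h4, h5⟩ := h.forest.arc y e' he'
    obtain ⟨k', -, hk'⟩ := hpend e' he'
    exact ⟨h2.1, h3, h4, h5, k', z, hk', hz⟩
  · intro e' he'
    obtain ⟨k', h2, hk'⟩ := hpend e' he'
    rw [hk'.depth_eq, h2]

theorem IsRerooting.isForest {i u x : ℕ} (h : IsRerooting i u T H MD F pa x 0) :
    IsForest (fun e => e < i) T H MD F pa := by
  have h1 := h.forest
  exact ⟨fun x e hx => ⟨(h1.arc x e hx).1.1, (h1.arc x e hx).2⟩,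
    fun e he => h1.covers e ⟨he, by omega⟩, h1.acyclic⟩

/-- The state while the amount `δ` is being pushed around the cycle that consists of the arc `i` and
the path from its head to its tail in the forest `pa₁`: the flow, originally `F₀`, has been
changed on `i` and on the path up to the node `x`, and arcs that became integral have been cut.
The field `cut` says that the head of `i` has already been separated from its tail, unless every
bottleneck of the path is still ahead; so it will be separated, or `i` itself becomes integral. -/
structure IsPushing (M i δ : ℕ) (T H MD F₀ pa₁ F pa : ℕ → ℕ) (x : ℕ) : Prop where
  forest : IsForest (fun e => e < i) T H MD F pa
  todo : ∀ y, Above (par T H pa₁) x y → pa y = pa₁ y ∧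
    ∀ e, pa₁ y = e + 1 → F e = F₀ e
  exc_eq : ∀ y, exc M T H F y = exc M T H F₀ y +
    δ * ((if x = y then 1 else 0) - (if T i = y then 1 else 0))
  le : ∀ e < M, F e ≤ MD e
  integral : ∀ e < M, F₀ e = 0 ∨ F₀ e = MD e → F e = F₀ e
  later : ∀ e, i < e → F e = F₀ e
  arc_eq : F i = F₀ i + δ
  root : pa (T i) = 0
  above : Above (par T H pa₁) (H i) x
  cut : (∃ k z, Climb (par T H pa) (H i) k z ∧ z ≠ T i) ∨
    (Above (par T H pa) (H i) x ∧ ∀ y e, Above (par T H pa₁) (H i) y → pa₁ y = e + 1 →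
      δ = slack (MD i) T F₀ pa₁ y → Above (par T H pa₁) x y)

/-- What is known about the amount `δ` after the walk from `H i` to its root. -/
structure IsBottleneck (i δ : ℕ) (T H MD F pa : ℕ → ℕ) : Prop where
  le_arc : δ ≤ MD i - F i
  le_path : ∀ y e, Above (par T H pa) (H i) y → pa y = e + 1 → δ ≤ slack (MD i) T F pa y
  attained : δ = MD i - F i ∨ ∃ y e, Above (par T H pa) (H i) y ∧ pa y = e + 1 ∧
    δ = slack (MD i) T F pa y

theorem IsPushing.start {i δ : ℕ} (hi : i < M) (hF : IsForest (fun e => e < i) T H MD F pa)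
    (hle : ∀ e < M, F e ≤ MD e) (h0 : 0 < F i) (h1 : F i < MD i) (hu : pa (T i) = 0)
    (hδ : IsBottleneck i δ T H MD F pa) :
    IsPushing M i δ T H MD F pa (Function.update F i (F i + δ)) pa (H i) := by
  have hne : ∀ e, e ≠ i → Function.update F i (F i + δ) e = F e :=
    fun e he => Function.update_of_ne he _ _
  refine ⟨⟨fun x e hx => ?_, fun e he => ?_, hF.acyclic⟩, fun y hy => ⟨rfl, fun e he => ?_⟩,
    fun y => ?_, fun e he => ?_, fun e he h => ?_, fun e he => hne e (by omega),
    by simp, hu, .refl _, Or.inr ⟨.refl _, fun y e hy _ _ => hy⟩⟩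
  · have := hF.arc x e hx
    rwa [hne e (by omega)]
  · rw [hne e (by omega)]; exact hF.covers e he
  · exact hne e (by have := (hF.arc y e he).1; omega)
  · rw [exc_update hi]; push_cast; ring
  · by_cases hei : e = i
    · subst hei; simp; have := hδ.le_arc; omega
    · rw [hne e hei]; exact hle e he
  · exact hne e (by rintro rfl; omega)

/-- One step up the path: the flow on the arc `a` from `x` to its parent becomes `v`. -/
theorem IsPushing.next {i δ x a v : ℕ} {F₀ pa₁ : ℕ → ℕ} (hi : i < M)
    (hN : IsNetwork M L T H MD grp md)
    (hF₁ : IsForest (fun e => e < i) T H MD F₀ pa₁)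
    (hδ : IsBottleneck i δ T H MD F₀ pa₁)
    (hroot : ∃ k, Climb (par T H pa₁) (H i) k (T i))
    (h : IsPushing M i δ T H MD F₀ pa₁ F pa x) (ha : pa x = a + 1)
    (hv : v = if T a = x then F a + δ else F a - δ) :
    v ≤ MD i ∧ MD a = MD i ∧ a < i ∧ (T a = x ∨ H a = x) ∧
    IsPushing M i δ T H MD F₀ pa₁ (Function.update F a v)
      (if v = 0 ∨ MD i ≤ v then Function.update pa x 0 else pa) (T a + H a - x) ∧
    depth (par T H pa₁) (T a + H a - x) + 1 = depth (par T H pa₁) x := by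
  have hP : ∀ e, e < i → e < M := fun e he => by omega
  obtain ⟨hai, hax, ha0, ha1⟩ := h.forest.arc x a ha
  obtain ⟨hpax, hFx⟩ := h.todo x (.refl x)
  have ha₁ : pa₁ x = a + 1 := by rw [← hpax, ha]
  have hFa := hFx a ha₁
  have hmd : MD a = MD i := by
    have h1 := hF₁.md_above hP hN h.above
    rw [hN.md_head i hi] at h1
    rw [← h1]
    rcases hax with rfl | rfl
    · exact (hN.md_tail a (by omega)).symm
    · exact (hN.md_head a (by omega)).symm
  have hsl := hδ.le_path x a h.above ha₁
  rw [slack, ha₁, Nat.add_sub_cancel, ← hFa] at hsl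
  have hneTH := hN.tail_ne_head a (by omega)
  -- the new flow value is within its bounds, and `δ` is the change in the direction of the path
  have hvle : v ≤ MD i := by
    rw [hv]; split_ifs at hsl ⊢ <;> omega
  have hvd : ∀ y, ((v : ℤ) - F a) * ((if H a = y then 1 else 0) - (if T a = y then 1 else 0)) =
      δ * ((if T a + H a - x = y then 1 else 0) - (if x = y then 1 else 0)) := by
    intro y
    by_cases hT : T a = x
    · rw [if_pos hT] at hv
      have : T a + H a - x = H a := by omega
      rw [this, hv, hT]; push_cast; ring
    · rw [if_neg hT] at hv hsl
      have hH : H a = x := by omega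
      have : T a + H a - x = T a := by omega
      rw [this, hv, hH, Nat.cast_sub hsl]; ring
  have hpar : par T H pa₁ x = some (T a + H a - x) := par_eq_some ha₁
  have hpar' : par T H pa x = some (T a + H a - x) := par_eq_some ha
  obtain ⟨j, hj⟩ := hroot
  obtain ⟨k, -, hk⟩ := h.above.climb hj
  obtain ⟨k', rfl, hk'⟩ := hk.parent hpar
  refine ⟨hvle, hmd, hai, hax, ?_, by rw [hk.depth_eq, hk'.depth_eq]⟩
  have hxu : x ≠ T i := by rintro rfl; have := h.root; omega
  have htodo : ∀ y, Above (par T H pa₁) (T a + H a - x) y → y ≠ x := fun y hy =>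
    Above.ne_of_parent hF₁.acyclic hpar hy
  have hpa' : ∀ y, y ≠ x → (if v = 0 ∨ MD i ≤ v then Function.update pa x 0 else pa) y = pa y := by
    intro y hy; split_ifs
    · rw [Function.update_of_ne hy]
    · rfl
  refine ⟨?_, fun y hy => ⟨?_, fun e he => ?_⟩, fun y => ?_, fun e he => ?_, fun e he hint => ?_,
    fun e he => ?_, ?_, ?_, h.above.trans (.step hpar (.refl _)), ?_⟩
  · split_ifs with hc
    · exact h.forest.update_cut ha (by omega)
    · exact h.forest.update ha (by omega) (by omega)
  · rw [hpa' y (htodo y hy)]; exact (h.todo y (.step hpar hy)).1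
  · rw [Function.update_of_ne]
    · exact (h.todo y (.step hpar hy)).2 e he
    · rintro rfl
      exact htodo y hy (hF₁.injective he ha₁)
  · rw [exc_update (by omega), hvd, h.exc_eq]; ring
  · by_cases hea : e = a
    · subst hea; simp; omega
    · rw [Function.update_of_ne hea]; exact h.le e he
  · rw [Function.update_of_ne]
    · exact h.integral e he hint
    · rintro rfl; omega
  · rw [Function.update_of_ne (by omega)]; exact h.later e he
  · rw [Function.update_of_ne (by omega)]; exact h.arc_eq
  · rw [hpa' _ (Ne.symm hxu)]; exact h.root
  · by_cases hc : v = 0 ∨ MD i ≤ v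
    · left
      rw [if_pos hc, par_update_zero]
      rcases h.cut with ⟨j', z, hz, hzu⟩ | ⟨hab, -⟩
      · by_cases hzx : ∃ j'' z', Climb (par T H pa) x j'' z' ∧ z ≠ z'
        · obtain ⟨j'', z', h1, h2⟩ := hzx
          exact ⟨j', z, hz.update _ ⟨j'', z', h1, Or.inr h2⟩, hzu⟩
        · push Not at hzx
          -- the remaining path from `x` to the tail of `i` is still intact
          exfalso
          have hint : ∀ w l z', Climb (par T H pa₁) w l z' → Above (par T H pa₁) x w →
              Climb (par T H pa) w l z' := by
            intro w l z' hw
            induction hw with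
            | @root z' hz' =>
              intro hxw
              refine .root (par_eq_none.2 ?_)
              rw [(h.todo _ hxw).1]; exact par_eq_none.1 hz'
            | @step w w' l z' hw hw' ih =>
              intro hxw
              obtain ⟨e, he, rfl⟩ := exists_arc_of_par hw
              refine .step (par_eq_some ?_) (ih (hxw.trans (.step hw (.refl _))))
              rw [(h.todo _ hxw).1, he]
          exact hzu (hzx _ _ (hint x _ _ hk (.refl x)))
      · obtain ⟨j', hj'⟩ := hab.climb_cut
        exact ⟨j', x, hj', hxu⟩
    · rw [if_neg hc]
      rcases h.cut with h1 | ⟨hab, hcrit⟩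
      · exact Or.inl h1
      · refine Or.inr ⟨hab.trans (.step hpar' (.refl _)), fun y e hy he hd => ?_⟩
        rcases (hcrit y e hy he hd).eq_or with rfl | ⟨w, hw, hw'⟩
        · exfalso
          rw [slack, ha₁, Nat.add_sub_cancel, ← hFa] at hd
          apply hc
          rw [hv]
          split_ifs at hd ⊢ <;> omega
        · rw [hpar] at hw; cases hw; exact hw'

/-- When the push has come round the cycle, the excesses are the original ones, and the arc `i` no
longer closes a cycle if it is still fractional. -/
theorem IsPushing.finish {i δ x : ℕ} {F₀ pa₁ : ℕ → ℕ}
    (hδ : IsBottleneck i δ T H MD F₀ pa₁)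
    (hroot : ∃ k, Climb (par T H pa₁) (H i) k (T i)) (hu : pa₁ (T i) = 0)
    (h : IsPushing M i δ T H MD F₀ pa₁ F pa x) (hx : pa x = 0) :
    (∀ y, exc M T H F y = exc M T H F₀ y) ∧
      (F i < MD i → ∃ k z, Climb (par T H pa) (H i) k z ∧ z ≠ T i) := by
  obtain ⟨j, hj⟩ := hroot
  obtain ⟨k, -, hk⟩ := h.above.climb hj
  have hx₁ : pa₁ x = 0 := by rw [← (h.todo x (.refl x)).1, hx]
  obtain ⟨-, hxu⟩ := hk.eq_of_root (par_eq_none.2 hx₁)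
  subst hxu
  refine ⟨fun y => by rw [h.exc_eq]; ring, fun hlt => ?_⟩
  rcases h.cut with h1 | ⟨-, h2⟩
  · exact h1
  · exfalso
    rcases hδ.attained with h3 | ⟨y, e, hy, he, hd⟩
    · have := h.arc_eq; omega
    · rcases (h2 y e hy he hd).eq_or with rfl | ⟨w, hw, -⟩
      · omega
      · rw [par_eq_none.2 hu] at hw; cases hw

end

/-! ### The program that rounds a flow

The word arrays `3`, `4`, `5`, `6` hold the tail, the head, the flow and the modulus of every arc,
the word array `7` holds the parent pointers.  The word variable `5` is the number of arcs, `6` the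
current arc `i`, `7` its modulus, `14` the amount `δ`, and `12` the current node of a walk; `11`
holds an arc that waits to be turned (plus one), `13` and `15` are auxiliary. -/

/-- Equality of words. -/
def Test.eq (e f : WordExp) : Test := .and (.le e f) (.le f e)

/-- The value of the word variable `x`. -/
abbrev vr (x : ℕ) : WordExp := .var x
/-- The constant `c`. -/
abbrev cn (c : ℕ) : WordExp := .const c
/-- The entry with the index `e` of the word array `a`. -/
abbrev gt (a : ℕ) (e : WordExp) : WordExp := .get a e

/-- The end node other than `x` of the arc `e`. -/
abbrev otherEnd (e x : WordExp) : WordExp := .sub (.add (gt 3 e) (gt 4 e)) x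

/-- One step up in the tree: the arc `d - 1` is turned. -/
def rerootBody : Program :=
  .seq (.set 12 (otherEnd (.sub (vr 11) (cn 1)) (vr 12)))
  (.seq (.set 13 (gt 7 (vr 12)))
  (.seq (.put 7 (vr 12) (vr 11)) (.set 11 (vr 13))))

/-- Make the tail of the arc `i` the root of its tree. -/
def rerootProg : Program :=
  .seq (.set 12 (gt 3 (vr 6)))
  (.seq (.set 11 (gt 7 (vr 12)))
  (.seq (.put 7 (vr 12) (cn 0)) (.loop (.lt (cn 0) (vr 11)) rerootBody)))

/-- One step up in the tree: `δ` becomes the minimum of `δ` and the slack. -/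
def walkBody : Program :=
  .seq (.set 13 (.sub (gt 7 (vr 12)) (cn 1)))
  (.seq (.ite (.eq (gt 3 (vr 13)) (vr 12)) (.set 15 (.sub (vr 7) (gt 5 (vr 13))))
    (.set 15 (gt 5 (vr 13))))
  (.seq (.ite (.lt (vr 15) (vr 14)) (.set 14 (vr 15)) .skip)
    (.set 12 (otherEnd (vr 13) (vr 12)))))

/-- Walk from the head of the arc `i` to the root and compute the bottleneck `δ`. -/
def walkProg : Program :=
  .seq (.set 12 (gt 4 (vr 6)))
  (.seq (.set 14 (.sub (vr 7) (gt 5 (vr 6))))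
    (.loop (.lt (cn 0) (gt 7 (vr 12))) walkBody))

/-- One step up in the tree: push `δ` and cut the arc if its flow became integral. -/
def pushBody : Program :=
  .seq (.set 13 (.sub (gt 7 (vr 12)) (cn 1)))
  (.seq (.ite (.eq (gt 3 (vr 13)) (vr 12)) (.put 5 (vr 13) (.add (gt 5 (vr 13)) (vr 14)))
    (.put 5 (vr 13) (.sub (gt 5 (vr 13)) (vr 14))))
  (.seq (.ite (.and (.lt (cn 0) (gt 5 (vr 13))) (.lt (gt 5 (vr 13)) (vr 7))) .skip
      (.put 7 (vr 12) (cn 0)))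
    (.set 12 (otherEnd (vr 13) (vr 12)))))

/-- Push `δ` around the cycle closed by the arc `i`. -/
def pushProg : Program :=
  .seq (.put 5 (vr 6) (.add (gt 5 (vr 6)) (vr 14)))
  (.seq (.set 12 (gt 4 (vr 6)))
    (.loop (.lt (cn 0) (gt 7 (vr 12))) pushBody))

/-- Insert the fractional arc `i` into the forest: if its end nodes are in one tree, the cycle that
it closes is cancelled first; if it is still fractional then, it links two trees. -/
def insertProg : Program :=
  .seq (.set 7 (gt 6 (vr 6)))
  (.seq rerootProg
  (.seq walkProg
  (.seq (.ite (.eq (vr 12) (gt 3 (vr 6))) pushProg .skip)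
    (.ite (.lt (gt 5 (vr 6)) (vr 7)) (.put 7 (gt 3 (vr 6)) (.add (vr 6) (cn 1))) .skip))))

/-- Round the flow: the fractional arcs are inserted into the forest one by one. -/
def roundProg : Program :=
  .forLoop 6 (vr 5)
    (.ite (.and (.lt (cn 0) (gt 5 (vr 6))) (.lt (gt 5 (vr 6)) (gt 6 (vr 6)))) insertProg .skip)

theorem holds_lt {σ : Store} {e f : WordExp} : (Test.lt e f).Holds σ ↔ e.eval σ < f.eval σ := by
  simp [Test.lt, Test.Holds]

theorem holds_eq {σ : Store} {e f : WordExp} : (Test.eq e f).Holds σ ↔ e.eval σ = f.eval σ := by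
  simp [Test.eq, Test.Holds, le_antisymm_iff]

section
variable {B M L : ℕ} {σ : Store} {grp md : ℕ → ℕ}

theorem WP_rerootProg (hB : M < B) (hTB : ∀ e < M, σ.arr 3 e < B ∧ σ.arr 4 e < B)
    (hN : IsNetwork M L (σ.arr 3) (σ.arr 4) (σ.arr 6) grp md) (hi : σ.var 6 < M)
    (hF : IsForest (fun e => e < σ.var 6) (σ.arr 3) (σ.arr 4) (σ.arr 6) (σ.arr 5) (σ.arr 7)) :
    WP B rerootProg σ fun t σ' =>
      IsForest (fun e => e < σ.var 6) (σ.arr 3) (σ.arr 4) (σ.arr 6) (σ.arr 5) (σ'.arr 7) ∧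
      σ'.arr 7 (σ.arr 3 (σ.var 6)) = 0 ∧ t ≤ 30 * L + 20 := by
  obtain ⟨k, z, hk⟩ := hF.acyclic (σ.arr 3 (σ.var 6))
  have hkL : k < L := hF.climb_lt (fun e he => by omega) hN hk hi (Or.inl rfl)
  have hpaB : σ.arr 7 (σ.arr 3 (σ.var 6)) < B := by
    rcases Nat.eq_zero_or_eq_succ_pred (σ.arr 7 (σ.arr 3 (σ.var 6))) with h | h
    · omega
    · have := (hF.arc _ _ h).1; omega
  have hTi := (hTB _ hi).1
  refine WP_seq (WP_set (by simpa [WordExp.eval] using hTi) ?_)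
  refine WP_seq (WP_set (by simpa [WordExp.eval] using hpaB) ?_)
  refine WP_seq (WP_put (by simp [WordExp.eval]; omega) ?_)
  obtain ⟨hst, hdep⟩ := hF.startReroot (u := σ.arr 3 (σ.var 6))
  refine (WP_loop
    (fun s => IsRerooting (σ.var 6) (σ.arr 3 (σ.var 6)) (σ.arr 3) (σ.arr 4) (σ.arr 6) (σ.arr 5)
      (s.arr 7) (s.var 12) (s.var 11))
    (fun s => if s.var 11 = 0 then 0 else
      30 * (depth (par (σ.arr 3) (σ.arr 4) (s.arr 7))
        (σ.arr 3 (s.var 11 - 1) + σ.arr 4 (s.var 11 - 1) - s.var 12) + 1)) ?_ ?_).mono ?_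
  · simpa [WordExp.eval] using hst
  · intro s hf hI hb
    have h3 : s.arr 3 = σ.arr 3 := by
      rw [hf.arr 3 (by rfl)]; simp
    have h4 : s.arr 4 = σ.arr 4 := by
      rw [hf.arr 4 (by rfl)]; simp
    obtain ⟨e, he⟩ : ∃ e, s.var 11 = e + 1 := by
      simp [holds_lt, WordExp.eval] at hb
      exact ⟨s.var 11 - 1, by omega⟩
    rw [he] at hI
    obtain ⟨hnext, hd⟩ := hI.next
    obtain ⟨hei, hex, -⟩ := hI.pending e rfl
    have hTe := hTB e (by omega)
    set y := σ.arr 3 e + σ.arr 4 e - s.var 12 with hy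
    have hyB : y < B := by omega
    have hcB : s.arr 7 y < B := by
      rcases Nat.eq_zero_or_eq_succ_pred (s.arr 7 y) with h | h
      · omega
      · have := (hI.forest.arc _ _ h).1.1; omega
    refine WP_seq (WP_set (by simpa [WordExp.eval, he, h3, h4] using hyB) ?_)
    refine WP_seq (WP_set (by simpa [WordExp.eval, he, h3, h4] using hcB) ?_)
    refine WP_seq (WP_put (by simp [WordExp.eval, he]; omega) ?_)
    refine WP_set (by simpa [WordExp.eval, he, h3, h4] using hcB) ?_
    constructor
    · simpa [WordExp.eval, he, h3, h4] using hnext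
    · simp only [WordExp.eval, he, h3, h4, Store.setv_var, Store.seta_arr, Store.setv_arr,
        WordExp.cost, Test.cost, Test.lt, Store.seta_var, Nat.add_sub_cancel, ← hy]
      norm_num
      split_ifs with h0
      · omega
      · obtain ⟨e', he'⟩ := Nat.exists_eq_succ_of_ne_zero h0
        have := hd e' he'
        simp only [he', Nat.succ_eq_add_one, Nat.add_sub_cancel]
        omega
  · rintro t s ⟨hf, hI, hb, ht⟩
    have h11 : s.var 11 = 0 := by simpa [holds_lt, WordExp.eval] using hb
    rw [h11] at hI
    refine ⟨hI.isForest, hI.root, ?_⟩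
    simp [WordExp.eval, Test.cost, Test.lt, WordExp.cost] at ht ⊢
    split_ifs at ht with h0
    · omega
    · obtain ⟨e', he'⟩ := Nat.exists_eq_succ_of_ne_zero h0
      have := hdep e' he' k z hk
      simp [he'] at ht
      omega

theorem WP_walkProg (hB : M < B) (hTB : ∀ e < M, σ.arr 3 e < B ∧ σ.arr 4 e < B ∧ σ.arr 6 e < B)
    (hN : IsNetwork M L (σ.arr 3) (σ.arr 4) (σ.arr 6) grp md) (hi : σ.var 6 < M)
    (hF : IsForest (fun e => e < σ.var 6) (σ.arr 3) (σ.arr 4) (σ.arr 6) (σ.arr 5) (σ.arr 7))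
    (hr : σ.var 7 = σ.arr 6 (σ.var 6)) :
    WP B walkProg σ fun t σ' =>
      (∃ k, Climb (par (σ.arr 3) (σ.arr 4) (σ.arr 7)) (σ.arr 4 (σ.var 6)) k (σ'.var 12)) ∧
      IsBottleneck (σ.var 6) (σ'.var 14) (σ.arr 3) (σ.arr 4) (σ.arr 6) (σ.arr 5) (σ.arr 7) ∧
      σ'.var 14 < B ∧ t ≤ 50 * L + 20 := by
  obtain ⟨k, z, hk⟩ := hF.acyclic (σ.arr 4 (σ.var 6))
  have hkL : k < L := hF.climb_lt (fun e he => by omega) hN hk hi (Or.inr rfl)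
  have hTi := hTB _ hi
  refine WP_seq (WP_set (by simpa [WordExp.eval] using hTi.2.1) ?_)
  refine WP_seq (WP_set (by simp [WordExp.eval]; omega) ?_)
  refine (WP_loop
    (fun s => Above (par (σ.arr 3) (σ.arr 4) (σ.arr 7)) (σ.arr 4 (σ.var 6)) (s.var 12) ∧
      s.var 14 ≤ σ.arr 6 (σ.var 6) - σ.arr 5 (σ.var 6) ∧
      (∀ y e, Above (par (σ.arr 3) (σ.arr 4) (σ.arr 7)) (σ.arr 4 (σ.var 6)) y →
        σ.arr 7 y = e + 1 → Above (par (σ.arr 3) (σ.arr 4) (σ.arr 7)) (s.var 12) y ∨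
          s.var 14 ≤ slack (σ.arr 6 (σ.var 6)) (σ.arr 3) (σ.arr 5) (σ.arr 7) y) ∧
      (s.var 14 = σ.arr 6 (σ.var 6) - σ.arr 5 (σ.var 6) ∨ ∃ y e,
        Above (par (σ.arr 3) (σ.arr 4) (σ.arr 7)) (σ.arr 4 (σ.var 6)) y ∧ σ.arr 7 y = e + 1 ∧
        s.var 14 = slack (σ.arr 6 (σ.var 6)) (σ.arr 3) (σ.arr 5) (σ.arr 7) y))
    (fun s => 50 * depth (par (σ.arr 3) (σ.arr 4) (σ.arr 7)) (s.var 12)) ?_ ?_).mono ?_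
  · simp only [WordExp.eval, Store.setv_var, hr]
    exact ⟨.refl _, le_rfl, fun y e hy he => Or.inl hy, Or.inl rfl⟩
  · rintro s hf ⟨hab, hle, hmin, hatt⟩ hb
    have h3 : s.arr 3 = σ.arr 3 := by rw [hf.arr 3 (by rfl)]; simp
    have h4 : s.arr 4 = σ.arr 4 := by rw [hf.arr 4 (by rfl)]; simp
    have h5 : s.arr 5 = σ.arr 5 := by rw [hf.arr 5 (by rfl)]; simp
    have h7 : s.arr 7 = σ.arr 7 := by rw [hf.arr 7 (by rfl)]; simp
    have hv7 : s.var 7 = σ.arr 6 (σ.var 6) := by rw [hf.var 7 (by rfl)]; simp [hr]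
    obtain ⟨a, ha⟩ : ∃ a, σ.arr 7 (s.var 12) = a + 1 := by
      simp [holds_lt, WordExp.eval, h7] at hb
      exact ⟨σ.arr 7 (s.var 12) - 1, by omega⟩
    obtain ⟨hai, hax, ha0, ha1⟩ := hF.arc _ _ ha
    have hTa := hTB a (by omega)
    have hpar := par_eq_some (T := σ.arr 3) (H := σ.arr 4) ha
    obtain ⟨j, -, hj⟩ := hab.climb hk
    obtain ⟨j', rfl, hj'⟩ := hj.parent hpar
    set S := slack (σ.arr 6 (σ.var 6)) (σ.arr 3) (σ.arr 5) (σ.arr 7) (s.var 12) with hS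
    -- the effect of one step of the walk
    have hpost : ∀ δ, δ = min (s.var 14) S →
        Above (par (σ.arr 3) (σ.arr 4) (σ.arr 7)) (σ.arr 4 (σ.var 6))
          (σ.arr 3 a + σ.arr 4 a - s.var 12) ∧
        δ ≤ σ.arr 6 (σ.var 6) - σ.arr 5 (σ.var 6) ∧
        (∀ y e, Above (par (σ.arr 3) (σ.arr 4) (σ.arr 7)) (σ.arr 4 (σ.var 6)) y →
          σ.arr 7 y = e + 1 → Above (par (σ.arr 3) (σ.arr 4) (σ.arr 7))
            (σ.arr 3 a + σ.arr 4 a - s.var 12) y ∨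
            δ ≤ slack (σ.arr 6 (σ.var 6)) (σ.arr 3) (σ.arr 5) (σ.arr 7) y) ∧
        (δ = σ.arr 6 (σ.var 6) - σ.arr 5 (σ.var 6) ∨ ∃ y e,
          Above (par (σ.arr 3) (σ.arr 4) (σ.arr 7)) (σ.arr 4 (σ.var 6)) y ∧ σ.arr 7 y = e + 1 ∧
          δ = slack (σ.arr 6 (σ.var 6)) (σ.arr 3) (σ.arr 5) (σ.arr 7) y) := by
      rintro δ rfl
      refine ⟨hab.trans (.step hpar (.refl _)), by omega, fun y e hy he => ?_, ?_⟩
      · rcases hmin y e hy he with h | h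
        · rcases h.eq_or with rfl | ⟨w, hw, hw'⟩
          · exact Or.inr (min_le_right _ _)
          · rw [hpar] at hw; cases hw; exact Or.inl hw'
        · exact Or.inr ((min_le_left _ _).trans h)
      · rcases le_total (s.var 14) S with h | h
        · rw [min_eq_left h]; exact hatt
        · rw [min_eq_right h]; exact Or.inr ⟨_, a, hab, ha, rfl⟩
    have hmdi := (hTB _ hi).2.2
    have hSv : S = if σ.arr 3 a = s.var 12 then σ.arr 6 (σ.var 6) - σ.arr 5 a
        else σ.arr 5 a := by
      rw [hS, slack, ha, Nat.add_sub_cancel]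
    have hSB : S < B := by
      rw [hSv]; split_ifs <;> omega
    refine WP_seq (WP_set (by simp [WordExp.eval, h7, ha]; omega) ?_)
    refine WP_seq ?_
    have hmid : WP B (.ite (.eq (gt 3 (vr 13)) (vr 12)) (.set 15 (.sub (vr 7) (gt 5 (vr 13))))
        (.set 15 (gt 5 (vr 13)))) (s.setv 13 a) fun t s' => s' = (s.setv 13 a).setv 15 S ∧
          t ≤ 14 := by
      refine WP_ite (fun h => WP_set ?_ ⟨?_, ?_⟩) (fun h => WP_set ?_ ⟨?_, ?_⟩)
      all_goals
        simp only [holds_eq, WordExp.eval, Store.setv_var, Store.setv_arr, h3] at h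
        simp at h
        simp [WordExp.eval, h5, hv7, h, WordExp.cost, Test.cost, Test.eq] at hSv ⊢
        try first | (rw [hSv]) | omega
    have hev : (WordExp.sub (gt 7 (vr 12)) (cn 1)).eval s = a := by
      simp [WordExp.eval, h7, ha]
    rw [hev]
    refine hmid.mono ?_
    rintro t₁ s₁ ⟨rfl, ht₁⟩
    refine WP_seq ?_
    have hmid2 : WP B (.ite (.lt (vr 15) (vr 14)) (.set 14 (vr 15)) .skip)
        ((s.setv 13 a).setv 15 S) fun t s' => s'.var 12 = s.var 12 ∧ s'.var 13 = a ∧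
          s'.arr = s.arr ∧ s'.var 14 = min (s.var 14) S ∧ t ≤ 6 := by
      refine WP_ite (fun h => WP_set ?_ ⟨?_, ?_, ?_, ?_, ?_⟩)
        (fun h => WP_skip ⟨?_, ?_, ?_, ?_, ?_⟩)
      all_goals
        simp only [holds_lt, WordExp.eval, Store.setv_var] at h
        simp at h
        simp [WordExp.eval, WordExp.cost, Test.cost, Test.lt]
        try omega
    refine hmid2.mono ?_
    rintro t₂ s₂ ⟨h12, h13, harr, h14, ht₂⟩
    refine WP_set (by simp [WordExp.eval, h12, h13, harr, h3, h4]; omega) ⟨?_, ?_⟩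
    · simpa [WordExp.eval, h12, h13, harr, h3, h4] using hpost _ h14
    · simp only [WordExp.eval, h12, h13, harr, h3, h4, Store.setv_var, if_true, hj'.depth_eq,
        hj.depth_eq, WordExp.cost, Test.cost, Test.lt]
      omega
  · rintro t s ⟨hf, ⟨hab, hle, hmin, hatt⟩, hb, ht⟩
    have h7 : s.arr 7 = σ.arr 7 := by rw [hf.arr 7 (by rfl)]; simp
    have h0 : σ.arr 7 (s.var 12) = 0 := by simpa [holds_lt, WordExp.eval, h7] using hb
    obtain ⟨j, -, hj⟩ := hab.climb hk
    obtain ⟨-, hz⟩ := hj.eq_of_root (par_eq_none.2 h0)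
    have hdep : depth (par (σ.arr 3) (σ.arr 4) (σ.arr 7)) (σ.arr 4 (σ.var 6)) = k := hk.depth_eq
    refine ⟨⟨k, hz ▸ hk⟩, ⟨hle, fun y e hy he => ?_, hatt⟩, by omega, ?_⟩
    · rcases hmin y e hy he with h | h
      · rcases h.eq_or with rfl | ⟨w, hw, -⟩
        · omega
        · rw [par_eq_none.2 h0] at hw; cases hw
      · exact h
    · simp [WordExp.eval, Test.cost, Test.lt, WordExp.cost, hdep] at ht ⊢
      omega

theorem WP_pushProg (hB : M < B)
    (hTB : ∀ e < M, σ.arr 3 e < B ∧ σ.arr 4 e < B ∧ σ.arr 6 e < B)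
    (hN : IsNetwork M L (σ.arr 3) (σ.arr 4) (σ.arr 6) grp md) (hi : σ.var 6 < M)
    (hF : IsForest (fun e => e < σ.var 6) (σ.arr 3) (σ.arr 4) (σ.arr 6) (σ.arr 5) (σ.arr 7))
    (hr : σ.var 7 = σ.arr 6 (σ.var 6)) (hle : ∀ e < M, σ.arr 5 e ≤ σ.arr 6 e)
    (h0 : 0 < σ.arr 5 (σ.var 6)) (h1 : σ.arr 5 (σ.var 6) < σ.arr 6 (σ.var 6))
    (hu : σ.arr 7 (σ.arr 3 (σ.var 6)) = 0)
    (hδ : IsBottleneck (σ.var 6) (σ.var 14) (σ.arr 3) (σ.arr 4) (σ.arr 6) (σ.arr 5) (σ.arr 7))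
    (hroot : ∃ k, Climb (par (σ.arr 3) (σ.arr 4) (σ.arr 7)) (σ.arr 4 (σ.var 6)) k
      (σ.arr 3 (σ.var 6))) :
    WP B pushProg σ fun t σ' =>
      (∃ x, IsPushing M (σ.var 6) (σ.var 14) (σ.arr 3) (σ.arr 4) (σ.arr 6) (σ.arr 5) (σ.arr 7)
        (σ'.arr 5) (σ'.arr 7) x) ∧
      (∀ y, exc M (σ.arr 3) (σ.arr 4) (σ'.arr 5) y = exc M (σ.arr 3) (σ.arr 4) (σ.arr 5) y) ∧
      (σ'.arr 5 (σ.var 6) < σ.arr 6 (σ.var 6) →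
        ∃ k z, Climb (par (σ.arr 3) (σ.arr 4) (σ'.arr 7)) (σ.arr 4 (σ.var 6)) k z ∧
          z ≠ σ.arr 3 (σ.var 6)) ∧
      t ≤ 60 * L + 20 := by
  obtain ⟨k, hk⟩ := hroot
  have hroot : ∃ k, Climb (par (σ.arr 3) (σ.arr 4) (σ.arr 7)) (σ.arr 4 (σ.var 6)) k
      (σ.arr 3 (σ.var 6)) := ⟨k, hk⟩
  have hkL : k < L := hF.climb_lt (fun e he => by omega) hN hk hi (Or.inr rfl)
  have hTi := hTB _ hi
  have hδi := hδ.le_arc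
  refine WP_seq (WP_put (by simp [WordExp.eval]; omega) ?_)
  refine WP_seq (WP_set (by simpa [WordExp.eval] using hTi.2.1) ?_)
  refine (WP_loop
    (fun s => IsPushing M (σ.var 6) (σ.var 14) (σ.arr 3) (σ.arr 4) (σ.arr 6) (σ.arr 5) (σ.arr 7)
      (s.arr 5) (s.arr 7) (s.var 12))
    (fun s => 60 * depth (par (σ.arr 3) (σ.arr 4) (σ.arr 7)) (s.var 12)) ?_ ?_).mono ?_
  · simpa [WordExp.eval] using IsPushing.start hi hF hle h0 h1 hu hδ
  · rintro s hf hI hb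
    have h3 : s.arr 3 = σ.arr 3 := by rw [hf.arr 3 (by rfl)]; simp
    have h4 : s.arr 4 = σ.arr 4 := by rw [hf.arr 4 (by rfl)]; simp
    have hv7 : s.var 7 = σ.arr 6 (σ.var 6) := by rw [hf.var 7 (by rfl)]; simp [hr]
    have hv14 : s.var 14 = σ.var 14 := by rw [hf.var 14 (by rfl)]; simp
    obtain ⟨a, ha⟩ : ∃ a, s.arr 7 (s.var 12) = a + 1 := by
      simp [holds_lt, WordExp.eval] at hb
      exact ⟨s.arr 7 (s.var 12) - 1, by omega⟩
    obtain ⟨v, hv⟩ : ∃ v, v = if σ.arr 3 a = s.var 12 then s.arr 5 a + σ.var 14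
      else s.arr 5 a - σ.var 14 := ⟨_, rfl⟩
    obtain ⟨hvle, hmd, hai, hax, hnext, hdep⟩ := hI.next hi hN hF hδ hroot ha hv
    have hTa := hTB a (by omega)
    refine WP_seq (WP_set (by simp [WordExp.eval, ha]; omega) ?_)
    have hev : (WordExp.sub (gt 7 (vr 12)) (cn 1)).eval s = a := by
      simp [WordExp.eval, ha]
    rw [hev]
    refine WP_seq ?_
    have hmid : WP B (.ite (.eq (gt 3 (vr 13)) (vr 12))
        (.put 5 (vr 13) (.add (gt 5 (vr 13)) (vr 14)))
        (.put 5 (vr 13) (.sub (gt 5 (vr 13)) (vr 14)))) (s.setv 13 a)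
        fun t s' => s' = (s.setv 13 a).seta 5 a v ∧ t ≤ 15 := by
      refine WP_ite (fun h => WP_put ?_ ⟨?_, ?_⟩) (fun h => WP_put ?_ ⟨?_, ?_⟩)
      all_goals
        simp only [holds_eq, WordExp.eval, Store.setv_var, Store.setv_arr, h3] at h
        simp at h
        simp [WordExp.eval, hv14, h, WordExp.cost, Test.cost, Test.eq] at hv ⊢
        try first | (rw [hv]) | omega
    refine hmid.mono ?_
    rintro t₁ s₁ ⟨rfl, ht₁⟩
    refine WP_seq ?_
    have hmid2 : WP B (.ite (.and (.lt (cn 0) (gt 5 (vr 13))) (.lt (gt 5 (vr 13)) (vr 7))) .skip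
        (.put 7 (vr 12) (cn 0))) ((s.setv 13 a).seta 5 a v) fun t s' =>
          s'.var 12 = s.var 12 ∧ s'.var 13 = a ∧ s'.arr 3 = σ.arr 3 ∧ s'.arr 4 = σ.arr 4 ∧
          s'.arr 5 = Function.update (s.arr 5) a v ∧
          s'.arr 7 = (if v = 0 ∨ σ.arr 6 (σ.var 6) ≤ v then
            Function.update (s.arr 7) (s.var 12) 0 else s.arr 7) ∧ t ≤ 14 := by
      refine WP_ite (fun h => WP_skip ⟨?_, ?_, ?_, ?_, ?_, ?_, ?_⟩)
        (fun h => WP_put ?_ ⟨?_, ?_, ?_, ?_, ?_, ?_, ?_⟩)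
      all_goals
        simp only [Test.Holds, holds_lt, WordExp.eval, Store.setv_var, Store.seta_arr,
          Store.seta_var] at h
        simp [hv7] at h
        simp [WordExp.eval, WordExp.cost, Test.cost, Test.lt, h3, h4]
        try omega
    refine hmid2.mono ?_
    rintro t₂ s₂ ⟨h12, h13, h3', h4', h5', h7', ht₂⟩
    refine WP_set (by simp [WordExp.eval, h12, h13, h3', h4']; omega) ⟨?_, ?_⟩
    · simpa [WordExp.eval, h12, h13, h3', h4', h5', h7'] using hnext
    · simp only [WordExp.eval, h12, h13, h3', h4', Store.setv_var, if_true, ← hdep,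
        WordExp.cost, Test.cost, Test.lt]
      omega
  · rintro t s ⟨hf, hI, hb, ht⟩
    have h0 : s.arr 7 (s.var 12) = 0 := by simpa [holds_lt, WordExp.eval] using hb
    obtain ⟨h8, h9⟩ := hI.finish hδ hroot hu h0
    refine ⟨⟨_, hI⟩, h8, h9, ?_⟩
    have hdep : depth (par (σ.arr 3) (σ.arr 4) (σ.arr 7)) (σ.arr 4 (σ.var 6)) = k := hk.depth_eq
    simp [WordExp.eval, Test.cost, Test.lt, WordExp.cost, hdep] at ht ⊢
    omega

/-- A fractional arc `i` is added to the forest as the parent arc of its tail, a root. -/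
theorem IsForest.insert {i : ℕ} {T H MD F pa : ℕ → ℕ} (hne : T i ≠ H i)
    (hF : IsForest (fun e => e < i) T H MD F pa) (hu : pa (T i) = 0)
    (h0 : 0 < F i)
    (h : F i < MD i → ∃ k z, Climb (par T H pa) (H i) k z ∧ z ≠ T i) :
    IsForest (fun e => e < i + 1) T H MD F
      (if F i < MD i then Function.update pa (T i) (i + 1) else pa) := by
  split_ifs with hlt
  · obtain ⟨k, z, hk, hz⟩ := h hlt
    refine ⟨fun x e hx => ?_, fun e he he0 he1 => ?_, ?_⟩
    · by_cases hxu : x = T i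
      · subst hxu
        simp only [Function.update_self] at hx
        obtain rfl : i = e := by omega
        exact ⟨by omega, Or.inl rfl, h0, hlt⟩
      · rw [Function.update_of_ne hxu] at hx
        obtain ⟨h1, h2⟩ := hF.arc x e hx
        exact ⟨by omega, h2⟩
    · by_cases hei : e = i
      · subst hei; exact ⟨T e, by simp⟩
      · obtain ⟨x, hx⟩ := hF.covers e (by omega) he0 he1
        refine ⟨x, ?_⟩
        rw [Function.update_of_ne, hx]
        rintro rfl; omega
    · rw [par_update_succ]
      rw [Nat.add_sub_cancel_left]
      exact hF.acyclic.link (par_eq_none.2 hu) hk hz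
  · refine ⟨fun x e hx => ?_, fun e he he0 he1 => ?_, hF.acyclic⟩
    · obtain ⟨h1, h2⟩ := hF.arc x e hx
      exact ⟨by omega, h2⟩
    · refine hF.covers e ?_ he0 he1
      have : e ≠ i := by rintro rfl; omega
      omega

/-- The invariant of the rounding of the flow `F₀`: the arcs below `i` have been inserted. -/
structure IsRounding (M i : ℕ) (T H MD F₀ F pa : ℕ → ℕ) : Prop where
  forest : IsForest (fun e => e < i) T H MD F pa
  exc_eq : ∀ y, exc M T H F y = exc M T H F₀ y
  le : ∀ e < M, F e ≤ MD e
  integral : ∀ e < M, F₀ e = 0 ∨ F₀ e = MD e → F e = F₀ e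
  later : ∀ e, i ≤ e → F e = F₀ e

theorem WP_insertProg {F₀ : ℕ → ℕ} (hB : M < B)
    (hTB : ∀ e < M, σ.arr 3 e < B ∧ σ.arr 4 e < B ∧ σ.arr 6 e < B)
    (hN : IsNetwork M L (σ.arr 3) (σ.arr 4) (σ.arr 6) grp md) (hi : σ.var 6 < M)
    (hR : IsRounding M (σ.var 6) (σ.arr 3) (σ.arr 4) (σ.arr 6) F₀ (σ.arr 5) (σ.arr 7))
    (h0 : 0 < σ.arr 5 (σ.var 6)) (h1 : σ.arr 5 (σ.var 6) < σ.arr 6 (σ.var 6)) :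
    WP B insertProg σ fun t σ' =>
      IsRounding M (σ.var 6 + 1) (σ.arr 3) (σ.arr 4) (σ.arr 6) F₀ (σ'.arr 5) (σ'.arr 7) ∧
        t ≤ 140 * L + 100 := by
  have hTi := hTB _ hi
  have hFi := hR.later _ le_rfl
  refine WP_seq (WP_set (by simpa [WordExp.eval] using hTi.2.2) ?_)
  have hev : (gt 6 (vr 6)).eval σ = σ.arr 6 (σ.var 6) := by simp [WordExp.eval]
  rw [hev]
  refine WP_seq ((WP_rerootProg (M := M) (L := L) (grp := grp) (md := md) hB ?_ ?_ ?_ ?_).frame.mono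
    ?_)
  · simpa using fun e he => ⟨(hTB e he).1, (hTB e he).2.1⟩
  · simpa using hN
  · simpa using hi
  · simpa using hR.forest
  rintro t₁ s₁ ⟨hf₁, hF₁, hu₁, ht₁⟩
  have e3 : s₁.arr 3 = σ.arr 3 := by rw [hf₁.arr 3 (by rfl)]; simp
  have e4 : s₁.arr 4 = σ.arr 4 := by rw [hf₁.arr 4 (by rfl)]; simp
  have e5 : s₁.arr 5 = σ.arr 5 := by rw [hf₁.arr 5 (by rfl)]; simp
  have e6 : s₁.arr 6 = σ.arr 6 := by rw [hf₁.arr 6 (by rfl)]; simp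
  have e7 : s₁.var 7 = σ.arr 6 (σ.var 6) := by rw [hf₁.var 7 (by rfl)]; simp
  have ei : s₁.var 6 = σ.var 6 := by rw [hf₁.var 6 (by rfl)]; simp
  simp only [Store.setv_arr, Store.setv_var] at hF₁ hu₁
  norm_num at hF₁ hu₁
  refine WP_seq ((WP_walkProg (M := M) (L := L) (grp := grp) (md := md) hB
    ?_ ?_ ?_ ?_ ?_).frame.mono ?_)
  · simpa [e3, e4, e6] using hTB
  · simpa [e3, e4, e6] using hN
  · simpa [ei] using hi
  · simpa [e3, e4, e5, e6, ei] using hF₁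
  · simpa [e6, ei] using e7
  rintro t₂ s₂ ⟨hf₂, hc₂, hδ₂, hδB, ht₂⟩
  have e3' : s₂.arr 3 = σ.arr 3 := by rw [hf₂.arr 3 (by rfl), e3]
  have e4' : s₂.arr 4 = σ.arr 4 := by rw [hf₂.arr 4 (by rfl), e4]
  have e5' : s₂.arr 5 = σ.arr 5 := by rw [hf₂.arr 5 (by rfl), e5]
  have e6' : s₂.arr 6 = σ.arr 6 := by rw [hf₂.arr 6 (by rfl), e6]
  have ep' : s₂.arr 7 = s₁.arr 7 := hf₂.arr 7 (by rfl)
  have e7' : s₂.var 7 = σ.arr 6 (σ.var 6) := by rw [hf₂.var 7 (by rfl), e7]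
  have ei' : s₂.var 6 = σ.var 6 := by rw [hf₂.var 6 (by rfl), ei]
  rw [e3, e4, ei] at hc₂
  rw [e3, e4, e5, e6, ei] at hδ₂
  refine WP_seq ?_
  have hmid : WP B (.ite (.eq (vr 12) (gt 3 (vr 6))) pushProg .skip) s₂ fun t s =>
      IsForest (fun e => e < σ.var 6) (σ.arr 3) (σ.arr 4) (σ.arr 6) (s.arr 5) (s.arr 7) ∧
      (∀ y, exc M (σ.arr 3) (σ.arr 4) (s.arr 5) y = exc M (σ.arr 3) (σ.arr 4) (σ.arr 5) y) ∧
      (∀ e < M, s.arr 5 e ≤ σ.arr 6 e) ∧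
      (∀ e < M, σ.arr 5 e = 0 ∨ σ.arr 5 e = σ.arr 6 e → s.arr 5 e = σ.arr 5 e) ∧
      (∀ e, σ.var 6 < e → s.arr 5 e = σ.arr 5 e) ∧ 0 < s.arr 5 (σ.var 6) ∧
      s.arr 7 (σ.arr 3 (σ.var 6)) = 0 ∧
      (s.arr 5 (σ.var 6) < σ.arr 6 (σ.var 6) →
        ∃ k z, Climb (par (σ.arr 3) (σ.arr 4) (s.arr 7)) (σ.arr 4 (σ.var 6)) k z ∧
          z ≠ σ.arr 3 (σ.var 6)) ∧
      t ≤ 60 * L + 30 := by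
    refine WP_ite (fun h => ?_) (fun h => WP_skip ?_)
    · simp only [holds_eq, WordExp.eval, e3', ei'] at h
      rw [h] at hc₂
      refine (WP_pushProg (M := M) (L := L) (grp := grp) (md := md) hB
        (by simpa [e3', e4', e6'] using hTB) (by simpa [e3', e4', e6'] using hN) (by rwa [ei'])
        (by simpa [e3', e4', e5', e6', ei', ep'] using hF₁) (by rw [e6', ei', e7'])
        (by simpa [e5', e6'] using hR.le) (by rwa [e5', ei']) (by rwa [e5', ei', e6'])
        (by rw [ep', e3', ei']; exact hu₁)
        (by rw [e3', e4', e5', e6', ei', ep']; exact hδ₂)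
        (by rw [e3', e4', ei', ep']; exact hc₂)).mono ?_
      rintro t s ⟨⟨x, hx⟩, h2, h3, h4⟩
      rw [e3', e4', e5', e6', ei', ep'] at hx
      rw [e3', e4', e5'] at h2
      rw [e3', e4', e6', ei'] at h3
      refine ⟨hx.forest, h2, hx.le, hx.integral, hx.later, ?_, hx.root, h3, ?_⟩
      · rw [hx.arc_eq]; omega
      · simp [WordExp.cost, Test.cost, Test.eq]; omega
    · simp only [holds_eq, WordExp.eval, e3', ei'] at h
      obtain ⟨k, hk⟩ := hc₂
      rw [e5', ep']
      refine ⟨hF₁, fun _ => rfl, hR.le, fun _ _ _ => rfl, fun _ _ => rfl, h0, hu₁,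
        fun _ => ⟨k, _, hk, h⟩, ?_⟩
      simp [WordExp.cost, Test.cost, Test.eq]
  refine hmid.frame.mono ?_
  rintro t₃ s₃ ⟨hf₃, hF₃, hexc, hle, hint, hlat, hpos, hu₃, hcl, ht₃⟩
  have e3'' : s₃.arr 3 = σ.arr 3 := by rw [hf₃.arr 3 (by rfl), e3']
  have e7'' : s₃.var 7 = σ.arr 6 (σ.var 6) := by rw [hf₃.var 7 (by rfl), e7']
  have ei'' : s₃.var 6 = σ.var 6 := by rw [hf₃.var 6 (by rfl), ei']
  have hins := hF₃.insert (hN.tail_ne_head _ hi) hu₃ hpos hcl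
  have hfin : ∀ pa', pa' = (if s₃.arr 5 (σ.var 6) < σ.arr 6 (σ.var 6) then
      Function.update (s₃.arr 7) (σ.arr 3 (σ.var 6)) (σ.var 6 + 1) else s₃.arr 7) →
      IsRounding M (σ.var 6 + 1) (σ.arr 3) (σ.arr 4) (σ.arr 6) F₀ (s₃.arr 5) pa' := by
    rintro pa' rfl
    refine ⟨hins, fun y => (hexc y).trans (hR.exc_eq y), hle, fun e he h => ?_, fun e he => ?_⟩
    · rw [hint e he (by rw [hR.integral e he h]; exact h), hR.integral e he h]
    · rw [hlat e (by omega), hR.later e (by omega)]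
  refine WP_ite (fun h => WP_put ?_ ⟨?_, ?_⟩) (fun h => WP_skip ⟨?_, ?_⟩)
  all_goals
    simp only [holds_lt, WordExp.eval, e7'', ei''] at h
    try simp only [WordExp.eval, ei'', e3'', WordExp.cost, Test.cost, Test.lt, Store.seta_arr]
    try norm_num
  · omega
  · exact hfin _ (by rw [if_pos h])
  · omega
  · exact hfin _ (by rw [if_neg h])
  · omega

/-- The rounding program turns all flow values into `0` or the modulus.  It keeps the excesses, and
the values that are integral from the start. -/
theorem WP_roundProg (hB : σ.var 5 < B)
    (hTB : ∀ e < σ.var 5, σ.arr 3 e < B ∧ σ.arr 4 e < B ∧ σ.arr 6 e < B)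
    (hN : IsNetwork (σ.var 5) L (σ.arr 3) (σ.arr 4) (σ.arr 6) grp md)
    (hle : ∀ e < σ.var 5, σ.arr 5 e ≤ σ.arr 6 e) (hpa : ∀ x, σ.arr 7 x = 0)
    (hexc : ∀ x, (md x : ℤ) ∣ exc (σ.var 5) (σ.arr 3) (σ.arr 4) (σ.arr 5) x) :
    WP B roundProg σ fun t σ' =>
      (∀ x, σ'.arr 7 x = 0) ∧
      (∀ e < σ.var 5, σ'.arr 5 e = 0 ∨ σ'.arr 5 e = σ.arr 6 e) ∧
      (∀ e < σ.var 5, σ.arr 5 e = 0 ∨ σ.arr 5 e = σ.arr 6 e → σ'.arr 5 e = σ.arr 5 e) ∧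
      (∀ x, exc (σ.var 5) (σ.arr 3) (σ.arr 4) (σ'.arr 5) x =
        exc (σ.var 5) (σ.arr 3) (σ.arr 4) (σ.arr 5) x) ∧
      t ≤ 30 * σ.var 5 + (140 * L + 100) *
        ((Finset.range (σ.var 5)).filter fun e => σ.arr 5 e ≠ 0 ∧ σ.arr 5 e ≠ σ.arr 6 e).card
        + 10 := by
  refine (WP_forLoop (σ.var 5)
    (fun e => 20 + if σ.arr 5 e ≠ 0 ∧ σ.arr 5 e ≠ σ.arr 6 e then 140 * L + 100 else 0)
    (fun i s => IsRounding (σ.var 5) i (σ.arr 3) (σ.arr 4) (σ.arr 6) (σ.arr 5) (s.arr 5) (s.arr 7))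
    hB (by rfl) ?_ ?_ ?_ ?_).mono ?_
  · intro s k hf _
    exact hf.var 5 (by rfl)
  · refine ⟨⟨fun x e hx => ?_, fun e he => absurd he (by omega), fun x => ⟨0, x, .root ?_⟩⟩,
      fun _ => rfl, hle, fun _ _ _ => rfl, fun _ _ => rfl⟩
    · simp [hpa] at hx
    · exact par_eq_none.2 (hpa x)
  · intro k s v h; simpa using h
  · intro k s hk hf hsk hI
    have e3 : s.arr 3 = σ.arr 3 := hf.arr 3 (by rfl)
    have e4 : s.arr 4 = σ.arr 4 := hf.arr 4 (by rfl)
    have e6 : s.arr 6 = σ.arr 6 := hf.arr 6 (by rfl)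
    have hlat := hI.later k le_rfl
    have hlek := hle k hk
    refine WP_ite (fun h => ?_) (fun h => WP_skip ⟨?_, ?_⟩)
    · simp only [Test.Holds, holds_lt, WordExp.eval, hsk, e6] at h
      refine (WP_insertProg (M := σ.var 5) (L := L) (grp := grp) (md := md) (F₀ := σ.arr 5) hB
        (by simpa [e3, e4, e6] using hTB) (by simpa [e3, e4, e6] using hN) (by rwa [hsk])
        (by rw [hsk, e3, e4, e6]; exact hI) (by rw [hsk]; exact h.1)
        (by rw [hsk, e6]; exact h.2)).mono ?_
      rintro t s' ⟨h1, h2⟩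
      rw [hsk, e3, e4, e6] at h1
      refine ⟨h1, ?_⟩
      rw [if_pos (by omega)]
      simp [WordExp.cost, Test.cost, Test.lt]; omega
    · simp only [Test.Holds, holds_lt, WordExp.eval, hsk, e6] at h
      have hF := hI.forest
      refine ⟨⟨fun x e hx => ?_, fun e he he0 he1 => ?_, hF.acyclic⟩, hI.exc_eq, hI.le,
        hI.integral, fun e he => hI.later e (by omega)⟩
      · obtain ⟨h1, h2⟩ := hF.arc x e hx
        exact ⟨by omega, h2⟩
      · refine hF.covers e ?_ he0 he1
        have : e ≠ k := by rintro rfl; omega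
        omega
    · simp [WordExp.cost, Test.cost, Test.lt]; omega
  · rintro t s ⟨hf, hI, ht⟩
    have hz := hI.forest.pa_eq_zero (fun e => Iff.rfl) hN hI.le
      (fun x => by rw [hI.exc_eq]; exact hexc x)
    refine ⟨hz, fun e he => ?_, hI.integral, hI.exc_eq, ?_⟩
    · by_contra! hcon
      have := hI.le e he
      obtain ⟨x, hx⟩ := hI.forest.covers e he (by omega) (by omega)
      rw [hz] at hx; omega
    · simp only [Finset.sum_add_distrib, ← Finset.sum_filter, Finset.sum_const, smul_eq_mul,
        Finset.card_range, WordExp.cost] at ht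
      refine ht.trans ?_
      ring_nf
      omega

end

/-! ### The network of a halving step -/

/-- The number of rounds of the group with the first round `lo`, when groups of length `2 * Q`
are cut off at `ρ`. -/
def rnd (ρ Q lo : ℕ) : ℕ := min (2 * Q) (ρ - lo)

/-- The number of rounds of the first half of the group `lo`. -/
def half (ρ Q lo : ℕ) : ℕ := min Q (rnd ρ Q lo)

/-- The group of a node.  With `K = n * ρ` and `j = lo * n + w`, the warehouse `w` has in the group
`lo` the three nodes `j` (arrivals), `K + j` and `2 * K + j` (departures); the node `3 * K + lo`
belongs to the group `lo` as a whole. -/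
def grp (n K x : ℕ) : ℕ := if x < 3 * K then x % K / n else x - 3 * K

/-- The internal arcs of a warehouse in a group, with `j = lo * n + w`: the arc `m + j` carries the
arrivals, the arc `m + K + j` carries the departures, and the arc `m + 2 * K + j` carries the
difference between them. -/
structure IsInternal (m n ρ Q K : ℕ) (T H MD : ℕ → ℕ) (j : ℕ) : Prop where
  t₁ : T (m + j) = j
  h₁ : H (m + j) = K + j
  d₁ : MD (m + j) = rnd ρ Q (j / n)
  t₂ : T (m + K + j) = K + j
  h₂ : H (m + K + j) = 2 * K + j
  d₂ : MD (m + K + j) = rnd ρ Q (j / n)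
  t₃ : T (m + 2 * K + j) = K + j
  h₃ : H (m + 2 * K + j) = 3 * K + j / n
  d₃ : MD (m + 2 * K + j) = rnd ρ Q (j / n)

/-- The network of a halving step after the first `k` products have been entered.  The arc `e < m`
of a product leads from the departures at its source to the arrivals at its sink and carries the
flow `half`, out of `rnd`; the flow on the internal arcs is determined modulo `rnd` by the
conservation of flow modulo `rnd`.  At most five arcs per product carry flow, so that only these
have to be rounded, although the network has `m + 3 * K` arcs. -/
structure IsSetup (m n ρ Q K : ℕ) (src snk φ T H MD F : ℕ → ℕ) (k : ℕ) : Prop where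
  internal : ∀ j < K, IsInternal m n ρ Q K T H MD j
  tail : ∀ e < k, T e = 2 * K + (φ e * n + src e)
  head : ∀ e < k, H e = φ e * n + snk e
  mod : ∀ e < k, MD e = rnd ρ Q (φ e)
  flow : ∀ e < k, F e = half ρ Q (φ e)
  rest : ∀ e < m, k ≤ e → F e = 0
  lt : ∀ a < 3 * K, F (m + a) < MD (m + a)
  dvd : ∀ x, (rnd ρ Q (grp n K x) : ℤ) ∣ exc (m + 3 * K) T H F x
  card_le : ((Finset.range (m + 3 * K)).filter fun e => F e ≠ 0).card ≤ 5 * k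

section
variable {m n ρ Q K : ℕ} {src snk φ T H MD F : ℕ → ℕ}

theorem grp_of_lt {j : ℕ} (hj : j < K) : grp n K j = j / n ∧ grp n K (K + j) = j / n ∧
    grp n K (2 * K + j) = j / n := by
  unfold grp
  rw [if_pos (by omega), if_pos (by omega), if_pos (by omega), Nat.mod_eq_of_lt hj,
    Nat.add_mod_left, Nat.mod_eq_of_lt hj, show 2 * K + j = j + K * 2 by ring,
    Nat.add_mul_mod_self_left, Nat.mod_eq_of_lt hj]
  exact ⟨rfl, rfl, rfl⟩

theorem grp_top (l : ℕ) : grp n K (3 * K + l) = l := by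
  simp [grp]

theorem cell_lt {lo w : ℕ} (hK : K = n * ρ) (hlo : lo < ρ) (hw : w < n) : lo * n + w < K := by
  calc lo * n + w < (lo + 1) * n := by rw [Nat.add_mul]; omega
    _ ≤ ρ * n := Nat.mul_le_mul_right _ hlo
    _ = K := by rw [hK, Nat.mul_comm]

theorem cell_div {lo w : ℕ} (hw : w < n) : (lo * n + w) / n = lo := by
  rw [Nat.mul_comm, Nat.mul_add_div (by omega), Nat.div_eq_of_lt hw, Nat.add_zero]

theorem cell_mod {lo w : ℕ} (hw : w < n) : (lo * n + w) % n = w := by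
  rw [Nat.mul_comm, Nat.mul_add_mod, Nat.mod_eq_of_lt hw]

theorem rnd_pos {lo : ℕ} (hQ : 0 < Q) (hlo : lo < ρ) : 0 < rnd ρ Q lo := by
  unfold rnd; omega

theorem card_support_update_le (M : ℕ) (F : ℕ → ℕ) (a v : ℕ) :
    ((Finset.range M).filter fun e => Function.update F a v e ≠ 0).card ≤
      ((Finset.range M).filter fun e => F e ≠ 0).card + 1 := by
  refine (Finset.card_le_card (t := insert a ((Finset.range M).filter fun e => F e ≠ 0))
    fun e he => ?_).trans (Finset.card_insert_le _ _)
  simp only [Finset.mem_filter, Finset.mem_insert] at he ⊢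
  by_cases h : e = a
  · exact Or.inl h
  · rw [Function.update_of_ne h] at he; exact Or.inr he

theorem IsInternal.congr {T' H' MD' : ℕ → ℕ} {j : ℕ} (h : IsInternal m n ρ Q K T H MD j)
    (hT : ∀ e, m ≤ e → T' e = T e) (hH : ∀ e, m ≤ e → H' e = H e)
    (hMD : ∀ e, m ≤ e → MD' e = MD e) : IsInternal m n ρ Q K T' H' MD' j where
  t₁ := by rw [hT _ (by omega), h.t₁]
  h₁ := by rw [hH _ (by omega), h.h₁]
  d₁ := by rw [hMD _ (by omega), h.d₁]
  t₂ := by rw [hT _ (by omega), h.t₂]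
  h₂ := by rw [hH _ (by omega), h.h₂]
  d₂ := by rw [hMD _ (by omega), h.d₂]
  t₃ := by rw [hT _ (by omega), h.t₃]
  h₃ := by rw [hH _ (by omega), h.h₃]
  d₃ := by rw [hMD _ (by omega), h.d₃]

/-- Entering a product: its arc is given the flow `c`, and the flow on the internal arcs is
corrected along ways from its head to its tail, so that the excesses stay the same modulo `r`. -/
theorem IsSetup.next (hK : K = n * ρ) (hQ : 0 < Q) {k : ℕ} (hk : k < m)
    (hφ : φ k < ρ) (hsrc : src k < n) (hsnk : snk k < n)
    (h : IsSetup m n ρ Q K src snk φ T H MD F k)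
    {js jt r c : ℕ} (hjs : js = φ k * n + src k) (hjt : jt = φ k * n + snk k)
    (hr : r = rnd ρ Q (φ k)) (hc : c = half ρ Q (φ k)) {F₁ F₂ F₃ F₄ : ℕ → ℕ}
    (hF₁ : F₁ = Function.update F k c)
    (hF₂ : F₂ = Function.update F₁ (m + jt) ((F₁ (m + jt) + c) % r))
    (hF₃ : F₃ = Function.update F₂ (m + K + js) ((F₂ (m + K + js) + c) % r))
    (hF₄ : F₄ = Function.update F₃ (m + 2 * K + jt) ((F₃ (m + 2 * K + jt) + c) % r)) :
    IsSetup m n ρ Q K src snk φ (Function.update T k (2 * K + js)) (Function.update H k jt)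
      (Function.update MD k r)
      (Function.update F₄ (m + 2 * K + js) ((F₄ (m + 2 * K + js) + (r - c)) % r)) (k + 1) := by
  have hjsK : js < K := hjs ▸ cell_lt hK hφ hsrc
  have hjtK : jt < K := hjt ▸ cell_lt hK hφ hsnk
  have hjsn : js / n = φ k := hjs ▸ cell_div hsrc
  have hjtn : jt / n = φ k := hjt ▸ cell_div hsnk
  have hrpos : 0 < r := hr ▸ rnd_pos hQ hφ
  have hcr : c ≤ r := by rw [hc, hr]; exact min_le_right _ _
  set T' := Function.update T k (2 * K + js) with hT'
  set H' := Function.update H k jt with hH'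
  set MD' := Function.update MD k r with hMD'
  set F₅ := Function.update F₄ (m + 2 * K + js) ((F₄ (m + 2 * K + js) + (r - c)) % r) with hF₅
  have hint : ∀ j < K, IsInternal m n ρ Q K T' H' MD' j := fun j hj =>
    (h.internal j hj).congr (fun e he => Function.update_of_ne (by omega) _ _)
      (fun e he => Function.update_of_ne (by omega) _ _)
      (fun e he => Function.update_of_ne (by omega) _ _)
  have hIs := hint js hjsK
  have hIt := hint jt hjtK
  have hlow : ∀ e < m, F₅ e = Function.update F k c e := by
    intro e he
    rw [hF₅, Function.update_of_ne (by omega), hF₄, Function.update_of_ne (by omega), hF₃,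
      Function.update_of_ne (by omega), hF₂, Function.update_of_ne (by omega), hF₁]
  refine ⟨hint, fun e he => ?_, fun e he => ?_, fun e he => ?_, fun e he => ?_, fun e he hke => ?_,
    ?_, ?_, ?_⟩
  · by_cases hek : e = k
    · subst hek; simp [hT', hjs]
    · rw [hT', Function.update_of_ne hek]; exact h.tail e (by omega)
  · by_cases hek : e = k
    · subst hek; simp [hH', hjt]
    · rw [hH', Function.update_of_ne hek]; exact h.head e (by omega)
  · by_cases hek : e = k
    · subst hek; simp [hMD', hr]
    · rw [hMD', Function.update_of_ne hek]; exact h.mod e (by omega)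
  · rw [hlow e (by omega)]
    by_cases hek : e = k
    · subst hek; simp [hc]
    · rw [Function.update_of_ne hek]; exact h.flow e (by omega)
  · rw [hlow e he, Function.update_of_ne (by omega)]; exact h.rest e he (by omega)
  · -- the internal flow values stay below the moduli
    have step : ∀ (G : ℕ → ℕ) (b v : ℕ), b < 3 * K → MD' (m + b) = r →
        (∀ a < 3 * K, G (m + a) < MD' (m + a)) →
        ∀ a < 3 * K, Function.update G (m + b) (v % r) (m + a) < MD' (m + a) := by
      intro G b v hb hbr hG a ha
      by_cases hab : a = b
      · subst hab; rw [Function.update_self, hbr]; exact Nat.mod_lt _ hrpos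
      · rw [Function.update_of_ne (by omega)]; exact hG a ha
    have s₁ : ∀ a < 3 * K, F₁ (m + a) < MD' (m + a) := by
      intro a ha
      rw [hF₁, hMD', Function.update_of_ne (by omega), Function.update_of_ne (by omega)]
      exact h.lt a ha
    have s₂ := step F₁ jt (F₁ (m + jt) + c) (by omega) (by rw [hIt.d₁, hjtn, hr]) s₁
    rw [← hF₂] at s₂
    have s₃ := step F₂ (K + js) (F₂ (m + K + js) + c) (by omega)
      (by rw [← Nat.add_assoc, hIs.d₂, hjsn, hr]) s₂
    rw [← Nat.add_assoc, ← hF₃] at s₃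
    have s₄ := step F₃ (2 * K + jt) (F₃ (m + 2 * K + jt) + c) (by omega)
      (by rw [← Nat.add_assoc, hIt.d₃, hjtn, hr]) s₃
    rw [← Nat.add_assoc, ← hF₄] at s₄
    have s₅ := step F₄ (2 * K + js) (F₄ (m + 2 * K + js) + (r - c)) (by omega)
      (by rw [← Nat.add_assoc, hIs.d₃, hjsn, hr]) s₄
    rw [← Nat.add_assoc, ← hF₅] at s₅
    exact s₅
  · intro x
    have e₀ : exc (m + 3 * K) T' H' F x = exc (m + 3 * K) T H F x := by
      refine exc_congr (fun e he => ⟨rfl, fun hne => ?_⟩) x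
      have hek : e ≠ k := by
        rintro rfl; exact hne (h.rest e hk le_rfl)
      exact ⟨Function.update_of_ne hek _ _, Function.update_of_ne hek _ _⟩
    have hFk : F k = 0 := h.rest k hk le_rfl
    have hT'k : T' k = 2 * K + js := by simp [hT']
    have hH'k : H' k = jt := by simp [hH']
    have cast_mod : ∀ a : ℕ, ((a % r : ℕ) : ℤ) = a - r * (a / r : ℕ) := by
      intro a
      have := Nat.div_add_mod a r
      rw [eq_sub_iff_add_eq, add_comm]
      exact_mod_cast this
    have key : exc (m + 3 * K) T' H' F₅ x = exc (m + 3 * K) T H F x + r *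
        (-((F₁ (m + jt) + c) / r : ℕ) * ((if K + jt = x then 1 else 0) - (if jt = x then 1 else 0))
        - ((F₂ (m + K + js) + c) / r : ℕ) *
          ((if 2 * K + js = x then 1 else 0) - (if K + js = x then 1 else 0))
        - ((F₃ (m + 2 * K + jt) + c) / r : ℕ) *
          ((if 3 * K + φ k = x then 1 else 0) - (if K + jt = x then 1 else 0))
        + (1 - ((F₄ (m + 2 * K + js) + (r - c)) / r : ℕ)) *
          ((if 3 * K + φ k = x then 1 else 0) - (if K + js = x then 1 else 0))) := by
      rw [hF₅, exc_update (by omega), cast_mod]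
      have f₄ := exc_update (M := m + 3 * K) (T := T') (H := H') (F := F₃) (e := m + 2 * K + jt)
        (by omega) ((F₃ (m + 2 * K + jt) + c) % r) x
      have f₃ := exc_update (M := m + 3 * K) (T := T') (H := H') (F := F₂) (e := m + K + js)
        (by omega) ((F₂ (m + K + js) + c) % r) x
      have f₂ := exc_update (M := m + 3 * K) (T := T') (H := H') (F := F₁) (e := m + jt)
        (by omega) ((F₁ (m + jt) + c) % r) x
      have f₁ := exc_update (M := m + 3 * K) (T := T') (H := H') (F := F) (e := k)
        (by omega) c x
      rw [← hF₄, cast_mod] at f₄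
      rw [← hF₃, cast_mod] at f₃
      rw [← hF₂, cast_mod] at f₂
      rw [← hF₁] at f₁
      rw [f₄, f₃, f₂, f₁, e₀, hFk, hT'k, hH'k, hIt.t₁, hIt.h₁, hIs.t₂, hIs.h₂, hIt.t₃, hIt.h₃,
        hIs.t₃, hIs.h₃, hjsn, hjtn]
      push_cast [Nat.cast_sub hcr]
      ring
    rw [key]
    refine dvd_add (h.dvd x) ?_
    by_cases hx : grp n K x = φ k
    · rw [hx, ← hr]; exact Dvd.intro _ rfl
    · obtain ⟨g₁, g₂, g₃⟩ := grp_of_lt (n := n) hjsK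
      obtain ⟨g₄, g₅, g₆⟩ := grp_of_lt (n := n) hjtK
      rw [hjsn] at g₁ g₂ g₃
      rw [hjtn] at g₄ g₅ g₆
      rw [if_neg (by rintro rfl; exact hx g₅), if_neg (by rintro rfl; exact hx g₄),
        if_neg (by rintro rfl; exact hx g₃), if_neg (by rintro rfl; exact hx g₂),
        if_neg (by rintro rfl; exact hx (grp_top _))]
      simp
  · have c₅ := card_support_update_le (m + 3 * K) F₄ (m + 2 * K + js)
      ((F₄ (m + 2 * K + js) + (r - c)) % r)
    have c₄ := card_support_update_le (m + 3 * K) F₃ (m + 2 * K + jt)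
      ((F₃ (m + 2 * K + jt) + c) % r)
    have c₃ := card_support_update_le (m + 3 * K) F₂ (m + K + js) ((F₂ (m + K + js) + c) % r)
    have c₂ := card_support_update_le (m + 3 * K) F₁ (m + jt) ((F₁ (m + jt) + c) % r)
    have c₁ := card_support_update_le (m + 3 * K) F k c
    rw [← hF₅] at c₅
    rw [← hF₄] at c₄
    rw [← hF₃] at c₃
    rw [← hF₂] at c₂
    rw [← hF₁] at c₁
    have := h.card_le
    omega

theorem exists_internal {a : ℕ} (ha : a < 3 * K) :
    ∃ j < K, a = j ∨ a = K + j ∨ a = 2 * K + j := by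
  rcases Nat.lt_or_ge a K with h | h
  · exact ⟨a, h, Or.inl rfl⟩
  rcases Nat.lt_or_ge a (2 * K) with h' | h'
  · exact ⟨a - K, by omega, by omega⟩
  · exact ⟨a - 2 * K, by omega, by omega⟩

theorem IsSetup.isNetwork (hK : K = n * ρ) (hφ : ∀ e < m, φ e < ρ) (hsrc : ∀ e < m, src e < n)
    (hsnk : ∀ e < m, snk e < n)
    (h : IsSetup m n ρ Q K src snk φ T H MD F m) :
    IsNetwork (m + 3 * K) (3 * n + 1) T H MD (grp n K) (fun x => rnd ρ Q (grp n K x)) := by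
  -- every arc connects two nodes of its group
  have key : ∀ e < m + 3 * K, T e ≠ H e ∧ ∃ g j j', MD e = rnd ρ Q g ∧ j < K ∧ j' < K ∧
      j / n = g ∧ j' / n = g ∧ (T e = j ∨ T e = K + j ∨ T e = 2 * K + j) ∧
      (H e = j' ∨ H e = K + j' ∨ H e = 2 * K + j' ∨ H e = 3 * K + g) := by
    intro e he
    rcases Nat.lt_or_ge e m with hem | hem
    · have h1 := cell_lt hK (hφ e hem) (hsrc e hem)
      have h2 := cell_lt hK (hφ e hem) (hsnk e hem)
      refine ⟨?_, φ e, _, _, h.mod e hem, h1, h2, cell_div (hsrc e hem), cell_div (hsnk e hem),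
        Or.inr (Or.inr (h.tail e hem)), Or.inl (h.head e hem)⟩
      rw [h.tail e hem, h.head e hem]; omega
    · obtain ⟨a, rfl⟩ := Nat.exists_eq_add_of_le hem
      obtain ⟨j, hj, ha⟩ := exists_internal (K := K) (a := a) (by omega)
      have hI := h.internal j hj
      rcases ha with rfl | rfl | rfl
      · exact ⟨by rw [hI.t₁, hI.h₁]; omega, _, _, _, hI.d₁, hj, hj, rfl, rfl, Or.inl hI.t₁,
          Or.inr (Or.inl hI.h₁)⟩
      · rw [← Nat.add_assoc]
        exact ⟨by rw [hI.t₂, hI.h₂]; omega, _, _, _, hI.d₂, hj, hj, rfl, rfl,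
          Or.inr (Or.inl hI.t₂), Or.inr (Or.inr (Or.inl hI.h₂))⟩
      · rw [← Nat.add_assoc]
        exact ⟨by rw [hI.t₃, hI.h₃]; generalize j / n = q; omega, _, _, _, hI.d₃, hj, hj, rfl, rfl,
          Or.inr (Or.inl hI.t₃), Or.inr (Or.inr (Or.inr hI.h₃))⟩
  have hgrp : ∀ e < m + 3 * K, ∃ g, MD e = rnd ρ Q g ∧ grp n K (T e) = g ∧ grp n K (H e) = g := by
    intro e he
    obtain ⟨-, g, j, j', h1, h2, h3, h4, h5, h6, h7⟩ := key e he
    obtain ⟨a₁, a₂, a₃⟩ := grp_of_lt (n := n) h2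
    obtain ⟨b₁, b₂, b₃⟩ := grp_of_lt (n := n) h3
    refine ⟨g, h1, ?_, ?_⟩
    · rcases h6 with h6 | h6 | h6 <;> rw [h6]
      · rw [a₁, h4]
      · rw [a₂, h4]
      · rw [a₃, h4]
    · rcases h7 with h7 | h7 | h7 | h7 <;> rw [h7]
      · rw [b₁, h5]
      · rw [b₂, h5]
      · rw [b₃, h5]
      · exact grp_top _
  refine ⟨fun e he => (key e he).1, fun e he => ?_, fun e he => ?_, fun e he => ?_, fun g => ?_⟩
  · obtain ⟨g, -, h1, h2⟩ := hgrp e he; rw [h1, h2]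
  · obtain ⟨g, h0, h1, h2⟩ := hgrp e he; simp only [h1, h0]
  · obtain ⟨g, h0, h1, h2⟩ := hgrp e he; simp only [h2, h0]
  · refine ⟨insert (3 * K + g) ((Finset.range n).image (fun w => g * n + w) ∪
      ((Finset.range n).image (fun w => K + (g * n + w)) ∪
        (Finset.range n).image (fun w => 2 * K + (g * n + w)))), ?_, ?_⟩
    · refine (Finset.card_insert_le _ _).trans ?_
      have u₁ := Finset.card_union_le ((Finset.range n).image (fun w => g * n + w))
        ((Finset.range n).image (fun w => K + (g * n + w)) ∪
          (Finset.range n).image (fun w => 2 * K + (g * n + w)))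
      have u₂ := Finset.card_union_le ((Finset.range n).image (fun w => K + (g * n + w)))
        ((Finset.range n).image (fun w => 2 * K + (g * n + w)))
      have v₁ := Finset.card_image_le (s := Finset.range n) (f := fun w => g * n + w)
      have v₂ := Finset.card_image_le (s := Finset.range n) (f := fun w => K + (g * n + w))
      have v₃ := Finset.card_image_le (s := Finset.range n) (f := fun w => 2 * K + (g * n + w))
      rw [Finset.card_range] at v₁ v₂ v₃
      omega
    · intro x e he hx hg
      obtain ⟨g', h0, h1, h2⟩ := hgrp e he
      obtain ⟨-, g'', j, j', -, h3, h4, h5, h6, h7, h8⟩ := key e he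
      have hcell : ∀ j < K, j / n = g → ∃ w < n, g * n + w = j := by
        intro j hj hjg
        have hn : 0 < n := by
          rcases Nat.eq_zero_or_pos n with h | h
          · subst h; simp at hK; omega
          · exact h
        refine ⟨j % n, Nat.mod_lt _ hn, ?_⟩
        rw [← hjg]
        exact Nat.div_add_mod' j n
      obtain ⟨a₁, a₂, a₃⟩ := grp_of_lt (n := n) h3
      obtain ⟨b₁, b₂, b₃⟩ := grp_of_lt (n := n) h4
      have hg'' : g'' = g := by
        rcases hx with rfl | rfl
        · rcases h7 with h7 | h7 | h7 <;> rw [h7] at hg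
          · rw [← h5, ← hg, a₁]
          · rw [← h5, ← hg, a₂]
          · rw [← h5, ← hg, a₃]
        · rcases h8 with h8 | h8 | h8 | h8 <;> rw [h8] at hg
          · rw [← h6, ← hg, b₁]
          · rw [← h6, ← hg, b₂]
          · rw [← h6, ← hg, b₃]
          · rwa [grp_top] at hg
      subst hg''
      obtain ⟨w, hw, hw'⟩ := hcell j h3 h5
      obtain ⟨w', hw₁, hw₂⟩ := hcell j' h4 h6
      simp only [Finset.mem_insert, Finset.mem_union, Finset.mem_image, Finset.mem_range]
      rcases hx with rfl | rfl
      · rcases h7 with h7 | h7 | h7 <;> rw [h7]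
        · exact Or.inr (Or.inl ⟨w, hw, hw'⟩)
        · exact Or.inr (Or.inr (Or.inl ⟨w, hw, by rw [hw']⟩))
        · exact Or.inr (Or.inr (Or.inr ⟨w, hw, by rw [hw']⟩))
      · rcases h8 with h8 | h8 | h8 | h8 <;> rw [h8]
        · exact Or.inr (Or.inl ⟨w', hw₁, hw₂⟩)
        · exact Or.inr (Or.inr (Or.inl ⟨w', hw₁, by rw [hw₂]⟩))
        · exact Or.inr (Or.inr (Or.inr ⟨w', hw₁, by rw [hw₂]⟩))
        · exact Or.inl rfl

end

/-! ### A halving step preserves the balance of the groups -/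

/-- The number of products `e < m` in the group `lo` for which the warehouse `f e` is `w`. -/
def cnt (m : ℕ) (f φ : ℕ → ℕ) (lo w : ℕ) : ℕ :=
  ((Finset.range m).filter fun e => φ e = lo ∧ f e = w).card

/-- The products are divided into groups: `φ e` is the group of `e`, and the group `lo` has to be
scheduled in the rounds from `lo` to `min (lo + Q) ρ - 1`.  Averaged over these rounds, at most
`DA w` products leave and at most `DB w` products reach a warehouse `w`; and either in all groups
at least as many products reach `w` as leave it, or in all groups at most as many. -/
structure IsLabelling (m n ρ Q : ℕ) (src snk DA DB φ : ℕ → ℕ) : Prop where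
  lt : ∀ e < m, φ e < ρ
  dvd : ∀ e < m, Q ∣ φ e
  out : ∀ lo < ρ, ∀ w < n, cnt m src φ lo w ≤ min Q (ρ - lo) * DA w
  inn : ∀ lo < ρ, ∀ w < n, cnt m snk φ lo w ≤ min Q (ρ - lo) * DB w
  sign : ∀ w < n, (∀ lo < ρ, cnt m src φ lo w ≤ cnt m snk φ lo w) ∨
    (∀ lo < ρ, cnt m snk φ lo w ≤ cnt m src φ lo w)

/-- A number `x` that differs from the fraction `h / r` of `X` by less than `1` respects the bounds
that hold for `X` on average. -/
theorem rounding_le {r h X x d D : ℤ} (hr : 0 < r) (h0 : 0 ≤ h) (h1 : h ≤ r) (hd : d < r)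
    (hd' : -r < d) (he : r * x = h * X + d) (hX : X ≤ r * D) :
    x ≤ h * D ∧ X - x ≤ (r - h) * D := by
  constructor
  · have : r * x < r * (h * D + 1) := by
      have := mul_le_mul_of_nonneg_left hX h0
      nlinarith
    have := lt_of_mul_lt_mul_left this hr.le
    omega
  · have : r * (X - x) < r * ((r - h) * D + 1) := by
      have := mul_le_mul_of_nonneg_left hX (sub_nonneg.2 h1)
      nlinarith
    have := lt_of_mul_lt_mul_left this hr.le
    omega

/-- A number `x` that differs from the fraction `h / r` of `X ≥ 0` by less than `1` is a part
of `X`. -/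
theorem rounding_nonneg {r h X x d : ℤ} (hr : 0 < r) (h0 : 0 ≤ h) (h1 : h ≤ r) (hd : d < r)
    (hd' : -r < d) (he : r * x = h * X + d) (hX : 0 ≤ X) : 0 ≤ x ∧ x ≤ X := by
  constructor
  · have : r * (-1) < r * x := by
      have := mul_nonneg h0 hX
      nlinarith
    have := lt_of_mul_lt_mul_left this hr.le
    omega
  · have : r * x < r * (X + 1) := by
      have := mul_nonneg (sub_nonneg.2 h1) hX
      nlinarith
    have := lt_of_mul_lt_mul_left this hr.le
    omega

section
variable {m n ρ Q K : ℕ} {src snk φ T H MD F : ℕ → ℕ}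

theorem exc_eq_sum (G : ℕ → ℕ) (x : ℕ) (hI : ∀ j < K, IsInternal m n ρ Q K T H MD j) :
    exc (m + 3 * K) T H G x =
      ∑ e ∈ Finset.range m, (G e : ℤ) * ((if H e = x then 1 else 0) - (if T e = x then 1 else 0)) +
      (∑ j ∈ Finset.range K, (G (m + j) : ℤ) *
        ((if K + j = x then 1 else 0) - (if j = x then 1 else 0)) +
      (∑ j ∈ Finset.range K, (G (m + K + j) : ℤ) *
        ((if 2 * K + j = x then 1 else 0) - (if K + j = x then 1 else 0)) +
      ∑ j ∈ Finset.range K, (G (m + 2 * K + j) : ℤ) *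
        ((if 3 * K + j / n = x then 1 else 0) - (if K + j = x then 1 else 0)))) := by
  unfold exc
  rw [show m + 3 * K = m + (K + (K + K)) by ring, Finset.sum_range_add,
    Finset.sum_range_add _ K, Finset.sum_range_add _ K]
  congr 1
  refine congrArg₂ _ (Finset.sum_congr rfl fun j hj => ?_)
    (congrArg₂ _ (Finset.sum_congr rfl fun j hj => ?_) (Finset.sum_congr rfl fun j hj => ?_)) <;>
  have h := hI j (Finset.mem_range.1 hj)
  · rw [h.t₁, h.h₁]
  · rw [← Nat.add_assoc, h.t₂, h.h₂]
  · rw [show m + (K + (K + j)) = m + 2 * K + j by ring, h.t₃, h.h₃]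

namespace IsSetup
variable (h : IsSetup m n ρ Q K src snk φ T H MD F m)
include h

/-- The arc `m + j` has to carry the flow of the products that arrive. -/
theorem exc_in (G : ℕ → ℕ) {j : ℕ} (hj : j < K) : exc (m + 3 * K) T H G j =
    ∑ e ∈ (Finset.range m).filter (fun e => φ e * n + snk e = j), (G e : ℤ) - G (m + j) := by
  rw [exc_eq_sum G j h.internal, Finset.sum_filter,
    Finset.sum_eq_single (s := Finset.range K) (a := j),
    Finset.sum_eq_zero (s := Finset.range K), Finset.sum_eq_zero (s := Finset.range K),
    Finset.sum_congr (s₂ := Finset.range m) rfl (g := fun e => if φ e * n + snk e = j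
      then (G e : ℤ) else 0)]
  · rw [if_neg (by omega), if_pos rfl]; ring
  · intro e he
    rw [h.head e (Finset.mem_range.1 he), h.tail e (Finset.mem_range.1 he),
      if_neg (c := 2 * K + _ = j) (by omega)]
    split_ifs <;> simp
  · intro i hi
    rw [if_neg (by generalize i / n = q; omega), if_neg (by omega)]; simp
  · intro i hi
    rw [if_neg (by omega), if_neg (by omega)]; simp
  · intro i hi hij
    rw [if_neg (by omega), if_neg hij]; simp
  · intro hj'; exact absurd (Finset.mem_range.2 hj) hj'

/-- The arc `m + K + j` has to carry the flow of the products that depart. -/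
theorem exc_out (hsnk : ∀ e < m, φ e * n + snk e < K) (G : ℕ → ℕ) {j : ℕ} (hj : j < K) :
    exc (m + 3 * K) T H G (2 * K + j) = G (m + K + j) -
      ∑ e ∈ (Finset.range m).filter (fun e => φ e * n + src e = j), (G e : ℤ) := by
  rw [exc_eq_sum G _ h.internal, Finset.sum_filter, Finset.sum_eq_zero (s := Finset.range K),
    Finset.sum_eq_single (s := Finset.range K) (a := j),
    Finset.sum_eq_zero (s := Finset.range K),
    Finset.sum_congr (s₂ := Finset.range m) rfl (g := fun e => - if φ e * n + src e = j
      then (G e : ℤ) else 0), Finset.sum_neg_distrib]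
  · rw [if_pos rfl, if_neg (by omega)]; ring
  · intro e he
    have := hsnk e (Finset.mem_range.1 he)
    rw [h.head e (Finset.mem_range.1 he), h.tail e (Finset.mem_range.1 he),
      if_neg (c := φ e * n + snk e = _) (by omega)]
    simp only [add_right_inj]
    split_ifs <;> simp
  · intro i hi
    have := Finset.mem_range.1 hi
    rw [if_neg (by generalize i / n = q; omega), if_neg (by omega)]; simp
  · intro i hi hij
    have := Finset.mem_range.1 hi
    rw [if_neg (by omega), if_neg (by omega)]; simp
  · intro hj'; exact absurd (Finset.mem_range.2 hj) hj'
  · intro i hi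
    have := Finset.mem_range.1 hi
    rw [if_neg (by omega), if_neg (by omega)]; simp

/-- The arc `m + 2 * K + j` has to carry the difference between arrivals and departures. -/
theorem exc_hub (hsnk : ∀ e < m, φ e * n + snk e < K) (G : ℕ → ℕ) {j : ℕ} (hj : j < K) :
    exc (m + 3 * K) T H G (K + j) =
      (G (m + j) : ℤ) - G (m + K + j) - G (m + 2 * K + j) := by
  rw [exc_eq_sum G _ h.internal, Finset.sum_eq_zero (s := Finset.range m),
    Finset.sum_eq_single (s := Finset.range K) (a := j),
    Finset.sum_eq_single (s := Finset.range K) (a := j),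
    Finset.sum_eq_single (s := Finset.range K) (a := j)]
  · rw [if_pos rfl, if_neg (by omega), if_neg (by omega),
      if_neg (by generalize j / n = q; omega)]
    ring
  · intro i hi hij
    rw [if_neg (by generalize i / n = q; omega), if_neg (by omega)]; simp
  · intro hj'; exact absurd (Finset.mem_range.2 hj) hj'
  · intro i hi hij
    have := Finset.mem_range.1 hi
    rw [if_neg (by omega), if_neg (by omega)]; simp
  · intro hj'; exact absurd (Finset.mem_range.2 hj) hj'
  · intro i hi hij
    have := Finset.mem_range.1 hi
    rw [if_neg (by omega), if_neg (by omega)]; simp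
  · intro hj'; exact absurd (Finset.mem_range.2 hj) hj'
  · intro e he
    have := hsnk e (Finset.mem_range.1 he)
    rw [h.head e (Finset.mem_range.1 he), h.tail e (Finset.mem_range.1 he),
      if_neg (by omega), if_neg (by omega)]
    simp

end IsSetup

theorem filter_cell {f : ℕ → ℕ} (hf : ∀ e < m, f e < n) {lo w : ℕ} (hw : w < n) :
    (Finset.range m).filter (fun e => φ e * n + f e = lo * n + w) =
      (Finset.range m).filter (fun e => φ e = lo ∧ f e = w) := by
  refine Finset.filter_congr fun e he => ?_
  have hfe := hf e (Finset.mem_range.1 he)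
  constructor
  · intro h
    have h1 := congrArg (· / n) h
    have h2 := congrArg (· % n) h
    simp only [cell_div hfe, cell_div hw, cell_mod hfe, cell_mod hw] at h1 h2
    exact ⟨h1, h2⟩
  · rintro ⟨h1, h2⟩
    rw [h1, h2]

/-- The numbers of the products of the group `lo` at `w` that a rounded flow `F'` assigns to the
first half, and to the second half. -/
theorem sum_rounded {f F' : ℕ → ℕ} {lo w r : ℕ} (hr : 0 < r)
    (hF' : ∀ e < m, φ e = lo → F' e = 0 ∨ F' e = r) :
    ∑ e ∈ (Finset.range m).filter (fun e => φ e = lo ∧ f e = w), (F' e : ℤ) =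
      r * (((Finset.range m).filter fun e => (φ e = lo ∧ F' e ≠ 0) ∧ f e = w).card : ℤ) ∧
    cnt m f φ lo w = ((Finset.range m).filter fun e => (φ e = lo ∧ F' e ≠ 0) ∧ f e = w).card +
      ((Finset.range m).filter fun e => (φ e = lo ∧ F' e = 0) ∧ f e = w).card := by
  constructor
  · have : ((Finset.range m).filter fun e => (φ e = lo ∧ F' e ≠ 0) ∧ f e = w) =
        ((Finset.range m).filter fun e => φ e = lo ∧ f e = w).filter fun e => F' e ≠ 0 := by
      rw [Finset.filter_filter]
      exact Finset.filter_congr fun e _ => by tauto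
    rw [this, ← nsmul_eq_mul', ← Finset.sum_const, Finset.sum_filter fun e => F' e ≠ 0]
    refine Finset.sum_congr rfl fun e he => ?_
    simp only [Finset.mem_filter, Finset.mem_range] at he
    rcases hF' e he.1 he.2.1 with h | h
    · simp [h]
    · rw [if_pos (by omega), h]
  · have h1 : ((Finset.range m).filter fun e => (φ e = lo ∧ F' e ≠ 0) ∧ f e = w) =
        ((Finset.range m).filter fun e => φ e = lo ∧ f e = w).filter fun e => ¬ F' e = 0 := by
      rw [Finset.filter_filter]
      exact Finset.filter_congr fun e _ => by tauto
    have h2 : ((Finset.range m).filter fun e => (φ e = lo ∧ F' e = 0) ∧ f e = w) =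
        ((Finset.range m).filter fun e => φ e = lo ∧ f e = w).filter fun e => F' e = 0 := by
      rw [Finset.filter_filter]
      exact Finset.filter_congr fun e _ => by tauto
    rw [h1, h2, add_comm, Finset.card_filter_add_card_filter_not, cnt]

/-- The effect of rounding on one group: its two parts obey the bounds for their numbers of rounds,
and inherit the sign of the difference between arrivals and departures. -/
theorem IsSetup.split (hK : K = n * ρ) (hQ : 0 < Q) (hφ : ∀ e < m, φ e < ρ)
    (hsrc : ∀ e < m, src e < n) (hsnk : ∀ e < m, snk e < n)
    (h : IsSetup m n ρ Q K src snk φ T H MD F m) {F' : ℕ → ℕ}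
    (h01 : ∀ e < m + 3 * K, F' e = 0 ∨ F' e = MD e)
    (hint : ∀ e < m + 3 * K, F e = 0 ∨ F e = MD e → F' e = F e)
    (hexc : ∀ x, exc (m + 3 * K) T H F' x = exc (m + 3 * K) T H F x)
    {lo w DA DB a₁ a₂ b₁ b₂ : ℕ} (hlo : lo < ρ) (hw : w < n)
    (hDA : cnt m src φ lo w ≤ rnd ρ Q lo * DA) (hDB : cnt m snk φ lo w ≤ rnd ρ Q lo * DB)
    (ha₁ : a₁ = ((Finset.range m).filter fun e => (φ e = lo ∧ F' e ≠ 0) ∧ src e = w).card)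
    (ha₂ : a₂ = ((Finset.range m).filter fun e => (φ e = lo ∧ F' e = 0) ∧ src e = w).card)
    (hb₁ : b₁ = ((Finset.range m).filter fun e => (φ e = lo ∧ F' e ≠ 0) ∧ snk e = w).card)
    (hb₂ : b₂ = ((Finset.range m).filter fun e => (φ e = lo ∧ F' e = 0) ∧ snk e = w).card) :
    a₁ ≤ half ρ Q lo * DA ∧ a₂ ≤ (rnd ρ Q lo - half ρ Q lo) * DA ∧
    b₁ ≤ half ρ Q lo * DB ∧ b₂ ≤ (rnd ρ Q lo - half ρ Q lo) * DB ∧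
    (cnt m src φ lo w ≤ cnt m snk φ lo w → a₁ ≤ b₁ ∧ a₂ ≤ b₂) ∧
    (cnt m snk φ lo w ≤ cnt m src φ lo w → b₁ ≤ a₁ ∧ b₂ ≤ a₂) := by
  have hj := cell_lt hK hlo hw
  have hcell : ∀ e < m, φ e * n + snk e < K := fun e he => cell_lt hK (hφ e he) (hsnk e he)
  have hr : 0 < rnd ρ Q lo := rnd_pos hQ hlo
  have hh : half ρ Q lo ≤ rnd ρ Q lo := min_le_right _ _
  have hI := h.internal _ hj
  have hF' : ∀ e < m, φ e = lo → F' e = 0 ∨ F' e = rnd ρ Q lo := by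
    intro e he hlo
    have := h01 e (by omega)
    rwa [h.mod e he, hlo] at this
  obtain ⟨sA, cA⟩ := sum_rounded (f := src) (w := w) hr hF'
  obtain ⟨sB, cB⟩ := sum_rounded (f := snk) (w := w) hr hF'
  rw [← ha₁, ← ha₂] at cA
  rw [← hb₁, ← hb₂] at cB
  rw [← ha₁] at sA
  rw [← hb₁] at sB
  have hsum : ∀ f : ℕ → ℕ,
      ∑ e ∈ (Finset.range m).filter (fun e => φ e = lo ∧ f e = w), (F e : ℤ) =
      half ρ Q lo * cnt m f φ lo w := by
    intro f
    rw [cnt, ← nsmul_eq_mul', ← Finset.sum_const]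
    refine Finset.sum_congr rfl fun e he => ?_
    simp only [Finset.mem_filter, Finset.mem_range] at he
    rw [h.flow e he.1, he.2.1]
  have hd : ∀ a < 3 * K, MD (m + a) = rnd ρ Q lo →
      (F' (m + a) : ℤ) - F (m + a) < rnd ρ Q lo ∧
      -(rnd ρ Q lo : ℤ) < (F' (m + a) : ℤ) - F (m + a) := by
    intro a ha hMD
    have h1 := h.lt a ha
    have h2 := h01 (m + a) (by omega)
    have h3 := hint (m + a) (by omega)
    rw [hMD] at h1 h2 h3
    rcases Nat.eq_zero_or_pos (F (m + a)) with h0 | h0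
    · rw [h3 (Or.inl h0)]; omega
    · rcases h2 with h2 | h2 <;> rw [h2] <;> push_cast <;> omega
  have eB := hexc (lo * n + w)
  have eA := hexc (2 * K + (lo * n + w))
  have eD := hexc (K + (lo * n + w))
  rw [h.exc_in _ hj, h.exc_in _ hj, filter_cell hsnk hw, sB, hsum] at eB
  rw [h.exc_out hcell _ hj, h.exc_out hcell _ hj, filter_cell hsrc hw, sA, hsum] at eA
  rw [h.exc_hub hcell _ hj, h.exc_hub hcell _ hj] at eD
  obtain ⟨dB, dB'⟩ := hd (lo * n + w) (by omega) (by rw [hI.d₁, cell_div hw])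
  obtain ⟨dA, dA'⟩ := hd (K + (lo * n + w)) (by omega)
    (by rw [← Nat.add_assoc, hI.d₂, cell_div hw])
  obtain ⟨dD, dD'⟩ := hd (2 * K + (lo * n + w)) (by omega)
    (by rw [← Nat.add_assoc, hI.d₃, cell_div hw])
  rw [← Nat.add_assoc m K] at dA dA'
  rw [← Nat.add_assoc m (2 * K)] at dD dD'
  have hrZ : (0 : ℤ) < rnd ρ Q lo := by exact_mod_cast hr
  have hhZ : (half ρ Q lo : ℤ) ≤ rnd ρ Q lo := by exact_mod_cast hh
  have hh0 : (0 : ℤ) ≤ half ρ Q lo := by positivity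
  obtain ⟨u₁, u₂⟩ := rounding_le (x := a₁) hrZ hh0 hhZ dA dA' (by linarith)
    (by exact_mod_cast hDA : (cnt m src φ lo w : ℤ) ≤ rnd ρ Q lo * DA)
  obtain ⟨v₁, v₂⟩ := rounding_le (x := b₁) hrZ hh0 hhZ dB dB' (by linarith)
    (by exact_mod_cast hDB : (cnt m snk φ lo w : ℤ) ≤ rnd ρ Q lo * DB)
  rw [cA] at u₂
  rw [cB] at v₂
  rw [← Nat.cast_sub hh] at u₂ v₂
  refine ⟨by exact_mod_cast u₁, ?_, by exact_mod_cast v₁, ?_, fun hle => ?_, fun hle => ?_⟩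
  · have : (a₂ : ℤ) ≤ ((rnd ρ Q lo - half ρ Q lo : ℕ) : ℤ) * DA := by push_cast at u₂ ⊢; linarith
    exact_mod_cast this
  · have : (b₂ : ℤ) ≤ ((rnd ρ Q lo - half ρ Q lo : ℕ) : ℤ) * DB := by push_cast at v₂ ⊢; linarith
    exact_mod_cast this
  · have hle' : (0 : ℤ) ≤ (cnt m snk φ lo w : ℤ) - cnt m src φ lo w := by
      rw [sub_nonneg]; exact_mod_cast hle
    have := rounding_nonneg (x := (b₁ : ℤ) - a₁) hrZ hh0 hhZ dD dD' (by linarith) hle'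
    rw [cA, cB] at this
    push_cast at this
    omega
  · have hle' : (0 : ℤ) ≤ (cnt m src φ lo w : ℤ) - cnt m snk φ lo w := by
      rw [sub_nonneg]; exact_mod_cast hle
    have := rounding_nonneg (x := (a₁ : ℤ) - b₁) (d := -((F' (m + 2 * K + (lo * n + w)) : ℤ) -
      F (m + 2 * K + (lo * n + w)))) hrZ hh0 hhZ (by linarith) (by linarith) (by linarith) hle'
    rw [cA, cB] at this
    push_cast at this
    omega

/-- The groups of length `2 * Q` are split into groups of length `Q` by the rounded flow. -/
theorem IsLabelling.next (hK : K = n * ρ) (hQ : 0 < Q) (hsrc : ∀ e < m, src e < n)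
    (hsnk : ∀ e < m, snk e < n) {DA DB : ℕ → ℕ}
    (hφ : IsLabelling m n ρ (2 * Q) src snk DA DB φ)
    (h : IsSetup m n ρ Q K src snk φ T H MD F m) {F' φ' : ℕ → ℕ}
    (h01 : ∀ e < m + 3 * K, F' e = 0 ∨ F' e = MD e)
    (hint : ∀ e < m + 3 * K, F e = 0 ∨ F e = MD e → F' e = F e)
    (hexc : ∀ x, exc (m + 3 * K) T H F' x = exc (m + 3 * K) T H F x)
    (hφ' : ∀ e < m, φ' e = if F' e = 0 then φ e + Q else φ e) :
    IsLabelling m n ρ Q src snk DA DB φ' := by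
  have hsplit := fun lo w (hlo : lo < ρ) (hw : w < n) =>
    h.split hK hQ hφ.lt hsrc hsnk h01 hint hexc hlo hw (hφ.out lo hlo w hw) (hφ.inn lo hlo w hw)
      rfl rfl rfl rfl
  -- a product can only be moved if its group has more than `Q` rounds
  have hmove : ∀ e < m, F' e = 0 → φ e + Q < ρ := by
    intro e he h0
    have h1 := hint e (by omega)
    rw [h.flow e he, h.mod e he, h0] at h1
    have h2 := hφ.lt e he
    by_contra hcon
    have h3 : half ρ Q (φ e) = rnd ρ Q (φ e) := by unfold half rnd; omega
    have h4 := h1 (Or.inr h3)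
    have := rnd_pos hQ h2
    omega
  have hlow : ∀ f lo w, 2 * Q ∣ lo → cnt m f φ' lo w =
      ((Finset.range m).filter fun e => (φ e = lo ∧ F' e ≠ 0) ∧ f e = w).card := by
    intro f lo w hlo
    unfold cnt
    congr 1
    refine Finset.filter_congr fun e he => ?_
    have he := Finset.mem_range.1 he
    rw [hφ' e he]
    have := hφ.dvd e he
    split_ifs with h0
    · have : φ e + Q ≠ lo := by
        rintro rfl
        have h2 : 2 * Q ∣ Q := (Nat.dvd_add_right this).1 hlo
        have := Nat.le_of_dvd hQ h2
        omega
      tauto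
    · tauto
  have hhigh : ∀ f lo w, ¬ 2 * Q ∣ lo → cnt m f φ' lo w = if Q ≤ lo then
      ((Finset.range m).filter fun e => (φ e = lo - Q ∧ F' e = 0) ∧ f e = w).card else 0 := by
    intro f lo w hlo
    unfold cnt
    split_ifs with hQlo
    · congr 1
      refine Finset.filter_congr fun e he => ?_
      have he := Finset.mem_range.1 he
      rw [hφ' e he]
      have := hφ.dvd e he
      split_ifs with h0
      · have : φ e + Q = lo ↔ φ e = lo - Q := by omega
        tauto
      · have : φ e ≠ lo := by rintro rfl; exact hlo this
        tauto
    · rw [Finset.card_eq_zero, Finset.filter_eq_empty_iff]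
      intro e he
      have he := Finset.mem_range.1 he
      rw [hφ' e he]
      have := hφ.dvd e he
      split_ifs with h0
      · omega
      · have : φ e ≠ lo := by rintro rfl; exact hlo this
        tauto
  have hr₁ : ∀ lo, half ρ Q lo = min Q (ρ - lo) := by intro lo; unfold half rnd; omega
  have hr₂ : ∀ lo < ρ, Q ≤ lo → rnd ρ Q (lo - Q) - half ρ Q (lo - Q) = min Q (ρ - lo) := by
    intro lo h1 h2; unfold half rnd; omega
  refine ⟨fun e he => ?_, fun e he => ?_, fun lo hlo w hw => ?_, fun lo hlo w hw => ?_,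
    fun w hw => ?_⟩
  · rw [hφ' e he]
    split_ifs with h0
    · exact hmove e he h0
    · exact hφ.lt e he
  · rw [hφ' e he]
    have := (Nat.dvd_mul_left Q 2).trans (hφ.dvd e he)
    split_ifs with h0
    · exact (Nat.dvd_add_right this).2 dvd_rfl
    · exact this
  · by_cases hd : 2 * Q ∣ lo
    · rw [hlow _ _ _ hd, ← hr₁]; exact (hsplit lo w hlo hw).1
    · rw [hhigh _ _ _ hd]
      split_ifs with hQlo
      · rw [← hr₂ lo hlo hQlo]; exact (hsplit (lo - Q) w (by omega) hw).2.1
      · exact Nat.zero_le _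
  · by_cases hd : 2 * Q ∣ lo
    · rw [hlow _ _ _ hd, ← hr₁]; exact (hsplit lo w hlo hw).2.2.1
    · rw [hhigh _ _ _ hd]
      split_ifs with hQlo
      · rw [← hr₂ lo hlo hQlo]; exact (hsplit (lo - Q) w (by omega) hw).2.2.2.1
      · exact Nat.zero_le _
  · refine (hφ.sign w hw).imp (fun hs lo hlo => ?_) (fun hs lo hlo => ?_)
    · by_cases hd : 2 * Q ∣ lo
      · rw [hlow _ _ _ hd, hlow _ _ _ hd]
        exact ((hsplit lo w hlo hw).2.2.2.2.1 (hs lo hlo)).1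
      · rw [hhigh _ _ _ hd, hhigh _ _ _ hd]
        split_ifs with hQlo
        · exact ((hsplit (lo - Q) w (by omega) hw).2.2.2.2.1 (hs _ (by omega))).2
        · exact le_rfl
    · by_cases hd : 2 * Q ∣ lo
      · rw [hlow _ _ _ hd, hlow _ _ _ hd]
        exact ((hsplit lo w hlo hw).2.2.2.2.2 (hs lo hlo)).1
      · rw [hhigh _ _ _ hd, hhigh _ _ _ hd]
        split_ifs with hQlo
        · exact ((hsplit (lo - Q) w (by omega) hw).2.2.2.2.2 (hs _ (by omega))).2
        · exact le_rfl

end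

/-! ### The program for a halving step

The word variables `0` to `5` hold `m`, `n`, `ρ`, `Q`, `K = n * ρ` and the number of arcs
`m + 3 * K`; the word array `2` holds the groups `φ` of the products.  For the current product `6`,
the word variables `9` and `10` are the cells of its source and its sink in its group, `7` is the
number of rounds of the group and `8` that of its first half. -/

/-- The number of rounds of the group with the first round `lo`; `a - (a - b)` is `min a b`. -/
abbrev rndExp (lo : WordExp) : WordExp :=
  .sub (.add (vr 3) (vr 3)) (.sub (.add (vr 3) (vr 3)) (.sub (vr 2) lo))

/-- Clear the flow. -/
def clearProg : Program := .forLoop 6 (vr 5) (.put 5 (vr 6) (cn 0))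

/-- The body of `internalProg`. -/
def internalBody : Program :=
  .seq (.put 3 (.add (vr 0) (vr 6)) (vr 6))
  (.seq (.put 4 (.add (vr 0) (vr 6)) (.add (vr 4) (vr 6)))
  (.seq (.put 6 (.add (vr 0) (vr 6)) (rndExp (.div (vr 6) (vr 1))))
  (.seq (.put 3 (.add (.add (vr 0) (vr 4)) (vr 6)) (.add (vr 4) (vr 6)))
  (.seq (.put 4 (.add (.add (vr 0) (vr 4)) (vr 6)) (.add (.mul (cn 2) (vr 4)) (vr 6)))
  (.seq (.put 6 (.add (.add (vr 0) (vr 4)) (vr 6)) (rndExp (.div (vr 6) (vr 1))))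
  (.seq (.put 3 (.add (.add (vr 0) (.mul (cn 2) (vr 4))) (vr 6)) (.add (vr 4) (vr 6)))
  (.seq (.put 4 (.add (.add (vr 0) (.mul (cn 2) (vr 4))) (vr 6))
    (.add (.mul (cn 3) (vr 4)) (.div (vr 6) (vr 1))))
  (.put 6 (.add (.add (vr 0) (.mul (cn 2) (vr 4))) (vr 6)) (rndExp (.div (vr 6) (vr 1)))))))))))

/-- Write down the internal arcs. -/
def internalProg : Program := .forLoop 6 (vr 4) internalBody

/-- Add `c` to the flow on the arc `a` modulo the word variable `7`. -/
def addMod (a c : WordExp) : Program :=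
  .put 5 a (.sub (.add (gt 5 a) c) (.mul (vr 7) (.div (.add (gt 5 a) c) (vr 7))))

/-- The body of `productProg`. -/
def productBody : Program :=
  .seq (.set 9 (.add (.mul (gt 2 (vr 6)) (vr 1)) (gt 0 (vr 6))))
  (.seq (.set 10 (.add (.mul (gt 2 (vr 6)) (vr 1)) (gt 1 (vr 6))))
  (.seq (.set 7 (rndExp (gt 2 (vr 6))))
  (.seq (.set 8 (.sub (vr 3) (.sub (vr 3) (vr 7))))
  (.seq (.put 3 (vr 6) (.add (.mul (cn 2) (vr 4)) (vr 9)))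
  (.seq (.put 4 (vr 6) (vr 10))
  (.seq (.put 6 (vr 6) (vr 7))
  (.seq (.put 5 (vr 6) (vr 8))
  (.seq (addMod (.add (vr 0) (vr 10)) (vr 8))
  (.seq (addMod (.add (.add (vr 0) (vr 4)) (vr 9)) (vr 8))
  (.seq (addMod (.add (.add (vr 0) (.mul (cn 2) (vr 4))) (vr 10)) (vr 8))
  (addMod (.add (.add (vr 0) (.mul (cn 2) (vr 4))) (vr 9)) (.sub (vr 7) (vr 8)))))))))))))

/-- Enter the products into the network. -/
def productProg : Program := .forLoop 6 (vr 0) productBody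

/-- Move the products without flow to the second halves of their groups. -/
def moveProg : Program :=
  .forLoop 6 (vr 0)
    (.ite (.le (gt 5 (vr 6)) (cn 0)) (.put 2 (vr 6) (.add (gt 2 (vr 6)) (vr 3))) .skip)

/-- A halving step: the groups of `2 * Q` rounds are split into groups of `Q` rounds. -/
def halvingProg : Program :=
  .seq clearProg (.seq internalProg (.seq productProg (.seq roundProg moveProg)))

theorem Store.seta_arr_self (σ : Store) (a i v : ℕ) :
    (σ.seta a i v).arr a = Function.update (σ.arr a) i v := by simp

theorem sub_sub_eq_rnd (ρ Q lo : ℕ) : Q + Q - (Q + Q - (ρ - lo)) = rnd ρ Q lo := by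
  unfold rnd; omega

section
variable {B m n ρ Q K : ℕ} {σ : Store}

theorem WP_clearProg (hB : σ.var 5 < B) :
    WP B clearProg σ fun t σ' => (∀ e < σ.var 5, σ'.arr 5 e = 0) ∧ t ≤ 12 * σ.var 5 + 10 := by
  refine (WP_forLoop (N := vr 5) (σ.var 5) (fun _ => 3) (fun k s => ∀ e < k, s.arr 5 e = 0) hB
    (by rfl) (fun s k hf _ => hf.var 5 (by rfl)) (by simp) (by simp) ?_).mono ?_
  · intro k s hk _ hsk hI
    refine WP_put (by simp [WordExp.eval]; omega) ⟨?_, by simp [WordExp.cost]⟩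
    intro e he
    simp only [Store.seta_arr_self, WordExp.eval, hsk]
    by_cases hek : e = k
    · subst hek; simp
    · rw [Function.update_of_ne hek]; exact hI e (by omega)
  · rintro t s ⟨-, h, ht⟩
    refine ⟨h, ?_⟩
    simp [WordExp.cost] at ht; omega

theorem WP_internalProg (h0 : σ.var 0 = m) (h1 : σ.var 1 = n) (h2 : σ.var 2 = ρ) (h3 : σ.var 3 = Q)
    (h4 : σ.var 4 = K) (hK : K = n * ρ) (hB : m + 4 * K + 2 * ρ + 2 * Q < B) :
    WP B internalProg σ fun t σ' =>
      (∀ j < K, IsInternal m n ρ Q K (σ'.arr 3) (σ'.arr 4) (σ'.arr 6) j) ∧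
        t ≤ 150 * K + 10 := by
  refine (WP_forLoop (N := vr 4) K (fun _ => 130)
    (fun k s => ∀ j < k, IsInternal m n ρ Q K (s.arr 3) (s.arr 4) (s.arr 6) j) (by omega)
    (by rfl) (fun s k hf _ => (hf.var 4 (by rfl)).trans h4) (by simp) (by simp) ?_).mono ?_
  · intro k s hk hf hsk hI
    have e0 : s.var 0 = m := (hf.var 0 (by rfl)).trans h0
    have e1 : s.var 1 = n := (hf.var 1 (by rfl)).trans h1
    have e2 : s.var 2 = ρ := (hf.var 2 (by rfl)).trans h2
    have e3 : s.var 3 = Q := (hf.var 3 (by rfl)).trans h3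
    have e4 : s.var 4 = K := (hf.var 4 (by rfl)).trans h4
    have hq : k / n < ρ := Nat.div_lt_of_lt_mul (hK ▸ hk)
    have hrB : rnd ρ Q (k / n) < B := by unfold rnd; omega
    refine WP_seq (WP_put ?_ (WP_seq (WP_put ?_ (WP_seq (WP_put ?_ (WP_seq (WP_put ?_
      (WP_seq (WP_put ?_ (WP_seq (WP_put ?_ (WP_seq (WP_put ?_ (WP_seq (WP_put ?_
      (WP_put ?_ ⟨?_, ?_⟩)))))))))))))))) <;>
    simp only [WordExp.eval, WordExp.cost, Store.seta_var, e0, e1, e2, e3, e4, hsk, sub_sub_eq_rnd]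
    any_goals first | exact hrB | omega | (generalize k / n = q at hq ⊢; omega)
    intro j hj
    norm_num
    by_cases hjk : j = k
    · subst hjk
      constructor <;> simp only [Function.update_apply] <;> split_ifs <;> first | rfl | omega
    · have := hI j (by omega)
      constructor <;> simp only [Function.update_apply] <;> split_ifs <;> first
        | omega
        | (first | exact this.t₁ | exact this.t₂ | exact this.t₃ | exact this.h₁ | exact this.h₂
                 | exact this.h₃ | exact this.d₁ | exact this.d₂ | exact this.d₃)
  · rintro t s ⟨-, h, ht⟩
    refine ⟨h, ?_⟩
    simp [WordExp.cost] at ht; omega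

theorem WP_addMod {a c : WordExp} {x v r : ℕ} {P : ℕ → Store → Prop} (ha : a.eval σ = x)
    (hc : c.eval σ = v) (hr : σ.var 7 = r) (hr0 : 0 < r) (hrB : r < B)
    (hP : P (3 * a.cost + 2 * c.cost + 10) (σ.seta 5 x ((σ.arr 5 x + v) % r))) :
    WP B (addMod a c) σ P := by
  have he : (WordExp.sub (.add (gt 5 a) c) (.mul (vr 7) (.div (.add (gt 5 a) c) (vr 7)))).eval σ =
      (σ.arr 5 x + v) % r := by
    simp only [WordExp.eval, ha, hc, hr]
    exact (Nat.mod_eq_sub_mul_div).symm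
  refine WP_put ?_ ?_
  · rw [he]; exact (Nat.mod_lt _ hr0).trans hrB
  · rw [he, ha]
    convert hP using 1
    simp only [WordExp.cost]; ring

theorem WP_productProg (h0 : σ.var 0 = m) (h1 : σ.var 1 = n) (h2 : σ.var 2 = ρ) (h3 : σ.var 3 = Q)
    (h4 : σ.var 4 = K) (hK : K = n * ρ) (hQ : 0 < Q) (hB : m + 4 * K + 2 * ρ + 2 * Q < B)
    (hφ : ∀ e < m, σ.arr 2 e < ρ) (hsrc : ∀ e < m, σ.arr 0 e < n) (hsnk : ∀ e < m, σ.arr 1 e < n)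
    (hF : ∀ e < m + 3 * K, σ.arr 5 e = 0)
    (hI : ∀ j < K, IsInternal m n ρ Q K (σ.arr 3) (σ.arr 4) (σ.arr 6) j) :
    WP B productProg σ fun t σ' =>
      IsSetup m n ρ Q K (σ.arr 0) (σ.arr 1) (σ.arr 2) (σ'.arr 3) (σ'.arr 4) (σ'.arr 6) (σ'.arr 5)
        m ∧ t ≤ 300 * m + 10 := by
  refine (WP_forLoop (N := vr 0) m (fun _ => 250)
    (fun k s => IsSetup m n ρ Q K (σ.arr 0) (σ.arr 1) (σ.arr 2) (s.arr 3) (s.arr 4) (s.arr 6)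
      (s.arr 5) k) (by omega)
    (by rfl) (fun s k hf _ => (hf.var 0 (by rfl)).trans h0) ?_ (fun k s v h => by simpa using h)
    ?_).mono ?_
  · simp only [Store.setv_arr]
    refine ⟨hI, fun e he => absurd he (by omega), fun e he => absurd he (by omega),
      fun e he => absurd he (by omega), fun e he => absurd he (by omega),
      fun e he _ => hF e (by omega), fun a ha => ?_, fun x => ?_, ?_⟩
    · rw [hF _ (by omega)]
      obtain ⟨j, hj, hja⟩ := exists_internal ha
      have hIj := hI j hj
      have hq : j / n < ρ := Nat.div_lt_of_lt_mul (hK ▸ hj)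
      have hr := rnd_pos hQ hq
      rcases hja with rfl | rfl | rfl
      · rwa [hIj.d₁]
      · rwa [← Nat.add_assoc, hIj.d₂]
      · rwa [← Nat.add_assoc, hIj.d₃]
    · have : exc (m + 3 * K) (σ.arr 3) (σ.arr 4) (σ.arr 5) x = 0 := by
        refine Finset.sum_eq_zero fun e he => ?_
        rw [hF e (Finset.mem_range.1 he)]; simp
      rw [this]; exact dvd_zero _
    · rw [Finset.filter_eq_empty_iff.2, Finset.card_empty]
      intro e he
      simpa using hF e (Finset.mem_range.1 he)
  · intro k s hk hf hsk hS
    have e0 : s.var 0 = m := (hf.var 0 (by rfl)).trans h0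
    have e1 : s.var 1 = n := (hf.var 1 (by rfl)).trans h1
    have e2 : s.var 2 = ρ := (hf.var 2 (by rfl)).trans h2
    have e3 : s.var 3 = Q := (hf.var 3 (by rfl)).trans h3
    have e4 : s.var 4 = K := (hf.var 4 (by rfl)).trans h4
    have a0 : s.arr 0 = σ.arr 0 := hf.arr 0 (by rfl)
    have a1 : s.arr 1 = σ.arr 1 := hf.arr 1 (by rfl)
    have a2 : s.arr 2 = σ.arr 2 := hf.arr 2 (by rfl)
    obtain ⟨js, hjs⟩ : ∃ js, js = σ.arr 2 k * n + σ.arr 0 k := ⟨_, rfl⟩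
    obtain ⟨jt, hjt⟩ : ∃ jt, jt = σ.arr 2 k * n + σ.arr 1 k := ⟨_, rfl⟩
    obtain ⟨r, hr⟩ : ∃ r, r = rnd ρ Q (σ.arr 2 k) := ⟨_, rfl⟩
    obtain ⟨c, hc⟩ : ∃ c, c = half ρ Q (σ.arr 2 k) := ⟨_, rfl⟩
    have hjsK : js < K := hjs ▸ cell_lt hK (hφ k hk) (hsrc k hk)
    have hjtK : jt < K := hjt ▸ cell_lt hK (hφ k hk) (hsnk k hk)
    have hr0 : 0 < r := hr ▸ rnd_pos hQ (hφ k hk)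
    have hrB : r < B := by rw [hr]; unfold rnd; omega
    have hc' : Q - (Q - r) = c := by rw [hc, hr]; unfold half; omega
    have hnext := hS.next hK hQ hk (hφ k hk) (hsrc k hk) (hsnk k hk) hjs hjt hr hc rfl rfl rfl rfl
    refine WP_seq (WP_set (by simp only [WordExp.eval, e1, a0, a2, hsk, ← hjs]; omega) ?_)
    simp only [WordExp.eval, e1, a0, a2, hsk, ← hjs]
    refine WP_seq (WP_set ?_ ?_) <;>
      simp [WordExp.eval, e1, a1, a2, hsk, ← hjt]
    · omega
    refine WP_seq (WP_set ?_ ?_) <;>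
      simp [WordExp.eval, e2, e3, a2, hsk, sub_sub_eq_rnd, ← hr]
    · exact hrB
    refine WP_seq (WP_set ?_ ?_) <;> simp [WordExp.eval, e3, hc']
    · omega
    refine WP_seq (WP_put ?_ ?_) <;> simp [WordExp.eval, e4, hsk]
    · omega
    refine WP_seq (WP_put ?_ ?_) <;> simp [WordExp.eval, hsk]
    · omega
    refine WP_seq (WP_put ?_ ?_) <;> simp [WordExp.eval, hsk]
    · exact hrB
    refine WP_seq (WP_put ?_ ?_) <;> simp [WordExp.eval, hsk]
    · omega
    refine WP_seq (WP_addMod (x := m + jt) (v := c) (r := r) (by simp [WordExp.eval, e0])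
      (by simp [WordExp.eval]) (by simp) hr0 hrB ?_)
    refine WP_seq (WP_addMod (x := m + K + js) (v := c) (r := r) (by simp [WordExp.eval, e0, e4])
      (by simp [WordExp.eval]) (by simp) hr0 hrB ?_)
    refine WP_seq (WP_addMod (x := m + 2 * K + jt) (v := c) (r := r)
      (by simp [WordExp.eval, e0, e4])
      (by simp [WordExp.eval]) (by simp) hr0 hrB ?_)
    refine WP_addMod (x := m + 2 * K + js) (v := r - c) (r := r) (by simp [WordExp.eval, e0, e4])
      (by simp [WordExp.eval]) (by simp) hr0 hrB ?_
    refine ⟨?_, by simp [WordExp.cost]⟩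
    convert hnext using 1 <;> simp
  · rintro t s ⟨-, h, ht⟩
    refine ⟨h, ?_⟩
    simp [WordExp.cost] at ht; omega

theorem WP_moveProg (h0 : σ.var 0 = m) (h3 : σ.var 3 = Q) (hB : m < B)
    (hφ : ∀ e < m, σ.arr 2 e + Q < B) :
    WP B moveProg σ fun t σ' =>
      (∀ e < m, σ'.arr 2 e = if σ.arr 5 e = 0 then σ.arr 2 e + Q else σ.arr 2 e) ∧
        t ≤ 30 * m + 10 := by
  refine (WP_forLoop (N := vr 0) m (fun _ => 20)
    (fun k s => (∀ e < k, s.arr 2 e = if σ.arr 5 e = 0 then σ.arr 2 e + Q else σ.arr 2 e) ∧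
      ∀ e, k ≤ e → s.arr 2 e = σ.arr 2 e) hB
    (by rfl) (fun s k hf _ => (hf.var 0 (by rfl)).trans h0) (by simp) (by simp) ?_).mono ?_
  · rintro k s hk hf hsk ⟨hI₁, hI₂⟩
    have e3 : s.var 3 = Q := (hf.var 3 (by rfl)).trans h3
    have a5 : s.arr 5 = σ.arr 5 := hf.arr 5 (by rfl)
    have hk2 := hI₂ k le_rfl
    refine WP_ite (fun h => WP_put ?_ ⟨⟨fun e he => ?_, fun e he => ?_⟩, ?_⟩)
      (fun h => WP_skip ⟨⟨fun e he => ?_, fun e he => ?_⟩, ?_⟩) <;>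
    simp only [Test.Holds, WordExp.eval, hsk, a5, Nat.le_zero] at h
    · simp only [WordExp.eval, hsk, e3, hk2]; exact hφ k hk
    · simp only [Store.seta_arr_self, WordExp.eval, hsk, e3, hk2]
      by_cases hek : e = k
      · subst hek; rw [Function.update_self, if_pos h]
      · rw [Function.update_of_ne hek]; exact hI₁ e (by omega)
    · simp only [Store.seta_arr_self, WordExp.eval, hsk, e3, hk2]
      rw [Function.update_of_ne (by omega)]; exact hI₂ e (by omega)
    · simp [WordExp.cost, Test.cost]
    · by_cases hek : e = k
      · subst hek; rw [if_neg h, hk2]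
      · exact hI₁ e (by omega)
    · exact hI₂ e (by omega)
    · simp [WordExp.cost, Test.cost]
  · rintro t s ⟨-, h, ht⟩
    refine ⟨h.1, ?_⟩
    simp [WordExp.cost] at ht; omega

theorem WP_halvingProg (h0 : σ.var 0 = m) (h1 : σ.var 1 = n) (h2 : σ.var 2 = ρ) (h3 : σ.var 3 = Q)
    (h4 : σ.var 4 = K) (h5 : σ.var 5 = m + 3 * K) (hK : K = n * ρ) (hQ : 0 < Q)
    (hB : m + 4 * K + 2 * ρ + 2 * Q < B) (hsrc : ∀ e < m, σ.arr 0 e < n)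
    (hsnk : ∀ e < m, σ.arr 1 e < n) (hpa : ∀ x, σ.arr 7 x = 0) {DA DB : ℕ → ℕ}
    (hφ : IsLabelling m n ρ (2 * Q) (σ.arr 0) (σ.arr 1) DA DB (σ.arr 2)) :
    WP B halvingProg σ fun t σ' =>
      IsLabelling m n ρ Q (σ.arr 0) (σ.arr 1) DA DB (σ'.arr 2) ∧ (∀ x, σ'.arr 7 x = 0) ∧
        t ≤ 400 * m + 300 * K + (140 * (3 * n + 1) + 100) * (5 * m) + 50 := by
  refine WP_seq ((WP_clearProg (by rw [h5]; omega)).frame.mono ?_)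
  rintro t₁ s₁ ⟨f₁, hF₁, ht₁⟩
  rw [h5] at hF₁ ht₁
  refine WP_seq ((WP_internalProg ((f₁.var 0 (by rfl)).trans h0) ((f₁.var 1 (by rfl)).trans h1)
    ((f₁.var 2 (by rfl)).trans h2) ((f₁.var 3 (by rfl)).trans h3)
    ((f₁.var 4 (by rfl)).trans h4) hK hB).frame.mono ?_)
  rintro t₂ s₂ ⟨f₂, hI₂, ht₂⟩
  have a0 : s₂.arr 0 = σ.arr 0 := (f₂.arr 0 (by rfl)).trans (f₁.arr 0 (by rfl))
  have a1 : s₂.arr 1 = σ.arr 1 := (f₂.arr 1 (by rfl)).trans (f₁.arr 1 (by rfl))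
  have a2 : s₂.arr 2 = σ.arr 2 := (f₂.arr 2 (by rfl)).trans (f₁.arr 2 (by rfl))
  have a5 : s₂.arr 5 = s₁.arr 5 := f₂.arr 5 (by rfl)
  have v : ∀ x < 6, s₂.var x = σ.var x := by
    intro x hx
    rw [f₂.var x (by interval_cases x <;> rfl), f₁.var x (by interval_cases x <;> rfl)]
  refine WP_seq ((WP_productProg ((v 0 (by omega)).trans h0) ((v 1 (by omega)).trans h1)
    ((v 2 (by omega)).trans h2) ((v 3 (by omega)).trans h3) ((v 4 (by omega)).trans h4) hK hQ hB
    (by rw [a2]; exact hφ.lt) (by rw [a0]; exact hsrc) (by rw [a1]; exact hsnk)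
    (by rw [a5]; exact hF₁) hI₂).frame.mono ?_)
  rintro t₃ s₃ ⟨f₃, hS, ht₃⟩
  rw [a0, a1, a2] at hS
  have hN := hS.isNetwork hK hφ.lt hsrc hsnk
  have v' : ∀ x < 6, s₃.var x = σ.var x := by
    intro x hx
    rw [f₃.var x (by interval_cases x <;> rfl), v x hx]
  have hM : s₃.var 5 = m + 3 * K := (v' 5 (by omega)).trans h5
  -- bounds for what is stored in the network
  have hbd : ∀ e < m + 3 * K, (s₃.arr 3 e < B ∧ s₃.arr 4 e < B ∧ s₃.arr 6 e < B) ∧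
      s₃.arr 5 e ≤ s₃.arr 6 e := by
    have hrB : ∀ lo, rnd ρ Q lo < B := by intro lo; unfold rnd; omega
    intro e he
    rcases Nat.lt_or_ge e m with hem | hem
    · have c₁ := cell_lt hK (hφ.lt e hem) (hsrc e hem)
      have c₂ := cell_lt hK (hφ.lt e hem) (hsnk e hem)
      rw [hS.tail e hem, hS.head e hem, hS.mod e hem, hS.flow e hem]
      exact ⟨⟨by omega, by omega, hrB _⟩, min_le_right _ _⟩
    · obtain ⟨a, rfl⟩ := Nat.exists_eq_add_of_le hem
      refine ⟨?_, (hS.lt a (by omega)).le⟩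
      obtain ⟨j, hj, ha⟩ := exists_internal (K := K) (a := a) (by omega)
      have hI := hS.internal j hj
      have hq : j / n < ρ := Nat.div_lt_of_lt_mul (hK ▸ hj)
      rcases ha with rfl | rfl | rfl
      · rw [hI.t₁, hI.h₁, hI.d₁]; exact ⟨by omega, by omega, hrB _⟩
      · rw [← Nat.add_assoc, hI.t₂, hI.h₂, hI.d₂]; exact ⟨by omega, by omega, hrB _⟩
      · rw [← Nat.add_assoc, hI.t₃, hI.h₃, hI.d₃]
        exact ⟨by omega, by generalize j / n = q at hq ⊢; omega, hrB _⟩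
  refine WP_seq ((WP_roundProg (L := 3 * n + 1) (grp := grp n K)
    (md := fun x => rnd ρ Q (grp n K x)) (by rw [hM]; omega)
    (by rw [hM]; exact fun e he => (hbd e he).1) (by rw [hM]; exact hN)
    (by rw [hM]; exact fun e he => (hbd e he).2) ?_
    (by rw [hM]; exact hS.dvd)).frame.mono ?_)
  · intro x
    rw [f₃.arr 7 (by rfl), f₂.arr 7 (by rfl), f₁.arr 7 (by rfl)]; exact hpa x
  rintro t₄ s₄ ⟨f₄, hpa', h01, hint, hexc, ht₄⟩
  rw [hM] at h01 hint hexc ht₄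
  have a2' : s₄.arr 2 = σ.arr 2 := by rw [f₄.arr 2 (by rfl), f₃.arr 2 (by rfl), a2]
  refine (WP_moveProg (m := m) (Q := Q)
    (by rw [f₄.var 0 (by rfl), v' 0 (by omega), h0])
    (by rw [f₄.var 3 (by rfl), v' 3 (by omega), h3]) (by omega) ?_).frame.mono ?_
  · intro e he
    rw [a2']; have := hφ.lt e he; omega
  rintro t₅ s₅ ⟨f₅, hφ', ht₅⟩
  rw [a2'] at hφ'
  refine ⟨hφ.next hK hQ hsrc hsnk hS h01 hint hexc hφ', fun x => ?_, ?_⟩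
  · rw [f₅.arr 7 (by rfl)]; exact hpa' x
  · have hcard : ((Finset.range (m + 3 * K)).filter fun e =>
        s₃.arr 5 e ≠ 0 ∧ s₃.arr 5 e ≠ s₃.arr 6 e).card ≤ 5 * m :=
      (Finset.card_le_card fun e he => by
        simp only [Finset.mem_filter] at he ⊢
        exact ⟨he.1, he.2.1⟩).trans hS.card_le
    have := Nat.mul_le_mul_left (140 * (3 * n + 1) + 100) hcard
    omega

end

/-! ### Feasibility and the lower bound -/

namespace Instance
variable {m n : ℕ} (I : Instance m n) {k : ℝ} {μ : ℕ}

theorem sum_size_eq (hs : I.UniformSize k) (s : Finset (Fin m)) :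
    ∑ p ∈ s, I.size p = s.card * k := by
  rw [Finset.sum_congr rfl fun p _ => hs p, Finset.sum_const, nsmul_eq_mul]

theorem card_source_eq_zero_or (hk : 0 < k) (hs : I.UniformSize k) (w : Fin n) :
    (Finset.univ.filter fun p => I.source p = w).card = 0 ∨ 1 ≤ ⌊I.carryOut w / k⌋₊ := by
  rw [or_iff_not_imp_left, ← Ne, Finset.card_ne_zero]
  rintro ⟨p, hp⟩
  have hp := (Finset.mem_filter.1 hp).2
  refine Nat.le_floor ?_
  rw [le_div_iff₀ hk, Nat.cast_one, one_mul, ← hs p, ← hp]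
  exact I.size_le_carryOut p

theorem card_sink_eq_zero_or (hk : 0 < k) (hs : I.UniformSize k) (w : Fin n) :
    (Finset.univ.filter fun p => I.sink p = w).card = 0 ∨ 1 ≤ ⌊I.carryIn w / k⌋₊ := by
  rw [or_iff_not_imp_left, ← Ne, Finset.card_ne_zero]
  rintro ⟨p, hp⟩
  have hp := (Finset.mem_filter.1 hp).2
  refine Nat.le_floor ?_
  rw [le_div_iff₀ hk, Nat.cast_one, one_mul, ← hs p, ← hp]
  exact I.size_le_carryIn p

theorem ceil_div_le_iff {a d X : ℕ} (h : a = 0 ∨ 1 ≤ d) :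
    ⌈(a : ℝ) / (d : ℝ)⌉₊ ≤ X ↔ a ≤ X * d := by
  rw [Nat.ceil_le]
  rcases Nat.eq_zero_or_pos d with rfl | hd
  · have : a = 0 := by omega
    simp [this]
  · rw [div_le_iff₀ (by exact_mod_cast hd)]
    exact_mod_cast Iff.rfl

/-- `ρ_max` is the least number of rounds that suffices for every warehouse. -/
theorem rhoMax_le_iff (hk : 0 < k) (hs : I.UniformSize k) (X : ℕ) :
    I.rhoMax k ≤ X ↔ ∀ w,
      (Finset.univ.filter fun p => I.source p = w).card ≤ X * ⌊I.carryOut w / k⌋₊ ∧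
      (Finset.univ.filter fun p => I.sink p = w).card ≤ X * ⌊I.carryIn w / k⌋₊ := by
  unfold rhoMax rho
  rw [Finset.sup_le_iff]
  simp only [Finset.mem_univ, true_imp_iff, max_le_iff,
    ceil_div_le_iff (I.card_source_eq_zero_or hk hs _),
    ceil_div_le_iff (I.card_sink_eq_zero_or hk hs _)]

/-- The lower bound: all products are sent in the rounds from `0` to the completion time
minus `μ`. -/
theorem rhoMax_add_le (hm : 1 ≤ m) (hk : 0 < k) (hs : I.UniformSize k) (hμ : I.UniformTransit μ)
    {ψ : Fin m → ℕ} (hψ : I.Feasible ψ) : I.rhoMax k + μ - 1 ≤ I.completionTime ψ := by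
  have hT : ∀ p, ψ p + μ ≤ I.completionTime ψ := by
    intro p
    rw [← hμ p]
    exact Finset.le_sup (f := fun p => ψ p + I.transit p) (Finset.mem_univ p)
  have h0 := hT ⟨0, hm⟩
  have h1 : I.rhoMax k ≤ I.completionTime ψ + 1 - μ := by
    rw [I.rhoMax_le_iff hk hs]
    intro w
    constructor
    · rw [Finset.card_eq_sum_card_fiberwise (f := ψ)
        (t := Finset.range (I.completionTime ψ + 1 - μ))]
      · refine (Finset.sum_le_card_nsmul _ _ ⌊I.carryOut w / k⌋₊ fun θ _ => ?_).trans
          (by simp)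
        refine Nat.le_floor ?_
        rw [le_div_iff₀ hk, ← I.sum_size_eq hs, Finset.filter_filter]
        exact hψ.1 θ w
      · intro p _
        have := hT p
        simp only [Finset.coe_range, Set.mem_Iio]
        omega
    · rw [Finset.card_eq_sum_card_fiberwise (f := ψ)
        (t := Finset.range (I.completionTime ψ + 1 - μ))]
      · refine (Finset.sum_le_card_nsmul _ _ ⌊I.carryIn w / k⌋₊ fun θ _ => ?_).trans
          (by simp)
        refine Nat.le_floor ?_
        rw [le_div_iff₀ hk, ← I.sum_size_eq hs, Finset.filter_filter]
        refine le_of_eq_of_le (Finset.sum_congr (Finset.filter_congr fun p _ => ?_)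
          fun _ _ => rfl) (hψ.2.1 (θ + μ) w)
        rw [hμ p, add_left_inj]
      · intro p _
        have := hT p
        simp only [Finset.coe_range, Set.mem_Iio]
        omega
  omega

/-- A schedule that respects the carry-out and carry-in capacities also respects the capacity of a
warehouse, if in all rounds at least as many products leave it as are sent to it, or the other way
round in all rounds. -/
theorem feasible_of_counts (hk : 0 ≤ k) (hs : I.UniformSize k) (hμ : I.UniformTransit μ)
    {φ : Fin m → ℕ}
    (hA : ∀ w lo, ((Finset.univ.filter fun p => φ p = lo ∧ I.source p = w).card : ℝ) * k ≤
      I.carryOut w)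
    (hB : ∀ w lo, ((Finset.univ.filter fun p => φ p = lo ∧ I.sink p = w).card : ℝ) * k ≤
      I.carryIn w)
    (hsign : ∀ w, (∀ lo, (Finset.univ.filter fun p => φ p = lo ∧ I.source p = w).card ≤
        (Finset.univ.filter fun p => φ p = lo ∧ I.sink p = w).card) ∨
      (∀ lo, (Finset.univ.filter fun p => φ p = lo ∧ I.sink p = w).card ≤
        (Finset.univ.filter fun p => φ p = lo ∧ I.source p = w).card)) :
    I.Feasible φ := by
  have hmono : ∀ s t : Finset (Fin m), s ⊆ t → ∑ p ∈ s, I.size p ≤ ∑ p ∈ t, I.size p :=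
    fun s t h => Finset.sum_le_sum_of_subset_of_nonneg h fun p _ _ => I.size_nonneg p
  refine ⟨fun θ w => ?_, fun θ w => ?_, fun θ w => ?_⟩
  · refine le_of_eq_of_le ?_ (hA w θ)
    rw [← I.sum_size_eq hs]
    exact Finset.sum_congr (Finset.filter_congr fun p _ => and_comm) fun _ _ => rfl
  · refine le_trans ?_ (hB w (θ - μ))
    rw [← I.sum_size_eq hs]
    refine hmono _ _ fun p hp => ?_
    simp only [Finset.mem_filter, Finset.mem_univ, true_and, hμ p] at hp ⊢
    exact ⟨by omega, hp.1⟩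
  · -- a product that has arrived at time `θ` was sent before `θ`, as transit times are positive
    have harr : ∑ p with I.sink p = w ∧ φ p + I.transit p ≤ θ, I.size p ≤
        ((Finset.univ.filter fun p => I.sink p = w ∧ φ p < θ).card : ℝ) * k := by
      rw [← I.sum_size_eq hs]
      refine hmono _ _ fun p hp => ?_
      have := I.transit_pos p
      simp only [Finset.mem_filter, Finset.mem_univ, true_and] at hp ⊢
      exact ⟨hp.1, by omega⟩
    have hsum : ∀ (f : Fin m → Fin n) (P : ℕ → Prop) [DecidablePred P],
        (Finset.univ.filter fun p => f p = w ∧ P (φ p)).card =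
        ∑ lo ∈ (Finset.range (Finset.univ.sup φ + 1)).filter P,
          (Finset.univ.filter fun p => φ p = lo ∧ f p = w).card := by
      intro f P _
      rw [Finset.card_eq_sum_card_fiberwise (f := φ)
        (t := (Finset.range (Finset.univ.sup φ + 1)).filter P)]
      · refine Finset.sum_congr rfl fun lo hlo => ?_
        rw [Finset.filter_filter]
        congr 1
        refine Finset.filter_congr fun p _ => ?_
        have hP := (Finset.mem_filter.1 hlo).2
        constructor
        · rintro ⟨⟨h1, -⟩, h2⟩; exact ⟨h2, h1⟩
        · rintro ⟨rfl, h2⟩; exact ⟨⟨h2, hP⟩, rfl⟩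
      · intro p hp
        have h1 := Finset.le_sup (f := φ) (Finset.mem_univ p)
        have h2 := (Finset.mem_filter.1 hp).2.2
        simp only [Finset.coe_filter, Finset.mem_range, Set.mem_ofPred_eq]
        exact ⟨by omega, h2⟩
    have hsplit : ∀ f : Fin m → Fin n,
        (Finset.univ.filter fun p => f p = w ∧ θ ≤ φ p).card +
        (Finset.univ.filter fun p => f p = w ∧ φ p < θ).card =
        (Finset.univ.filter fun p => f p = w).card := by
      intro f
      rw [← Finset.filter_filter, ← Finset.filter_filter,
        ← Finset.card_filter_add_card_filter_not (s := Finset.univ.filter fun p => f p = w)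
          (fun p => θ ≤ φ p)]
      simp only [not_le]
    have hdep : ∑ p with I.source p = w ∧ θ ≤ φ p, I.size p =
        ((Finset.univ.filter fun p => I.source p = w ∧ θ ≤ φ p).card : ℝ) * k :=
      I.sum_size_eq hs _
    rw [hdep]
    refine (add_le_add le_rfl harr).trans ?_
    rw [← add_mul]
    rcases hsign w with h | h
    · refine le_trans ?_ (I.final_le_cap w)
      rw [I.sum_size_eq hs, ← hsplit I.sink]
      push_cast
      refine mul_le_mul_of_nonneg_right ?_ hk
      gcongr 1
      rw [hsum I.source (fun x => θ ≤ x), hsum I.sink (fun x => θ ≤ x)]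
      exact_mod_cast Finset.sum_le_sum fun lo _ => h lo
    · refine le_trans ?_ (I.initial_le_cap w)
      rw [I.sum_size_eq hs, ← hsplit I.source]
      push_cast
      refine mul_le_mul_of_nonneg_right ?_ hk
      gcongr 1
      rw [hsum I.source (fun x => x < θ), hsum I.sink (fun x => x < θ)]
      exact_mod_cast Finset.sum_le_sum fun lo _ => h lo

end Instance

theorem toArray_apply {α : Type} [Zero α] {k : ℕ} (f : Fin k → α) (i : Fin k) :
    toArray f i = f i := by
  simp [toArray]

theorem card_filter_fin {m : ℕ} (P : ℕ → Prop) [DecidablePred P] :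
    (Finset.univ.filter fun p : Fin m => P p).card = ((Finset.range m).filter P).card := by
  rw [Finset.card_filter, Finset.card_filter,
    Fin.sum_univ_eq_sum_range (fun i => if P i then 1 else 0)]

theorem cnt_eq_card {m n : ℕ} (f : Fin m → Fin n) (φ : ℕ → ℕ) (lo : ℕ) (w : Fin n) :
    cnt m (toArray fun p => (f p : ℕ)) φ lo w =
      (Finset.univ.filter fun p : Fin m => φ p = lo ∧ f p = w).card := by
  rw [cnt, ← card_filter_fin]
  congr 1
  refine Finset.filter_congr fun p _ => ?_
  rw [toArray_apply, Fin.ext_iff]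

theorem card_eq_card_fin {m n : ℕ} (f : Fin m → Fin n) (w : Fin n) :
    ((Finset.range m).filter fun e => toArray (fun p => (f p : ℕ)) e = w).card =
      (Finset.univ.filter fun p : Fin m => f p = w).card := by
  rw [← card_filter_fin]
  congr 1
  refine Finset.filter_congr fun p _ => ?_
  rw [toArray_apply, Fin.ext_iff]

/-- Groups of a single round are a feasible schedule. -/
theorem IsLabelling.feasible {m n ρ : ℕ} {I : Instance m n} {k : ℝ} {μ : ℕ} {DA DB φ : ℕ → ℕ}
    (hk : 0 < k) (hs : I.UniformSize k) (hμ : I.UniformTransit μ)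
    (h : IsLabelling m n ρ 1 (toArray fun p => (I.source p : ℕ)) (toArray fun p => (I.sink p : ℕ))
      DA DB φ)
    (hDA : ∀ w : Fin n, DA w = ⌊I.carryOut w / k⌋₊)
    (hDB : ∀ w : Fin n, DB w = ⌊I.carryIn w / k⌋₊) :
    I.Feasible fun p => φ p := by
  have hzero : ∀ (f : Fin m → Fin n) w lo, ρ ≤ lo →
      (Finset.univ.filter fun p : Fin m => φ p = lo ∧ f p = w).card = 0 := by
    intro f w lo hlo
    rw [Finset.card_eq_zero, Finset.filter_eq_empty_iff]
    rintro p - ⟨rfl, -⟩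
    exact absurd (h.lt p p.2) (by omega)
  refine I.feasible_of_counts hk.le hs hμ (fun w lo => ?_) (fun w lo => ?_) (fun w => ?_)
  · rcases Nat.lt_or_ge lo ρ with hlo | hlo
    · have h1 := (h.out lo hlo w w.2).trans (Nat.mul_le_mul_right _ (min_le_left 1 _))
      rw [one_mul, cnt_eq_card, hDA, Nat.le_floor_iff (div_nonneg (I.carryOut_nonneg w) hk.le),
        le_div_iff₀ hk] at h1
      exact h1
    · rw [hzero _ _ _ hlo]; simpa using I.carryOut_nonneg w
  · rcases Nat.lt_or_ge lo ρ with hlo | hlo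
    · have h1 := (h.inn lo hlo w w.2).trans (Nat.mul_le_mul_right _ (min_le_left 1 _))
      rw [one_mul, cnt_eq_card, hDB, Nat.le_floor_iff (div_nonneg (I.carryIn_nonneg w) hk.le),
        le_div_iff₀ hk] at h1
      exact h1
    · rw [hzero _ _ _ hlo]; simpa using I.carryIn_nonneg w
  · refine (h.sign w w.2).imp (fun h1 lo => ?_) (fun h1 lo => ?_)
    all_goals
      rcases Nat.lt_or_ge lo ρ with hlo | hlo
      · rw [← cnt_eq_card, ← cnt_eq_card]; exact h1 lo hlo
      · rw [hzero _ _ _ hlo, hzero _ _ _ hlo]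

/-! ### The complete program -/

/-- For the warehouse in the word variable `16`, raise the word variable `2` to the number of rounds
that is necessary for the products whose entry in the word array `f` is this warehouse, when its
capacity is found in the real array `c`.  Real numbers cannot be rounded, so the number of products
that fit into the capacity is found by comparisons, in the word variable `17`; the search ends at
`m`, which is as good as any larger number and keeps the time in `O(m)`. -/
def sideProg (f c : ℕ) : Program :=
  .seq (.set 17 (cn 0))
  (.seq (.loop (.and (.lt (vr 17) (vr 0))
      (.rle (.mul (.word (.add (vr 17) (cn 1))) (.get 0 (cn 0))) (.get c (vr 16))))
    (.set 17 (.add (vr 17) (cn 1))))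
  (.seq (.set 18 (cn 0))
  (.seq (.forLoop 19 (vr 0)
    (.ite (.eq (gt f (vr 19)) (vr 16)) (.set 18 (.add (vr 18) (cn 1))) .skip))
  (.seq (.set 18 (.div (.sub (.add (vr 18) (vr 17)) (cn 1)) (vr 17)))
    (.ite (.lt (vr 2) (vr 18)) (.set 2 (vr 18)) .skip)))))

/-- Compute `ρ_max` in the word variable `2`. -/
def rhoProg : Program := .forLoop 16 (vr 1) (.seq (sideProg 0 3) (sideProg 1 4))

/-- The algorithm: if the products have size zero, all of them are sent at time zero.  Otherwise
they form one group at first, and `Q` runs from the least power of two that is at least `ρ_max` down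
to `1`. -/
def mainProg : Program :=
  .ite (.rle (.get 0 (cn 0)) (.word (cn 0))) .skip
  (.seq rhoProg
  (.seq (.set 3 (cn 1))
  (.seq (.loop (.lt (vr 3) (vr 2)) (.set 3 (.add (vr 3) (vr 3))))
  (.seq (.set 4 (.mul (vr 1) (vr 2)))
  (.seq (.set 5 (.add (vr 0) (.mul (cn 3) (vr 4))))
    (.loop (.lt (cn 1) (vr 3)) (.seq (.set 3 (.div (vr 3) (cn 2))) halvingProg)))))))

/-- A capacity above the number `m` of products may be replaced by `m`. -/
theorem add_sub_one_div_le_iff {a D m d X : ℕ} (hD : D = min m d) (ham : a ≤ m)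
    (h : a = 0 ∨ 1 ≤ d) : (a + D - 1) / D ≤ X ↔ a ≤ X * d := by
  rcases Nat.eq_zero_or_pos D with h0 | h0
  · have : a = 0 := by omega
    subst this; simp [h0]
  · rw [← Nat.lt_succ_iff, Nat.div_lt_iff_lt_mul h0, Nat.succ_mul]
    rcases Nat.eq_zero_or_pos X with rfl | hX
    · simp; omega
    · have h1 : D ≤ X * D := Nat.le_mul_of_pos_left _ hX
      have h2 : d ≤ X * d := Nat.le_mul_of_pos_left _ hX
      rcases le_total m d with hmd | hmd
      · rw [min_eq_left hmd] at hD
        omega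
      · rw [min_eq_right hmd] at hD
        subst hD
        omega

section
variable {B m n : ℕ} {σ : Store} {k : ℝ}

theorem WP_sideProg {f c : ℕ} (h0 : σ.var 0 = m) (hm : 1 ≤ m) (hk : 0 < k) (hk' : σ.rarr 0 0 = k)
    (hc : 0 ≤ σ.rarr c (σ.var 16)) (hB : 2 * m < B)
    (hd : ((Finset.range m).filter fun e => σ.arr f e = σ.var 16).card = 0 ∨
      1 ≤ ⌊σ.rarr c (σ.var 16) / k⌋₊) :
    WP B (sideProg f c) σ fun t σ' =>
      (∀ X, σ'.var 2 ≤ X ↔ σ.var 2 ≤ X ∧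
        ((Finset.range m).filter fun e => σ.arr f e = σ.var 16).card ≤
          X * ⌊σ.rarr c (σ.var 16) / k⌋₊) ∧ t ≤ 100 * m + 100 := by
  have hfl : ∀ D : ℕ, D ≤ ⌊σ.rarr c (σ.var 16) / k⌋₊ ↔ (D : ℝ) * k ≤ σ.rarr c (σ.var 16) := by
    intro D
    rw [Nat.le_floor_iff (div_nonneg hc hk.le), le_div_iff₀ hk]
  generalize hdd : ⌊σ.rarr c (σ.var 16) / k⌋₊ = d at *
  refine WP_seq (WP_set (by simp [WordExp.eval]; omega) ?_)
  refine WP_seq ((WP_loop (fun s => s.var 17 ≤ m ∧ s.var 17 ≤ d)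
    (fun s => 30 * (m - s.var 17)) (by simp [WordExp.eval]) ?_).mono ?_)
  · rintro s hf ⟨hI₁, hI₂⟩ hb
    have e0 : s.var 0 = m := (hf.var 0 (by rfl)).trans (by simpa using h0)
    have e16 : s.var 16 = σ.var 16 := (hf.var 16 (by rfl)).trans (by simp)
    have er : s.rarr = σ.rarr := (hf.rarr (by rfl)).trans (by simp)
    simp only [Test.Holds, holds_lt, WordExp.eval, RealExp.eval, e0, e16, er, hk'] at hb
    have h2 := (hfl (s.var 17 + 1)).2 hb.2
    refine WP_set (by simp [WordExp.eval]; omega) ⟨?_, ?_⟩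
    · simp [WordExp.eval]; omega
    · simp [WordExp.eval, WordExp.cost, Test.cost, Test.lt, RealExp.cost]; omega
  rintro t₁ s₁ ⟨f₁, ⟨hI₁, hI₂⟩, hb, ht₁⟩
  have e0 : s₁.var 0 = m := (f₁.var 0 (by rfl)).trans (by simpa using h0)
  have e16 : s₁.var 16 = σ.var 16 := (f₁.var 16 (by rfl)).trans (by simp)
  have e2 : s₁.var 2 = σ.var 2 := (f₁.var 2 (by rfl)).trans (by simp)
  have er : s₁.rarr = σ.rarr := (f₁.rarr (by rfl)).trans (by simp)
  have ea : s₁.arr = σ.arr := by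
    funext a; exact (f₁.arr a (by rfl)).trans (by simp)
  have hD : s₁.var 17 = min m d := by
    simp only [Test.Holds, holds_lt, WordExp.eval, RealExp.eval, e0, e16, er, hk'] at hb
    have := (hfl (s₁.var 17 + 1)).not
    by_contra hne
    have h3 : s₁.var 17 < m ∧ s₁.var 17 + 1 ≤ d := by omega
    exact hb ⟨h3.1, (hfl _).1 h3.2⟩
  refine WP_seq (WP_set (by simp [WordExp.eval]; omega) ?_)
  have hcard : ∀ i, ((Finset.range i).filter fun e => σ.arr f e = σ.var 16).card ≤ i := fun i =>
    (Finset.card_filter_le _ _).trans (by simp)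
  refine WP_seq ((WP_forLoop (N := vr 0) m (fun _ => 20)
    (fun i s => s.var 18 = ((Finset.range i).filter fun e => σ.arr f e = σ.var 16).card)
    (by omega) (by rfl) (fun s k hf _ => (hf.var 0 (by rfl)).trans (by simpa using e0))
    (by simp [WordExp.eval]) (fun k s v h => by simpa using h) ?_).mono ?_)
  · intro i s hi hf hsi hI
    have e16' : s.var 16 = σ.var 16 := (hf.var 16 (by rfl)).trans (by simpa using e16)
    have ea' : s.arr f = σ.arr f := (hf.arr f (by rfl)).trans (by simp [ea])
    have := hcard i
    refine WP_ite (fun h => WP_set ?_ ⟨?_, ?_⟩) (fun h => WP_skip ⟨?_, ?_⟩) <;>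
      simp only [holds_eq, WordExp.eval, hsi, e16', ea'] at h
    · simp [WordExp.eval, hI]; omega
    · rw [Finset.range_add_one, Finset.filter_insert, if_pos h, Finset.card_insert_of_notMem
        (by simp)]
      simp [WordExp.eval, hI]
    · simp [WordExp.cost, Test.cost, Test.eq]
    · rw [Finset.range_add_one, Finset.filter_insert, if_neg h]
      exact hI
    · simp [WordExp.cost, Test.cost, Test.eq]
  rintro t₂ s₂ ⟨f₂, hI, ht₂⟩
  have e17 : s₂.var 17 = min m d := (f₂.var 17 (by rfl)).trans (by simpa using hD)
  have e2' : s₂.var 2 = σ.var 2 := (f₂.var 2 (by rfl)).trans (by simpa using e2)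
  have ham := hcard m
  generalize ((Finset.range m).filter fun e => σ.arr f e = σ.var 16).card = a at *
  have hiff := fun X => add_sub_one_div_le_iff (X := X) rfl ham hd
  have hle : (a + min m d - 1) / min m d ≤ a :=
    (hiff a).2 (by rcases hd with rfl | h; · simp
                   · exact Nat.le_mul_of_pos_right _ h)
  refine WP_seq (WP_set (by simp only [WordExp.eval, hI, e17]; omega) ?_)
  simp only [WordExp.eval, hI, e17]
  refine WP_ite (fun h => WP_set ?_ ⟨fun X => ?_, ?_⟩) (fun h => WP_skip ⟨fun X => ?_, ?_⟩) <;>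
    simp [holds_lt, WordExp.eval, e2'] at h
  · simp [WordExp.eval]; omega
  · have := hiff X
    simp [WordExp.eval]; omega
  · simp [WordExp.cost, Test.cost, Test.lt, RealExp.cost, WordExp.eval] at ht₁ ht₂ ⊢; omega
  · have := hiff X
    simp [e2']; omega
  · simp [WordExp.cost, Test.cost, Test.lt, RealExp.cost, WordExp.eval] at ht₁ ht₂ ⊢; omega

theorem WP_rhoProg (h0 : σ.var 0 = m) (h1 : σ.var 1 = n) (h2 : σ.var 2 = 0) (hm : 1 ≤ m)
    (hk : 0 < k) (hk' : σ.rarr 0 0 = k) (hc : ∀ w < n, 0 ≤ σ.rarr 3 w ∧ 0 ≤ σ.rarr 4 w)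
    (hB : 2 * m + n < B)
    (hd₁ : ∀ w < n, ((Finset.range m).filter fun e => σ.arr 0 e = w).card = 0 ∨
      1 ≤ ⌊σ.rarr 3 w / k⌋₊)
    (hd₂ : ∀ w < n, ((Finset.range m).filter fun e => σ.arr 1 e = w).card = 0 ∨
      1 ≤ ⌊σ.rarr 4 w / k⌋₊) :
    WP B rhoProg σ fun t σ' =>
      (∀ X, σ'.var 2 ≤ X ↔ ∀ w < n,
        ((Finset.range m).filter fun e => σ.arr 0 e = w).card ≤ X * ⌊σ.rarr 3 w / k⌋₊ ∧
        ((Finset.range m).filter fun e => σ.arr 1 e = w).card ≤ X * ⌊σ.rarr 4 w / k⌋₊) ∧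
      t ≤ n * (200 * m + 210) + 10 := by
  refine (WP_forLoop (N := vr 1) n (fun _ => 200 * m + 200)
    (fun i s => ∀ X, s.var 2 ≤ X ↔ ∀ w < i,
        ((Finset.range m).filter fun e => σ.arr 0 e = w).card ≤ X * ⌊σ.rarr 3 w / k⌋₊ ∧
        ((Finset.range m).filter fun e => σ.arr 1 e = w).card ≤ X * ⌊σ.rarr 4 w / k⌋₊)
    (by omega) (by rfl) (fun s k hf _ => (hf.var 1 (by rfl)).trans h1) (by simp [h2])
    (fun k s v h => by simpa using h) ?_).mono ?_
  · intro i s hi hf hsi hI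
    have e0 : s.var 0 = m := (hf.var 0 (by rfl)).trans h0
    have er : s.rarr = σ.rarr := hf.rarr (by rfl)
    have a0 : s.arr 0 = σ.arr 0 := hf.arr 0 (by rfl)
    have a1 : s.arr 1 = σ.arr 1 := hf.arr 1 (by rfl)
    refine WP_seq ((WP_sideProg e0 hm hk (by rw [er, hk']) (by rw [er, hsi]; exact (hc i hi).1)
      (by omega) (by rw [a0, er, hsi]; exact hd₁ i hi)).frame.mono ?_)
    rintro t₁ s₁ ⟨f₁, hI₁, ht₁⟩
    have e0' : s₁.var 0 = m := (f₁.var 0 (by rfl)).trans e0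
    have e16 : s₁.var 16 = i := (f₁.var 16 (by rfl)).trans hsi
    have er' : s₁.rarr = σ.rarr := (f₁.rarr (by rfl)).trans er
    have a1' : s₁.arr 1 = σ.arr 1 := (f₁.arr 1 (by rfl)).trans a1
    refine (WP_sideProg e0' hm hk (by rw [er', hk']) (by rw [er', e16]; exact (hc i hi).2)
      (by omega) (by rw [a1', er', e16]; exact hd₂ i hi)).mono ?_
    rintro t₂ s₂ ⟨hI₂, ht₂⟩
    refine ⟨fun X => ?_, by omega⟩
    rw [hI₂, hI₁, hI, a0, a1', er, er', hsi, e16]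
    constructor
    · rintro ⟨⟨h3, h4⟩, h5⟩ w hw
      rcases Nat.lt_succ_iff_lt_or_eq.1 hw with h | rfl
      · exact h3 w h
      · exact ⟨h4, h5⟩
    · intro h
      exact ⟨⟨fun w hw => h w (by omega), (h i (by omega)).1⟩, (h i (by omega)).2⟩
  · rintro t s ⟨-, h, ht⟩
    refine ⟨h, ?_⟩
    simp [WordExp.cost] at ht
    have : n * (200 * m + 200 + 1 + 7) + 1 + 5 ≤ n * (200 * m + 210) + 10 := by
      have := Nat.mul_le_mul_left n (show 200 * m + 200 + 1 + 7 ≤ 200 * m + 210 by omega)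
      omega
    omega

end

/-! ### Correctness and running time of the algorithm -/

section
variable {B m n : ℕ} {k : ℝ}

/-- The labelling with which the algorithm starts: all products are in one group of `ρ` rounds. -/
theorem IsLabelling.initial {ρ Q : ℕ} {src snk DA DB φ : ℕ → ℕ} (hρ : 0 < ρ) (hQ : ρ ≤ Q)
    (hφ : ∀ e, φ e = 0)
    (h : ∀ w < n, ((Finset.range m).filter fun e => src e = w).card ≤ ρ * DA w ∧
        ((Finset.range m).filter fun e => snk e = w).card ≤ ρ * DB w) :
    IsLabelling m n ρ Q src snk DA DB φ := by
  have hcnt : ∀ (f : ℕ → ℕ) lo w, cnt m f φ lo w =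
      if lo = 0 then ((Finset.range m).filter fun e => f e = w).card else 0 := by
    intro f lo w
    unfold cnt
    split_ifs with hlo
    · simp [hφ, hlo]
    · rw [Finset.card_eq_zero, Finset.filter_eq_empty_iff]
      rintro e - ⟨h1, -⟩
      rw [hφ] at h1; omega
  refine ⟨fun e _ => by rwa [hφ], fun e _ => by rw [hφ]; exact dvd_zero _, fun lo _ w hw => ?_,
    fun lo _ w hw => ?_, fun w _ => ?_⟩
  · rw [hcnt]
    split_ifs with hlo
    · rw [hlo, Nat.sub_zero, min_eq_right hQ]; exact (h w hw).1
    · exact Nat.zero_le _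
  · rw [hcnt]
    split_ifs with hlo
    · rw [hlo, Nat.sub_zero, min_eq_right hQ]; exact (h w hw).2
    · exact Nat.zero_le _
  · refine (le_total ((Finset.range m).filter fun e => src e = w).card
      ((Finset.range m).filter fun e => snk e = w).card).imp (fun h lo _ => ?_) (fun h lo _ => ?_)
    all_goals
      rw [hcnt, hcnt]
      split_ifs
      · exact h
      · exact le_rfl

/-- The bound for the steps of a halving step, plus those of the loop that calls it. -/
theorem halving_cost_le {ρ K : ℕ} (hm : 1 ≤ m) (hn : 1 ≤ n) (hρ : ρ ≤ m) (hK : K = n * ρ) :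
    400 * m + 300 * K + (140 * (3 * n + 1) + 100) * (5 * m) + 70 ≤ 4100 * (m * n) := by
  have h1 : K ≤ m * n := by rw [hK, Nat.mul_comm]; exact Nat.mul_le_mul_right _ hρ
  have h2 : m ≤ m * n := Nat.le_mul_of_pos_right _ hn
  have h3 : 1 ≤ m * n := Nat.mul_pos hm hn
  have h4 : (140 * (3 * n + 1) + 100) * (5 * m) = 2100 * (m * n) + 1200 * m := by ring
  omega

theorem WP_mainProg (I : Instance m n) (hm : 1 ≤ m) (hk : 0 < k) (hs : I.UniformSize k)
    (hB : 16 * ((m + 1) * (n + 1)) ≤ B) :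
    WP B mainProg I.input fun t σ' =>
      (∃ DA DB : ℕ → ℕ, (∀ w : Fin n, DA w = ⌊I.carryOut w / k⌋₊) ∧
        (∀ w : Fin n, DB w = ⌊I.carryIn w / k⌋₊) ∧
        IsLabelling m n (I.rhoMax k) 1 (toArray fun p => (I.source p : ℕ))
          (toArray fun p => (I.sink p : ℕ)) DA DB (σ'.arr 2)) ∧
      ∃ j, 2 ^ j < 2 * m ∧ t ≤ 5000 * (m * n) * (j + 1) := by
  have hn : 1 ≤ n := by have := (I.source ⟨0, hm⟩).2; omega
  have hsize : toArray I.size 0 = k := by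
    have := toArray_apply I.size ⟨0, hm⟩
    rw [hs] at this; exact this
  have hBmn : 16 * (m * n) + 16 * m + 16 * n + 16 ≤ B := by
    refine le_trans (le_of_eq ?_) hB; ring
  refine WP_ite (fun h => ?_) (fun _ => ?_)
  · exfalso
    simp [Test.Holds, RealExp.eval, WordExp.eval, Instance.input, hsize] at h
    linarith
  have harr : ∀ (f : Fin n → ℝ) (w : ℕ) (hw : w < n), toArray f w = f ⟨w, hw⟩ :=
    fun f w hw => toArray_apply f ⟨w, hw⟩
  refine WP_seq ((WP_rhoProg (m := m) (n := n) (k := k) rfl rfl rfl hm hk hsize ?_ (by omega) ?_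
    ?_).frame.mono ?_)
  · intro w hw
    simp only [Instance.input, harr _ w hw]
    exact ⟨I.carryOut_nonneg _, I.carryIn_nonneg _⟩
  · intro w hw
    simp only [Instance.input, harr _ w hw]
    rw [card_eq_card_fin I.source ⟨w, hw⟩]
    exact I.card_source_eq_zero_or hk hs _
  · intro w hw
    simp only [Instance.input, harr _ w hw]
    rw [card_eq_card_fin I.sink ⟨w, hw⟩]
    exact I.card_sink_eq_zero_or hk hs _
  rintro t₁ s₁ ⟨f₁, hρ₁, ht₁⟩
  have hρ : s₁.var 2 = I.rhoMax k := by
    refine eq_of_forall_ge_iff fun X => ?_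
    rw [hρ₁, I.rhoMax_le_iff hk hs]
    simp only [Instance.input]
    constructor
    · intro h w
      have := h w w.2
      rwa [card_eq_card_fin, card_eq_card_fin, toArray_apply, toArray_apply] at this
    · intro h w hw
      have := h ⟨w, hw⟩
      rw [harr _ w hw, harr _ w hw]
      rwa [← card_eq_card_fin, ← card_eq_card_fin] at this
  generalize hr : I.rhoMax k = ρ at *
  have hρpos : 0 < ρ := by
    by_contra h0
    have h1 := ((I.rhoMax_le_iff hk hs 0).1 (by omega) (I.source ⟨0, hm⟩)).1
    simp only [Nat.zero_mul, Nat.le_zero, Finset.card_eq_zero, Finset.filter_eq_empty_iff] at h1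
    exact h1 (Finset.mem_univ ⟨0, hm⟩) rfl
  have hρm : ρ ≤ m := by
    rw [← hr, I.rhoMax_le_iff hk hs]
    intro w
    constructor
    · rcases I.card_source_eq_zero_or hk hs w with h | h
      · omega
      · exact (Finset.card_filter_le _ _).trans (by
          rw [Finset.card_univ, Fintype.card_fin]; exact Nat.le_mul_of_pos_right _ h)
    · rcases I.card_sink_eq_zero_or hk hs w with h | h
      · omega
      · exact (Finset.card_filter_le _ _).trans (by
          rw [Finset.card_univ, Fintype.card_fin]; exact Nat.le_mul_of_pos_right _ h)
  have hK : n * ρ ≤ m * n := by rw [Nat.mul_comm]; exact Nat.mul_le_mul_right _ hρm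
  refine WP_seq (WP_set (by simp [WordExp.eval]; omega) ?_)
  refine WP_seq ((WP_loop (fun s => ∃ j, s.var 3 = 2 ^ j ∧ s.var 3 < 2 * ρ)
    (fun s => 10 * (2 * ρ - s.var 3)) ⟨0, by simp [WordExp.eval], by simp [WordExp.eval]; omega⟩
    ?_).mono ?_)
  · rintro s hf ⟨j, hj, hlt⟩ hb
    have e2 : s.var 2 = ρ := (hf.var 2 (by rfl)).trans (by simpa using hρ)
    simp only [holds_lt, WordExp.eval, e2] at hb
    have hpos : 0 < s.var 3 := by rw [hj]; positivity
    refine WP_set (by simp [WordExp.eval]; omega) ⟨⟨j + 1, ?_, ?_⟩, ?_⟩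
    · simp only [WordExp.eval, Store.setv_var, if_true, hj]; ring
    · simp [WordExp.eval]; omega
    · simp [WordExp.eval, WordExp.cost, Test.cost, Test.lt]; omega
  rintro t₂ s₂ ⟨f₂, ⟨j₀, hj₀, hlt₂⟩, hb₂, ht₂⟩
  have v : ∀ x < 3, s₂.var x = s₁.var x := by
    intro x hx
    rw [f₂.var x (by interval_cases x <;> rfl)]
    simp only [Store.setv_var]; rw [if_neg (by omega)]
  have e2 : s₂.var 2 = ρ := (v 2 (by omega)).trans hρ
  have e0 : s₂.var 0 = m := (v 0 (by omega)).trans (f₁.var 0 (by rfl))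
  have e1 : s₂.var 1 = n := (v 1 (by omega)).trans (f₁.var 1 (by rfl))
  have ea : ∀ a, s₂.arr a = I.input.arr a := by
    intro a; rw [f₂.arr a (by rfl)]; exact f₁.arr a (by rfl)
  simp only [holds_lt, WordExp.eval, e2] at hb₂
  refine WP_seq (WP_set (by simp only [WordExp.eval, e1, e2]; omega) ?_)
  simp only [WordExp.eval, e1, e2]
  refine WP_seq (WP_set (by simp [WordExp.eval, e0]; omega) ?_)
  simp only [WordExp.eval, Store.setv_var, e0]
  norm_num
  obtain ⟨DA, hDA⟩ : ∃ DA : ℕ → ℕ, ∀ w : Fin n, DA w = ⌊I.carryOut w / k⌋₊ :=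
    ⟨fun w => if h : w < n then ⌊I.carryOut ⟨w, h⟩ / k⌋₊ else 0, by simp⟩
  obtain ⟨DB, hDB⟩ : ∃ DB : ℕ → ℕ, ∀ w : Fin n, DB w = ⌊I.carryIn w / k⌋₊ :=
    ⟨fun w => if h : w < n then ⌊I.carryIn ⟨w, h⟩ / k⌋₊ else 0, by simp⟩
  have hinit : IsLabelling m n ρ (s₂.var 3) (I.input.arr 0) (I.input.arr 1) DA DB (s₂.arr 2) := by
    refine IsLabelling.initial hρpos (by omega) (fun e => by rw [ea]; rfl) fun w hw => ?_
    have := (I.rhoMax_le_iff hk hs ρ).1 hr.le ⟨w, hw⟩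
    rw [← hDA, ← hDB, ← card_eq_card_fin, ← card_eq_card_fin] at this
    exact this
  refine (WP_loop (fun s => (∃ j, s.var 3 = 2 ^ j ∧ s.var 3 < 2 * ρ) ∧
      IsLabelling m n ρ (s.var 3) (I.input.arr 0) (I.input.arr 1) DA DB (s.arr 2) ∧
      ∀ x, s.arr 7 x = 0)
    (fun s => 4100 * (m * n) * Nat.log 2 (s.var 3)) ?_ ?_).mono ?_
  · refine ⟨⟨j₀, by simpa using hj₀, by simpa using hlt₂⟩, by simpa using hinit, fun x => ?_⟩
    simp only [Store.setv_arr, ea]; rfl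
  · rintro s hf ⟨⟨j, hj, hlt⟩, hL, hpa⟩ hb
    have w0 : s.var 0 = m := (hf.var 0 (by rfl)).trans (by simpa using e0)
    have w1 : s.var 1 = n := (hf.var 1 (by rfl)).trans (by simpa using e1)
    have w2 : s.var 2 = ρ := (hf.var 2 (by rfl)).trans (by simpa using e2)
    have w4 : s.var 4 = n * ρ := (hf.var 4 (by rfl)).trans (by simp)
    have w5 : s.var 5 = m + 3 * (n * ρ) := (hf.var 5 (by rfl)).trans (by simp)
    have a0 : s.arr 0 = I.input.arr 0 := (hf.arr 0 (by rfl)).trans (by simp [ea])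
    have a1 : s.arr 1 = I.input.arr 1 := (hf.arr 1 (by rfl)).trans (by simp [ea])
    simp only [holds_lt, WordExp.eval] at hb
    obtain ⟨i, rfl⟩ : ∃ i, j = i + 1 := by
      refine Nat.exists_eq_succ_of_ne_zero ?_
      rintro rfl
      simp at hj; omega
    have hhalf : s.var 3 / 2 = 2 ^ i := by rw [hj, pow_succ]; omega
    have hdouble : 2 * 2 ^ i = s.var 3 := by rw [hj, pow_succ]; ring
    have hpos : 0 < 2 ^ i := by positivity
    refine WP_seq (WP_set (by simp [WordExp.eval]; omega) ?_)
    simp only [WordExp.eval, hhalf]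
    refine ((WP_halvingProg (m := m) (n := n) (ρ := ρ) (Q := 2 ^ i) (K := n * ρ) (DA := DA)
      (DB := DB) (by simpa using w0) (by simpa using w1) (by simpa using w2) (by simp)
      (by simpa using w4) (by simpa using w5) rfl hpos (by omega) ?_ ?_ (by simpa using hpa)
      ?_).frame.mono ?_)
    · intro e he
      simp only [Store.setv_arr, a0, Instance.input]
      rw [toArray_apply (fun p => (I.source p : ℕ)) ⟨e, he⟩]; exact (I.source _).2
    · intro e he
      simp only [Store.setv_arr, a1, Instance.input]
      rw [toArray_apply (fun p => (I.sink p : ℕ)) ⟨e, he⟩]; exact (I.sink _).2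
    · simp only [Store.setv_arr, a0, a1, hdouble]; exact hL
    · rintro t s' ⟨f', hL', hpa', ht'⟩
      have e3 : s'.var 3 = 2 ^ i := (f'.var 3 (by rfl)).trans (by simp)
      simp only [Store.setv_arr, a0, a1] at hL'
      refine ⟨⟨⟨i, e3, by omega⟩, by rw [e3]; exact hL', hpa'⟩, ?_⟩
      have hc := halving_cost_le hm hn hρm rfl
      rw [e3, hj, Nat.log_pow (by omega), Nat.log_pow (by omega), Nat.mul_succ]
      simp only [WordExp.cost, Test.cost, Test.lt]
      omega
  · rintro t s ⟨hf, ⟨⟨j, hj, hlt⟩, hL, -⟩, hb, ht⟩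
    have h1 : s.var 3 = 1 := by
      simp only [holds_lt, WordExp.eval] at hb
      have : 0 < s.var 3 := by rw [hj]; positivity
      omega
    rw [h1] at hL
    refine ⟨⟨DA, hDA, DB, hDB, hL⟩, j₀, by rw [← hj₀]; omega, ?_⟩
    simp [hj₀, WordExp.cost, Test.cost, Test.lt, RealExp.cost, WordExp.eval] at ht ht₂ ⊢
    have h2 : m ≤ m * n := Nat.le_mul_of_pos_right _ hn
    have h3 : n ≤ m * n := Nat.le_mul_of_pos_left _ hm
    have h4 : n * (200 * m + 210) = 200 * (m * n) + 210 * n := by ring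
    have h5 : 5000 * (m * n) * (j₀ + 1) = 5000 * (m * n) + 900 * (m * n * j₀) +
      4100 * (m * n) * j₀ := by ring
    have h6 := Nat.zero_le (m * n * j₀)
    omega

/-- The schedule that the program finds for products of positive size. -/
theorem mainProg_spec (I : Instance m n) {μ : ℕ} (hm : 1 ≤ m) (hk : 0 < k) (hs : I.UniformSize k)
    (hμ : I.UniformTransit μ) (hB : 16 * ((m + 1) * (n + 1)) ≤ B) :
    WP B mainProg I.input fun t σ' =>
      I.Feasible (output m σ') ∧ I.completionTime (output m σ') ≤ I.rhoMax k + μ - 1 ∧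
      ∃ j, 2 ^ j < 2 * m ∧ t ≤ 5000 * (m * n) * (j + 1) := by
  refine (WP_mainProg I hm hk hs hB).mono ?_
  rintro t σ' ⟨⟨DA, DB, hDA, hDB, hL⟩, ht⟩
  refine ⟨hL.feasible hk hs hμ hDA hDB, Finset.sup_le fun p _ => ?_, ht⟩
  have := hL.lt p p.2
  rw [hμ p]
  simp only [output]
  omega

end

end Realloc

end

theorem theorem1 :
    -- the minimum completion time equals `ρ_max + μ - 1`
    (∀ (m n : ℕ) (I : Realloc.Instance m n) (k : ℝ) (μ : ℕ),
      1 ≤ m → 0 < k → I.UniformSize k → I.UniformTransit μ →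
      IsLeast {T : ℕ | ∃ φ : Fin m → ℕ, I.Feasible φ ∧ I.completionTime φ = T}
        (I.rhoMax k + μ - 1)) ∧
    -- one program finds an optimal schedule in `O(m n log m)` steps on words of `O(log (m + n))` bits
    (∃ (A : Realloc.Program) (K : ℕ) (C : ℝ),
      ∀ (m n : ℕ) (I : Realloc.Instance m n) (k : ℝ) (μ : ℕ),
        1 ≤ m → I.UniformSize k → I.UniformTransit μ →
        ∃ (t : ℕ) (σ : Realloc.Store),
          Realloc.Exec ((m + n + 1) ^ K) A I.input t σ ∧
          (t : ℝ) ≤ C * ((m : ℝ) * (n : ℝ) * Real.log ((m : ℝ) + 1)) ∧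
          I.IsOptimal (Realloc.output m σ)) := by
  refine ⟨fun m n I k μ hm hk hs hμ => ⟨?_, ?_⟩, Realloc.mainProg, 4, 30000,
    fun m n I k μ hm hs hμ => ?_⟩
  · obtain ⟨t, σ, -, hf, hc, -⟩ := Realloc.mainProg_spec I hm hk hs hμ le_rfl
    exact ⟨_, hf, le_antisymm hc (I.rhoMax_add_le hm hk hs hμ hf)⟩
  · rintro T ⟨ψ, hψ, rfl⟩
    exact I.rhoMax_add_le hm hk hs hμ hψ
  · have hn : 1 ≤ n := by have := (I.source ⟨0, hm⟩).2; omega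
    have hlog2 : (1 : ℝ) / 2 ≤ Real.log 2 := by have := Real.log_two_gt_d9; linarith
    have hlogm : Real.log 2 ≤ Real.log ((m : ℝ) + 1) := by
      refine Real.log_le_log (by norm_num) ?_
      have : (1 : ℝ) ≤ m := by exact_mod_cast hm
      linarith
    have hmn : (1 : ℝ) ≤ (m : ℝ) * n := by exact_mod_cast Nat.mul_pos hm hn
    rcases lt_or_eq_of_le (I.size_nonneg ⟨0, hm⟩) with hk | hk
    · rw [hs] at hk
      have hB : 16 * ((m + 1) * (n + 1)) ≤ (m + n + 1) ^ 4 := by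
        have h1 : (m + 1) * (n + 1) ≤ (m + n + 1) * (m + n + 1) :=
          Nat.mul_le_mul (by omega) (by omega)
        have hn2 : 2 ≤ n := by
          have h1 := I.source_ne_sink ⟨0, hm⟩
          have h2 := (I.source ⟨0, hm⟩).2
          have h3 := (I.sink ⟨0, hm⟩).2
          rw [Ne, Fin.ext_iff] at h1
          omega
        have h2 : 4 * 4 ≤ (m + n + 1) * (m + n + 1) := Nat.mul_le_mul (by omega) (by omega)
        calc 16 * ((m + 1) * (n + 1))
            ≤ ((m + n + 1) * (m + n + 1)) * ((m + n + 1) * (m + n + 1)) := Nat.mul_le_mul h2 h1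
          _ = (m + n + 1) ^ 4 := by ring
      obtain ⟨t, σ, he, hf, hc, j, hj, ht⟩ := Realloc.mainProg_spec I hm hk hs hμ hB
      refine ⟨t, σ, he, ?_, hf, fun ψ hψ => hc.trans (I.rhoMax_add_le hm hk hs hμ hψ)⟩
      have ht' : (t : ℝ) ≤ 5000 * ((m : ℝ) * n) * (j + 1) := by exact_mod_cast ht
      -- from `2 ^ j < 2 * m` the number `j` of halving steps is logarithmic
      have hj' : (j : ℝ) * Real.log 2 ≤ Real.log 2 + Real.log ((m : ℝ) + 1) := by
        rw [← Real.log_pow, ← Real.log_mul (by norm_num) (by positivity)]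
        refine Real.log_le_log (by positivity) ?_
        have : ((2 : ℝ)) ^ j < 2 * m := by exact_mod_cast hj
        linarith
      have hj'' : (j : ℝ) + 1 ≤ 6 * Real.log ((m : ℝ) + 1) := by
        have : (j : ℝ) * (1 / 2) ≤ j * Real.log 2 :=
          mul_le_mul_of_nonneg_left hlog2 (Nat.cast_nonneg j)
        linarith
      calc (t : ℝ) ≤ 5000 * ((m : ℝ) * n) * (j + 1) := ht'
        _ ≤ 5000 * ((m : ℝ) * n) * (6 * Real.log ((m : ℝ) + 1)) := by gcongr
        _ = 30000 * ((m : ℝ) * n * Real.log ((m : ℝ) + 1)) := by ring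
    · rw [hs] at hk
      subst hk
      have hsize : Realloc.toArray I.size 0 = 0 := by
        have := Realloc.toArray_apply I.size ⟨0, hm⟩
        rw [hs] at this; exact this
      refine ⟨_, _, Realloc.Exec.iteTrue _ _ _ _ _ _ ?_ (.skip _), ?_, ?_, fun ψ _ => ?_⟩
      · simp [Realloc.Test.Holds, Realloc.RealExp.eval, Realloc.WordExp.eval,
          Realloc.Instance.input, hsize]
      · have : (1 : ℝ) / 2 ≤ (m : ℝ) * n * Real.log ((m : ℝ) + 1) := by
          nlinarith
        norm_num [Realloc.Test.cost, Realloc.RealExp.cost, Realloc.WordExp.cost]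
        linarith
      · -- nothing is bounded below by products of size zero
        refine ⟨fun θ w => ?_, fun θ w => ?_, fun θ w => ?_⟩
        · rw [I.sum_size_eq hs, mul_zero]; exact I.carryOut_nonneg w
        · rw [I.sum_size_eq hs, mul_zero]; exact I.carryIn_nonneg w
        · rw [I.sum_size_eq hs, I.sum_size_eq hs, mul_zero, mul_zero, add_zero]
          exact I.cap_nonneg w
      · refine Finset.sup_mono_fun fun p _ => ?_
        simp [Realloc.output, Realloc.Instance.input]
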